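/- Let $M$ be a compact isotropy irreducible Riemannian homogeneous space: a Riemannian manifold whose isometry group $G=I(M)$ (with the compact-open topology) is compact, such that the identity component $G_0$ of $G$ acts transitively on $M$, and such that, for a fixed $p\in M$ with isotropy subgroup $K=\{a\in G_0 : a(p)=p\}$, the linear isotropy representation of $K$ on $T_pM$ is irreducible over $\mathbb{R}$ (in particular $T_pM\neq 0$). Equip $G$ with its structure of a Lie transformation group of $M$; let $\mathfrak g$ be its Lie algebra and let $\pi:G_0\to M$, $\pi(a)=a(p)$, so that $M=G_0/K$. There is an $\operatorname{Ad}(G)$-invariant inner product on $\mathfrak g$ for which the induced normal homogeneous metric on $G_0/K=M$ is the given metric of $M$, i.e. $d\pi_e$ maps the orthogonal complement of the Lie algebra $\mathfrak k = \ker d\pi_e$ of $K$ isometrically onto $T_pM$. Fix any such inner product, and equip $G_0$ with the corresponding bi-invariant metric. Let $V_{\mathfrak g}=L^2([0,1],\mathfrak g)$, and let $\Phi_K=\pi\circ\Phi:V_{\mathfrak g}\to M$ be the parallel transport map, where $\Phi(u)=E_u(1)$ and $E_u\in H^1([0,1],G)$ is the solution of $E_u^{-1}E_u'=u$, $E_u(0)=e$.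 Let $N$ be a closed (embedded) submanifold of $M$, let $S$ be a closed subgroup of $G$ with $aSa^{-1}=S$ for all $a\in G_0$, and let $S_p=\{s\in S: s(p)=p\}$. Then the following are equivalent: (i) $N$ is an $S$-weakly reflective submanifold of $M$; (ii) $\pi^{-1}(N)$ is an $(S\times S_p)$-weakly reflective submanifold of $G_0$, where $(b_1,b_2)$ acts by $a\mapsto b_1ab_2^{-1}$ and only those elements of $S\times S_p$ are used that preserve $G_0$; (iii) $\Phi_K^{-1}(N)$ is a $P(S,S\times S_p)$-weakly reflective PF submanifold of $V_{\mathfrak g}$, where $P(S,S\times S_p)$ is the group of $H^1$-paths $g:[0,1]\to S$ with $(g(0),g(1))\in S\times S_p$, acting by $g*u=gug^{-1}-g'g^{-1}$. Here a submanifold $A$ of a Riemannian (Hilbert) manifold $X$ is called $R$-weakly reflective, for a group $R$ acting on $X$ by isometries, if for each $x\in A$ and each normal vector $\xi$ of $A$ at $x$ there is $\nu\in R$ with $\nu(x)=x$, $d\nu_x(\xi)=-\xi$ and $\nu(A)=A$. A PF (proper Fredholm) submanifold of a Hilbert space is a submanifold of finite codimension such that the end point map $(x,\xi)\mapsto x+\xi$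 of its normal bundle, restricted to each normal disk bundle $\{\|\xi\|\le r\}$ of finite radius, is proper and Fredholm. -/

import Mathlib

open Set MeasureTheory
open scoped Manifold ContDiff Topology

noncomputable section

/-! ## Submanifolds, normal vectors and weak reflectivity -/

section Submanifolds

variable (F : Type*) [NormedAddCommGroup F] [NormedSpace ℝ F]
  {X : Type*} [TopologicalSpace X] [ChartedSpace F X]

/-- A closed (embedded) submanifold of finite codimension of a manifold `X` modelled on the
normed space `F`: a closed subset which near each of its points is the zero set of a smooth
submersion to `ℝᵏ`. -/
def IsClosedSubmanifold (A : Set X) : Prop :=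
  IsClosed A ∧ ∃ k : ℕ, ∀ x ∈ A, ∃ U : Set X, IsOpen U ∧ x ∈ U ∧
    ∃ f : X → EuclideanSpace ℝ (Fin k),
      ContMDiffOn 𝓘(ℝ, F) 𝓘(ℝ, EuclideanSpace ℝ (Fin k)) ∞ f U ∧
      (∀ y ∈ U, y ∈ A ↔ f y = 0) ∧
      ∀ y ∈ U, Function.Surjective (mfderiv 𝓘(ℝ, F) 𝓘(ℝ, EuclideanSpace ℝ (Fin k)) f y)

/-- The tangent space at `x` of a submanifold `A`: the velocities at time `0` of the curves in `A`
through `x` that are differentiable at `0` (for a submanifold these already form a subspace). -/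
def tangentSub (A : Set X) (x : X) : Submodule ℝ (TangentSpace 𝓘(ℝ, F) x) :=
  Submodule.span ℝ {v : TangentSpace 𝓘(ℝ, F) x | ∃ γ : ℝ → X, γ 0 = x ∧ (∀ t, γ t ∈ A) ∧
    HasMFDerivAt 𝓘(ℝ, ℝ) 𝓘(ℝ, F) γ 0 (ContinuousLinearMap.toSpanSingleton ℝ (v : F))}

/-- `ξ` is a normal vector of `A` at `x`, for the Riemannian metric `m` on `X`. -/
def IsNormalVector (m : ∀ x : X, TangentSpace 𝓘(ℝ, F) x → TangentSpace 𝓘(ℝ, F) x → ℝ)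
    (A : Set X) (x : X) (ξ : TangentSpace 𝓘(ℝ, F) x) : Prop :=
  ∀ v ∈ tangentSub F A x, m x v ξ = 0

/-- For each normal vector `ξ` of `A` at each point `x` of `A` there is a reflection with respect
to `ξ` that belongs to the set `R` of transformations: it fixes `x`, its differential maps `ξ` to
`-ξ`, and it maps `A` onto `A`. -/
def HasReflections (m : ∀ x : X, TangentSpace 𝓘(ℝ, F) x → TangentSpace 𝓘(ℝ, F) x → ℝ)
    (R : Set (X → X)) (A : Set X) : Prop :=
  ∀ x ∈ A, ∀ ξ : TangentSpace 𝓘(ℝ, F) x, IsNormalVector F m A x ξ →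
    ∃ ν ∈ R, ν x = x ∧ (mfderiv 𝓘(ℝ, F) 𝓘(ℝ, F) ν x ξ : F) = -(ξ : F) ∧ ν '' A = A

/-- `A` is an `R`-weakly reflective closed submanifold of the Riemannian manifold `(X, m)`, where
`R` is a set of isometries. -/
def IsWeaklyReflective (m : ∀ x : X, TangentSpace 𝓘(ℝ, F) x → TangentSpace 𝓘(ℝ, F) x → ℝ)
    (R : Set (X → X)) (A : Set X) : Prop :=
  IsClosedSubmanifold F A ∧ HasReflections F m R A

end Submanifolds

/-! ## Proper Fredholm submanifolds of a Hilbert space -/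

section ProperFredholm

variable (V : Type*) [NormedAddCommGroup V] [InnerProductSpace ℝ V]

/-- The Riemannian metric of a Hilbert space. -/
def hilbertMetric (x : V) (v w : TangentSpace 𝓘(ℝ, V) x) : ℝ :=
  @inner ℝ V _ v w

variable {V}

/-- The total space of the normal bundle of a submanifold `A` of a Hilbert space `V`, as a subset
of `V × V`. -/
def normalBundle (A : Set V) : Set (V × V) :=
  {q | q.1 ∈ A ∧ IsNormalVector V (hilbertMetric V) A q.1 q.2}

/-- The differential at `q` of the end point map `(x, ξ) ↦ x + ξ` on the normal bundle of `A`. -/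
def endPointDifferential (A : Set V) (q : V × V) :
    (tangentSub (V × V) (normalBundle A) q : Submodule ℝ (V × V)) →L[ℝ] V :=
  (ContinuousLinearMap.fst ℝ V V + ContinuousLinearMap.snd ℝ V V).comp
    (Submodule.subtypeL (tangentSub (V × V) (normalBundle A) q : Submodule ℝ (V × V)))

/-- A proper Fredholm (PF) submanifold of a Hilbert space: a submanifold of finite codimension
such that the end point map of the normal bundle, restricted to each normal disk bundle of finite
radius, is proper and Fredholm. -/
structure IsPFSubmanifold (A : Set V) : Prop where
  submanifold : IsClosedSubmanifold V A
  proper : ∀ r : ℝ, 0 < r →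
    IsProperMap (fun q : {q : V × V // q ∈ normalBundle A ∧ ‖q.2‖ ≤ r} => q.1.1 + q.1.2)
  fredholm : ∀ q ∈ normalBundle A, (endPointDifferential A q).IsFredholm

end ProperFredholm

/-! ## Lie groups, path spaces and the parallel transport map -/

section LieGroups

variable (L : Type*) [NormedAddCommGroup L] [NormedSpace ℝ L]
  {G : Type*} [TopologicalSpace G] [ChartedSpace L G] [Group G]

/-- The adjoint action of `a` on the Lie algebra: the differential at `1` of `x ↦ a x a⁻¹`. -/
def adjointAction (a : G) (v : GroupLieAlgebra 𝓘(ℝ, L) G) : GroupLieAlgebra 𝓘(ℝ, L) G :=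
  (mfderiv 𝓘(ℝ, L) 𝓘(ℝ, L) (fun x : G => a * x * a⁻¹) 1 v : L)

variable (G) in
/-- An `Ad(G)`-invariant inner product on the Lie algebra of `G`. -/
structure AdInvariantInner where
  /-- The inner product. -/
  core : InnerProductSpace.Core ℝ (GroupLieAlgebra 𝓘(ℝ, L) G)
  ad_invariant : ∀ (a : G) (v w : GroupLieAlgebra 𝓘(ℝ, L) G),
    core.inner (adjointAction L a v) (adjointAction L a w) = core.inner v w

variable {L}

/-- The Lie algebra of `G` as an inner product space, with the inner product `B`. -/
def LieAlg (_B : AdInvariantInner L G) : Type _ := GroupLieAlgebra 𝓘(ℝ, L) G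

variable (B : AdInvariantInner L G)

instance : AddCommGroup (LieAlg B) :=
  inferInstanceAs (AddCommGroup (GroupLieAlgebra 𝓘(ℝ, L) G))

instance : Module ℝ (LieAlg B) :=
  inferInstanceAs (Module ℝ (GroupLieAlgebra 𝓘(ℝ, L) G))

/-- The inner product `B`, transported to `LieAlg B`. -/
@[reducible]
def LieAlg.core : InnerProductSpace.Core ℝ (LieAlg B) := B.core

instance : NormedAddCommGroup (LieAlg B) :=
  InnerProductSpace.Core.toNormedAddCommGroup (𝕜 := ℝ) (cd := LieAlg.core B)

instance : InnerProductSpace ℝ (LieAlg B) :=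
  InnerProductSpace.ofCore (LieAlg.core B).toCore

/-- The adjoint action on the inner product space `LieAlg B`. -/
def LieAlg.ad (a : G) (v : LieAlg B) : LieAlg B := adjointAction L a v

/-- The bi-invariant Riemannian metric on `G` given by the `Ad(G)`-invariant inner product `B`,
extended by left translations. -/
def biinvariantMetric (a : G) (v w : TangentSpace 𝓘(ℝ, L) a) : ℝ :=
  B.core.inner (mfderiv 𝓘(ℝ, L) 𝓘(ℝ, L) (fun x : G => a⁻¹ * x) a v : L)
    (mfderiv 𝓘(ℝ, L) 𝓘(ℝ, L) (fun x : G => a⁻¹ * x) a w : L)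

/-- The Hilbert space `L²([0,1], 𝔤)`. -/
abbrev PathAlg : Type _ := Lp (LieAlg B) 2 (volume.restrict (Icc (0 : ℝ) 1))

variable {B}

/-- The derivative of `f : G → ℝ` at `a` in the direction `a v`, where `v` is in the Lie algebra. -/
def leftDeriv (f : G → ℝ) (a : G) (v : LieAlg B) : ℝ :=
  mfderiv 𝓘(ℝ, L) 𝓘(ℝ, ℝ) (fun x : G => f (a * x)) 1 v

/-- The derivative of `f : G → ℝ` at `a` in the direction `v a`, where `v` is in the Lie algebra. -/
def rightDeriv (f : G → ℝ) (a : G) (v : LieAlg B) : ℝ :=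
  mfderiv 𝓘(ℝ, L) 𝓘(ℝ, ℝ) (fun x : G => f (x * a)) 1 v

/-- The path `E : [0,1] → G` (values outside `[0,1]` are irrelevant) is of Sobolev class `H¹` and
satisfies `E⁻¹ E' = u`. The weak derivative is tested against the smooth functions on `G`. -/
def HasLeftLogDeriv (E : ℝ → G) (u : PathAlg B) : Prop :=
  ContinuousOn E (Icc 0 1) ∧
    ∀ f : G → ℝ, ContMDiff 𝓘(ℝ, L) 𝓘(ℝ, ℝ) ∞ f → ∀ t ∈ Icc (0 : ℝ) 1,
      f (E t) = f (E 0) + ∫ s in (0 : ℝ)..t, leftDeriv f (E s) (u s)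

/-- The path `g : [0,1] → G` (values outside `[0,1]` are irrelevant) is of Sobolev class `H¹` and
satisfies `g' g⁻¹ = w`. -/
def HasRightLogDeriv (g : ℝ → G) (w : PathAlg B) : Prop :=
  ContinuousOn g (Icc 0 1) ∧
    ∀ f : G → ℝ, ContMDiff 𝓘(ℝ, L) 𝓘(ℝ, ℝ) ∞ f → ∀ t ∈ Icc (0 : ℝ) 1,
      f (g t) = f (g 0) + ∫ s in (0 : ℝ)..t, rightDeriv f (g s) (w s)

/-- `T` is the gauge transformation `u ↦ g * u = g u g⁻¹ - g' g⁻¹` of `L²([0,1], 𝔤)` given by the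
`H¹`-path `g` in `G`. -/
def IsGaugeTransformation (g : ℝ → G) (T : PathAlg B → PathAlg B) : Prop :=
  ∃ w : PathAlg B, HasRightLogDeriv g w ∧ ∀ u : PathAlg B,
    ∀ᵐ t ∂(volume.restrict (Icc (0 : ℝ) 1)),
      T u t = LieAlg.ad B (g t) (u t) - w t

variable (B)

/-- The transformations of `L²([0,1], 𝔤)` given by the group `P(S, H)` of `H¹`-paths in the
subgroup `S` of `G` with pair of end points in `H`. -/
def gaugeGroup (S : Subgroup G) (H : Set (G × G)) : Set (PathAlg B → PathAlg B) :=
  {T | ∃ g : ℝ → G, (∀ t ∈ Icc (0 : ℝ) 1, g t ∈ S) ∧ (g 0, g 1) ∈ H ∧ IsGaugeTransformation g T}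

open Classical in
/-- The parallel transport map `Φ(u) = E_u(1)`, where `E_u` is the solution of `E⁻¹ E' = u`,
`E(0) = 1` (which exists and is unique if `G` is a compact Lie group; `1` is a dummy value). -/
def parallelTransport (u : PathAlg B) : G :=
  if h : ∃ E : ℝ → G, E 0 = 1 ∧ HasLeftLogDeriv E u then h.choose 1 else 1

end LieGroups

/-! ## The isometry group of a Riemannian manifold -/

section Isometries

variable {E : Type*} [NormedAddCommGroup E] [NormedSpace ℝ E]
  {M : Type*} [TopologicalSpace M] [ChartedSpace E M] [IsManifold 𝓘(ℝ, E) ∞ M]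

/-- The isometries of a Riemannian manifold `(M, m)`: the diffeomorphisms preserving `m`. -/
structure RiemIsom (m : Bundle.ContMDiffRiemannianMetric 𝓘(ℝ, E) ∞ E
    (fun x : M => TangentSpace 𝓘(ℝ, E) x)) extends Diffeomorph 𝓘(ℝ, E) 𝓘(ℝ, E) M M ∞ where
  preserves : ∀ (x : M) (v w : TangentSpace 𝓘(ℝ, E) x),
    m.inner (toFun x) (mfderiv 𝓘(ℝ, E) 𝓘(ℝ, E) toFun x v)
      (mfderiv 𝓘(ℝ, E) 𝓘(ℝ, E) toFun x w) = m.inner x v w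

variable {m : Bundle.ContMDiffRiemannianMetric 𝓘(ℝ, E) ∞ E
    (fun x : M => TangentSpace 𝓘(ℝ, E) x)}

namespace RiemIsom

instance : CoeFun (RiemIsom m) (fun _ => M → M) := ⟨fun φ => φ.toFun⟩

theorem contMDiff (φ : RiemIsom m) : ContMDiff 𝓘(ℝ, E) 𝓘(ℝ, E) ∞ φ := φ.contMDiff_toFun

theorem ext' {φ ψ : RiemIsom m} (h : ∀ x, φ x = ψ x) : φ = ψ := by
  obtain ⟨φ, hφ⟩ := φ
  obtain ⟨ψ, hψ⟩ := ψ
  have : φ = ψ := Diffeomorph.ext h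
  subst this
  rfl

instance : One (RiemIsom m) :=
  ⟨{ Diffeomorph.refl 𝓘(ℝ, E) M ∞ with
      preserves := fun x v w => by
        change m.inner x (mfderiv 𝓘(ℝ, E) 𝓘(ℝ, E) id x v)
          (mfderiv 𝓘(ℝ, E) 𝓘(ℝ, E) id x w) = _
        rw [mfderiv_id]
        rfl }⟩

instance : Mul (RiemIsom m) :=
  ⟨fun φ ψ => { ψ.toDiffeomorph.trans φ.toDiffeomorph with
      preserves := fun x v w => by
        change m.inner (φ (ψ x)) (mfderiv 𝓘(ℝ, E) 𝓘(ℝ, E) (φ ∘ ψ) x v)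
          (mfderiv 𝓘(ℝ, E) 𝓘(ℝ, E) (φ ∘ ψ) x w) = _
        rw [mfderiv_comp x (φ.contMDiff.mdifferentiableAt (by simp))
          (ψ.contMDiff.mdifferentiableAt (by simp))]
        exact (φ.preserves (ψ x) _ _).trans (ψ.preserves x v w) }⟩

instance : Inv (RiemIsom m) :=
  ⟨fun φ => { φ.toDiffeomorph.symm with
      preserves := fun x v w => by
        have hs : ContMDiff 𝓘(ℝ, E) 𝓘(ℝ, E) ∞ φ.toDiffeomorph.symm :=
          φ.toDiffeomorph.symm.contMDiff
        have hc : (φ : M → M) ∘ φ.toDiffeomorph.symm = id := by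
          funext y
          exact φ.toDiffeomorph.apply_symm_apply y
        have hd : mfderiv 𝓘(ℝ, E) 𝓘(ℝ, E) ((φ : M → M) ∘ φ.toDiffeomorph.symm) x
            = (mfderiv 𝓘(ℝ, E) 𝓘(ℝ, E) φ (φ.toDiffeomorph.symm x)).comp
              (mfderiv 𝓘(ℝ, E) 𝓘(ℝ, E) φ.toDiffeomorph.symm x) :=
          mfderiv_comp x (φ.contMDiff.mdifferentiableAt (by simp))
            (hs.mdifferentiableAt (by simp))
        have key := φ.preserves (φ.toDiffeomorph.symm x)
          (mfderiv 𝓘(ℝ, E) 𝓘(ℝ, E) φ.toDiffeomorph.symm x v)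
          (mfderiv 𝓘(ℝ, E) 𝓘(ℝ, E) φ.toDiffeomorph.symm x w)
        refine key.symm.trans ?_
        have e : ∀ z : TangentSpace 𝓘(ℝ, E) x,
            (mfderiv 𝓘(ℝ, E) 𝓘(ℝ, E) φ (φ.toDiffeomorph.symm x)
              (mfderiv 𝓘(ℝ, E) 𝓘(ℝ, E) φ.toDiffeomorph.symm x z) : E) = (z : E) := by
          intro z
          have := congrArg (fun A : E →L[ℝ] E => A z) hd
          rw [hc, mfderiv_id] at this
          exact this.symm
        have hx : φ (φ.toDiffeomorph.symm x) = x := φ.toDiffeomorph.apply_symm_apply x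
        have e' : ∀ (y : M), y = x → ∀ a b a' b' : E, a = a' → b = b' →
            (m.inner y : E →L[ℝ] E →L[ℝ] ℝ) a b = (m.inner x : E →L[ℝ] E →L[ℝ] ℝ) a' b' := by
          rintro y rfl a b a' b' rfl rfl
          rfl
        exact e' _ hx _ _ _ _ (e v) (e w) }⟩

/-- The group of isometries, with composition as multiplication. -/
instance : Group (RiemIsom m) :=
  Group.ofLeftAxioms (fun _ _ _ => ext' fun _ => rfl) (fun _ => ext' fun _ => rfl)
    (fun φ => ext' fun x => φ.toDiffeomorph.symm_apply_apply x)

/-- The compact-open topology on the group of isometries. -/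
instance : TopologicalSpace (RiemIsom m) :=
  TopologicalSpace.induced (fun φ => (⟨φ, φ.contMDiff.continuous⟩ : C(M, M))) inferInstance

end RiemIsom

variable (m) in
/-- The identity component `G₀` of the isometry group. -/
def identityComponent : Set (RiemIsom m) := connectedComponent 1

/-- The differential of an isometry `k` at a fixed point `p` of `k`, as a map of `T_p M`. -/
def linearIsotropy (k : RiemIsom m) (p : M) (v : TangentSpace 𝓘(ℝ, E) p) :
    TangentSpace 𝓘(ℝ, E) p :=
  (mfderiv 𝓘(ℝ, E) 𝓘(ℝ, E) k p v : E)

/-- `(M, m)` is isotropy irreducible at `p`: the linear isotropy representation on `T_p M` of the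
isotropy subgroup `K` of `G₀` at `p` is irreducible over `ℝ`. -/
def IsIsotropyIrreducible (m : Bundle.ContMDiffRiemannianMetric 𝓘(ℝ, E) ∞ E
    (fun x : M => TangentSpace 𝓘(ℝ, E) x)) (p : M) : Prop :=
  Nontrivial (TangentSpace 𝓘(ℝ, E) p) ∧
    ∀ W : Submodule ℝ (TangentSpace 𝓘(ℝ, E) p),
      (∀ k ∈ identityComponent m, k p = p → ∀ v ∈ W, linearIsotropy k p v ∈ W) → W = ⊥ ∨ W = ⊤

variable {L : Type*} [NormedAddCommGroup L] [NormedSpace ℝ L] [ChartedSpace L (RiemIsom m)]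

/-- The differential at the identity of the orbit map `a ↦ a p`, from the Lie algebra of the
isometry group to `T_p M`. -/
def orbitDifferential (L : Type*) [NormedAddCommGroup L] [NormedSpace ℝ L]
    [ChartedSpace L (RiemIsom m)] (p : M) (v : GroupLieAlgebra 𝓘(ℝ, L) (RiemIsom m)) :
    TangentSpace 𝓘(ℝ, E) p :=
  (mfderiv 𝓘(ℝ, L) 𝓘(ℝ, E) (fun a : RiemIsom m => a p) 1 v : E)

/-- The normal homogeneous metric on `G₀/K` given by `B` is the given metric of `M` under the
identification `G₀/K = M`, `aK ↦ a p`: the differential at `1` of the orbit map sends the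
`B`-orthogonal complement `𝔪` of its kernel `𝔨` (the Lie algebra of `K`) isometrically onto
`T_p M`. By `G₀`-invariance of both metrics it is enough to require this at `p`. -/
def IsNormalHomogeneous (B : AdInvariantInner L (RiemIsom m)) (p : M) : Prop :=
  (∀ v : GroupLieAlgebra 𝓘(ℝ, L) (RiemIsom m),
    (∀ k, orbitDifferential L p k = 0 → B.core.inner k v = 0) →
      m.inner p (orbitDifferential L p v) (orbitDifferential L p v) = B.core.inner v v) ∧
  Function.Surjective (orbitDifferential (m := m) L p)

/-- The transformations of `M` given by the elements of `S`. -/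
def isometriesOf (S : Subgroup (RiemIsom m)) : Set (M → M) :=
  {ν | ∃ s ∈ S, ν = s}

/-- The product `S × S_p`, with `S_p` the isotropy subgroup of `S` at `p`. -/
def prodIsotropy (S : Subgroup (RiemIsom m)) (p : M) : Set (RiemIsom m × RiemIsom m) :=
  {b | b.1 ∈ S ∧ b.2 ∈ S ∧ b.2 p = p}

/-- The transformations `a ↦ b₁ a b₂⁻¹` with `(b₁, b₂) ∈ H` that preserve `G₀`. -/
def twoSidedTranslations (H : Set (RiemIsom m × RiemIsom m)) :
    Set (RiemIsom m → RiemIsom m) :=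
  {ν | ∃ b ∈ H, ν = (fun a => b.1 * a * b.2⁻¹) ∧
    ν '' identityComponent m = identityComponent m}

/-- The inverse image of `N` under `π : G₀ → M`, `a ↦ a p`. As `G₀` is open and closed in `G`,
closed submanifolds of `G₀`, their normal vectors etc. are those of `G`. -/
def orbitPreimage (p : M) (N : Set M) : Set (RiemIsom m) :=
  {a | a ∈ identityComponent m ∧ a p ∈ N}

/-- The inverse image of `N` under the parallel transport map `Φ_K = π ∘ Φ` over `M = G₀/K`. -/
def transportPreimage (B : AdInvariantInner L (RiemIsom m)) (p : M) (N : Set M) :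
    Set (PathAlg B) :=
  {u | (parallelTransport B u) p ∈ N}

end Isometries

end

/-! Both the orbit map `π : G₀ → M` and the parallel transport map `Φ : L²([0,1], 𝔤) → G₀` are
surjective Riemannian submersions, and weak reflectivity passes through such a map in both
directions as soon as the transformations upstairs and downstairs cover each other. The normal
vectors of a preimage are exactly the horizontal lifts of the normal vectors below. A reflection
upstairs that covers a transformation downstairs therefore projects to a reflection
(`hasReflections_of_preimage`). Conversely, let `ν` be isometric at a fixed point and cover a
reflection `s`. Then pairing `dν ξ` with any vector gives the same value as pairing `-ξ` with it, so
`dν ξ = -ξ` (`hasReflections_preimage`).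

It remains to exhibit the lifts. If `s ∈ S` fixes `a p`, then `b = a⁻¹ s a` lies in `S_p`, because
`G₀` normalizes `S`, and `x ↦ s x b⁻¹` fixes `a` and covers `s`. If `x ↦ s x b⁻¹` fixes `Φ(u)`, the
path `g = E_u⁻¹ s E_u` stays in `S`, runs from `s` to `b` and satisfies `g * u = u`. In the other
direction every gauge transformation covers `x ↦ g(0) x g(1)⁻¹`.

The analysis supports these facts. The equation `E⁻¹E' = u` is solved for small `u` by the inverse
function theorem in a chart. The cocycle identity `Φ(u + v) = Φ(Ad(E_u) v) Φ(u)` then spreads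
existence, smoothness and the formula for `dΦ` from `0` to all of `L²`. The image of `Φ` is an open
subgroup inside `G₀`, hence all of `G₀`.

The proper Fredholm property holds for every preimage under `Φ` of a closed submanifold. Normal
vectors have the form `Ad(E_u)⁻¹ c`, and for bounded `u` and `c` these form a relatively compact
family by Hölder estimates and Arzelà–Ascoli. Compactness gives properness, and it makes the shape
part of the end point differential a compact operator.

An inner product inducing the given metric is found by averaging over Haar measure. The pullback of
the metric of `T_pM` is then compared with the average by a version of Schur's lemma, and
irreducibility leaves a single positive factor to absorb. -/

set_option linter.unusedSectionVars false

noncomputable section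

/-! ## Superposition operators on spaces of continuous maps -/

section Superposition

variable {K : Type*} [TopologicalSpace K] [CompactSpace K]

/-- Pointwise application of a continuous family of operators to a continuous family of vectors. -/
def ContinuousMap.pointwiseApplyL (K : Type*) [TopologicalSpace K] [CompactSpace K]
    (E W : Type*) [NormedAddCommGroup E] [NormedSpace ℝ E] [NormedAddCommGroup W]
    [NormedSpace ℝ W] : C(K, E →L[ℝ] W) →L[ℝ] C(K, E) →L[ℝ] C(K, W) :=
  LinearMap.mkContinuous₂
    (LinearMap.mk₂ ℝ (fun (A : C(K, E →L[ℝ] W)) (y : C(K, E)) =>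
        (⟨fun k => A k (y k), by fun_prop⟩ : C(K, W)))
      (fun _ _ _ => by ext; simp) (fun _ _ _ => by ext; simp) (fun _ _ _ => by ext; simp)
      (fun _ _ _ => by ext; simp)) 1 (fun A y => by
        rw [ContinuousMap.norm_le _ (by positivity)]
        intro k
        simp only [LinearMap.mk₂_apply, ContinuousMap.coe_mk, one_mul]
        exact (A k).le_of_opNorm_le_of_le (A.norm_coe_le_norm k) (y.norm_coe_le_norm k))

/-- As `E` is finite dimensional, `F'` is uniformly continuous on the closed ball of radius `‖y‖ +
1`. The mean value inequality on the segments from `y k` to `y k + h k` is therefore uniform in `k`.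
-/
theorem ContinuousMap.hasFDerivAt_comp_left {E W : Type*} [NormedAddCommGroup E]
    [NormedSpace ℝ E] [FiniteDimensional ℝ E] [NormedAddCommGroup W] [NormedSpace ℝ W]
    (F : C(E, W)) (F' : C(E, E →L[ℝ] W)) (hF : ∀ x, HasFDerivAt F (F' x) x) (y : C(K, E)) :
    HasFDerivAt (fun y : C(K, E) => F.comp y) (pointwiseApplyL K E W (F'.comp y)) y := by
  rw [hasFDerivAt_iff_isLittleO_nhds_zero, Asymptotics.isLittleO_iff]
  intro ε hε
  have hc : IsCompact (Metric.closedBall (0 : E) (‖y‖ + 1)) := isCompact_closedBall _ _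
  have hu := hc.uniformContinuousOn_of_continuous F'.continuous.continuousOn
  rw [Metric.uniformContinuousOn_iff] at hu
  obtain ⟨δ, hδ, hu⟩ := hu ε hε
  filter_upwards [Metric.ball_mem_nhds (0 : C(K, E)) (lt_min hδ one_pos)] with h hh
  rw [mem_ball_zero_iff, lt_min_iff] at hh
  rw [ContinuousMap.norm_le _ (by positivity)]
  intro k
  have hk : ‖h k‖ ≤ ‖h‖ := h.norm_coe_le_norm k
  have hyk : ‖y k‖ ≤ ‖y‖ := y.norm_coe_le_norm k
  have hseg : ∀ z ∈ segment ℝ (y k) (y k + h k), ‖z - y k‖ ≤ ‖h k‖ := by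
    intro z hz
    have := norm_sub_le_of_mem_segment hz
    simpa using this
  have key := (convex_segment (𝕜 := ℝ) (y k) (y k + h k)).norm_image_sub_le_of_norm_hasFDerivWithin_le'
    (f := F) (f' := F') (φ := F' (y k)) (C := ε)
    (fun z _ => (hF z).hasFDerivWithinAt)
    (fun z hz => by
      have h1 := hseg z hz
      have := hu z ?_ (y k) ?_ ?_
      · rw [dist_eq_norm] at this; exact this.le
      · rw [mem_closedBall_zero_iff]
        calc ‖z‖ = ‖y k + (z - y k)‖ := by congr 1; abel
          _ ≤ ‖y k‖ + ‖z - y k‖ := norm_add_le _ _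
          _ ≤ _ := by linarith [hh.2.le]
      · rw [mem_closedBall_zero_iff]; linarith
      · rw [dist_eq_norm]; linarith [hh.1])
    (left_mem_segment ℝ _ _) (right_mem_segment ℝ _ _)
  simp only [add_sub_cancel_left] at key
  exact key.trans (by gcongr)

/-- The derivative is postcomposition with `F'` followed by a bounded bilinear map, so induction
applies to `F'`. Its target is `E →L[ℝ] W`, which is why `W` varies in the induction and shares its
universe with `E`. -/
theorem ContinuousMap.contDiff_comp_left_nat.{u} {E : Type u} [NormedAddCommGroup E]
    [NormedSpace ℝ E] [FiniteDimensional ℝ E] (n : ℕ) :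
    ∀ {W : Type u} [NormedAddCommGroup W] [NormedSpace ℝ W] (F : C(E, W)),
      ContDiff ℝ n F → ContDiff ℝ n (fun y : C(K, E) => F.comp y) := by
  induction n with
  | zero =>
    intro W _ _ F _
    exact contDiff_zero.2 (ContinuousMap.continuous_postcomp F)
  | succ n ih =>
    intro W _ _ F hF
    have hF' : ContDiff ℝ n (fderiv ℝ F) := hF.fderiv_right (by norm_cast)
    have hd : ∀ x, HasFDerivAt F (fderiv ℝ F x) x := fun x =>
      (hF.differentiable (by norm_cast)).differentiableAt.hasFDerivAt
    have hy := hasFDerivAt_comp_left (K := K) F ⟨fderiv ℝ F, hF'.continuous⟩ hd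
    rw [Nat.cast_succ, contDiff_succ_iff_fderiv]
    refine ⟨fun y => (hy y).differentiableAt, by simp, ?_⟩
    rw [show fderiv ℝ (fun y : C(K, E) => F.comp y) = fun y => pointwiseApplyL K E W
      ((⟨fderiv ℝ F, hF'.continuous⟩ : C(E, E →L[ℝ] W)).comp y) from funext fun y => (hy y).fderiv]
    exact (pointwiseApplyL K E W).contDiff.comp (ih ⟨fderiv ℝ F, hF'.continuous⟩ hF')

theorem ContinuousMap.contDiff_comp_left.{u} {E : Type u} [NormedAddCommGroup E]
    [NormedSpace ℝ E] [FiniteDimensional ℝ E] {W : Type u} [NormedAddCommGroup W]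
    [NormedSpace ℝ W] (F : C(E, W)) (hF : ContDiff ℝ ∞ F) :
    ContDiff ℝ ∞ (fun y : C(K, E) => F.comp y) :=
  contDiff_infty.2 fun n => contDiff_comp_left_nat n F (contDiff_infty.1 hF n)

end Superposition

/-! ## Functions whose increments are dominated -/

/-- Cutting `[0, t]` into short equal pieces and telescoping bounds `|D t - D 0|` by `ε (K t - K 0)`
for every `ε`. This proves integral identities for absolutely continuous paths without almost
everywhere differentiation; `K` will be a primitive of a norm. -/
theorem eq_of_increment_le {D K : ℝ → ℝ}
    (h : ∀ ε > 0, ∃ δ > 0, ∀ s ∈ Icc (0 : ℝ) 1, ∀ t ∈ Icc (0 : ℝ) 1, s ≤ t → t - s < δ →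
      |D t - D s| ≤ ε * (K t - K s)) {t : ℝ} (ht : t ∈ Icc (0 : ℝ) 1) : D t = D 0 := by
  have key : ∀ ε > 0, |D t - D 0| ≤ ε * (K t - K 0) := by
    intro ε hε
    obtain ⟨δ, hδ, h⟩ := h ε hε
    obtain ⟨n, hn⟩ := exists_nat_one_div_lt hδ
    have hn0 : (0 : ℝ) < n + 1 := by positivity
    have hmem : ∀ k : ℕ, k ≤ n + 1 → t * k / (n + 1) ∈ Icc (0 : ℝ) 1 := by
      intro k hk
      have hk' : (k : ℝ) ≤ n + 1 := by exact_mod_cast hk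
      have ht0 := ht.1
      refine ⟨by positivity, ?_⟩
      rw [div_le_one hn0]
      nlinarith [ht.2, Nat.cast_nonneg (α := ℝ) k]
    have hind : ∀ k : ℕ, k ≤ n + 1 →
        |D (t * k / (n + 1)) - D 0| ≤ ε * (K (t * k / (n + 1)) - K 0) := by
      intro k
      induction k with
      | zero => intro _; simp
      | succ k ih =>
        intro hk
        have h1 := ih (by omega)
        have hdiff : t * (k + 1 : ℕ) / (n + 1) - t * k / (n + 1) = t / (n + 1) := by
          push_cast; field_simp; ring
        have htn : t / (n + 1) ≤ 1 / (n + 1) := by gcongr; exact ht.2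
        have htn0 : 0 ≤ t / (n + 1) := by have := ht.1; positivity
        have h2 := h _ (hmem k (by omega)) _ (hmem (k + 1) hk) (by linarith) (by linarith)
        calc |D (t * (k + 1 : ℕ) / (n + 1)) - D 0|
            = |(D (t * (k + 1 : ℕ) / (n + 1)) - D (t * k / (n + 1))) +
                (D (t * k / (n + 1)) - D 0)| := by ring_nf
          _ ≤ _ := abs_add_le _ _
          _ ≤ _ := by linarith
    have := hind (n + 1) le_rfl
    rwa [show t * ((n + 1 : ℕ) : ℝ) / (n + 1) = t by push_cast; field_simp] at this
  have h0 : |D t - D 0| ≤ 0 := by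
    refine le_of_forall_pos_le_add fun ε hε => ?_
    have hK : 0 ≤ K t - K 0 := by
      have := key 1 one_pos
      have := abs_nonneg (D t - D 0)
      linarith
    have := key (ε / (K t - K 0 + 1)) (by positivity)
    refine this.trans ?_
    rw [zero_add, div_mul_eq_mul_div, div_le_iff₀ (by positivity)]
    nlinarith
  have := abs_nonpos_iff.1 h0
  linarith

/-! ## Square integrable paths -/

section SquareIntegrable

/-- Lebesgue measure on the unit interval. -/
abbrev unitVolume : Measure ℝ := volume.restrict (Icc (0 : ℝ) 1)

instance : IsProbabilityMeasure unitVolume := ⟨by simp⟩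

/-- The retraction of the real line onto the unit interval. -/
abbrev toUnit (t : ℝ) : Icc (0 : ℝ) 1 := projIcc 0 1 zero_le_one t

variable {H W : Type*} [NormedAddCommGroup H] [NormedSpace ℝ H] [NormedAddCommGroup W]
  [NormedSpace ℝ W]

theorem integrable_lp_two (u : Lp H 2 unitVolume) : Integrable u unitVolume :=
  (Lp.memLp u).integrable (by norm_num)

theorem restrict_le_unitVolume {s t : ℝ} (hs : s ∈ Icc (0 : ℝ) 1) (ht : t ∈ Icc (0 : ℝ) 1) :
    volume.restrict (uIoc s t) ≤ unitVolume :=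
  Measure.restrict_mono (uIoc_subset_uIcc.trans ((convex_Icc (0 : ℝ) 1).ordConnected.uIcc_subset hs ht)) le_rfl

theorem MeasureTheory.Integrable.intervalIntegrable_unit {f : ℝ → W} (hf : Integrable f unitVolume) {s t : ℝ}
    (hs : s ∈ Icc (0 : ℝ) 1) (ht : t ∈ Icc (0 : ℝ) 1) : IntervalIntegrable f volume s t :=
  intervalIntegrable_iff.2 (hf.mono_measure (restrict_le_unitVolume hs ht))

theorem intervalIntegral_congr_unit {f g : ℝ → W} (hfg : f =ᵐ[unitVolume] g) {s t : ℝ}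
    (hs : s ∈ Icc (0 : ℝ) 1) (ht : t ∈ Icc (0 : ℝ) 1) : ∫ r in s..t, f r = ∫ r in s..t, g r :=
  intervalIntegral.integral_congr_ae_restrict
    (hfg.filter_mono (ae_mono (restrict_le_unitVolume hs ht)))

/-- Hölder's inequality on an interval of length `t - s`. It is the source of the Hölder exponent
one half for all `H¹` paths below. -/
theorem intervalIntegral_norm_le (u : Lp H 2 unitVolume) {s t : ℝ}
    (hs : s ∈ Icc (0 : ℝ) 1) (ht : t ∈ Icc (0 : ℝ) 1) (hst : s ≤ t) :
    ∫ r in s..t, ‖u r‖ ≤ ‖u‖ * √(t - s) := by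
  have hle : volume.restrict (Ioc s t) ≤ unitVolume := by
    rw [← uIoc_of_le hst]; exact restrict_le_unitVolume hs ht
  have hm : AEStronglyMeasurable u (volume.restrict (Ioc s t)) :=
    (Lp.aestronglyMeasurable u).mono_measure hle
  have h1 : eLpNorm u 1 (volume.restrict (Ioc s t)) ≤
      eLpNorm u 2 unitVolume * ENNReal.ofReal (t - s) ^ (1 / 2 : ℝ) := by
    refine (eLpNorm_le_eLpNorm_mul_rpow_measure_univ (p := 1) (q := 2) (by norm_num) hm).trans ?_
    gcongr
    · simp; norm_num
  rw [intervalIntegral.integral_of_le hst, integral_norm_eq_lintegral_enorm hm,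
    ← eLpNorm_one_eq_lintegral_enorm]
  refine (ENNReal.toReal_mono ?_ h1).trans ?_
  · exact ENNReal.mul_ne_top (Lp.eLpNorm_ne_top u)
      (ENNReal.rpow_ne_top_of_nonneg (by norm_num) ENNReal.ofReal_ne_top)
  · rw [ENNReal.toReal_mul, ← ENNReal.toReal_rpow, ENNReal.toReal_ofReal (by linarith),
      Real.sqrt_eq_rpow, Lp.norm_def]

theorem aestronglyMeasurable_apply {A : ℝ → H →L[ℝ] W} (hA : ContinuousOn A (Icc 0 1)) {u : ℝ → H}
    (hu : AEStronglyMeasurable u unitVolume) :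
    AEStronglyMeasurable (fun t => A t (u t)) unitVolume :=
  (ContinuousLinearMap.id ℝ (H →L[ℝ] W)).aestronglyMeasurable_comp₂
    (hA.aestronglyMeasurable measurableSet_Icc) hu

theorem memLp_apply {A : ℝ → H →L[ℝ] W} (hA : ContinuousOn A (Icc 0 1))
    (u : Lp H 2 unitVolume) : MemLp (fun t => A t (u t)) 2 unitVolume := by
  obtain ⟨C, hC⟩ := isCompact_Icc.exists_bound_of_continuousOn hA
  refine MemLp.of_le_mul (c := C) (Lp.memLp u) (aestronglyMeasurable_apply hA
    (Lp.aestronglyMeasurable u)) ?_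
  filter_upwards [ae_restrict_mem measurableSet_Icc] with t ht
  exact (A t).le_of_opNorm_le (hC t ht) _

theorem integrable_apply {A : ℝ → H →L[ℝ] W} (hA : ContinuousOn A (Icc 0 1))
    (u : Lp H 2 unitVolume) : Integrable (fun t => A t (u t)) unitVolume :=
  (memLp_apply hA u).integrable (by norm_num)

theorem continuousOn_comp_toUnit {X : Type*} [TopologicalSpace X] (A : C(Icc (0 : ℝ) 1, X)) :
    ContinuousOn (fun t => A (toUnit t)) (Icc 0 1) :=
  (A.continuous.comp continuous_projIcc).continuousOn

variable (H W) in
/-- Pointwise application of a continuous path of operators to a square integrable path. -/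
def pathApplyL : C(Icc (0 : ℝ) 1, H →L[ℝ] W) →L[ℝ] Lp H 2 unitVolume →L[ℝ] Lp W 2 unitVolume :=
  LinearMap.mkContinuous₂
    (LinearMap.mk₂ ℝ (fun (A : C(Icc (0 : ℝ) 1, H →L[ℝ] W)) (u : Lp H 2 unitVolume) =>
        (memLp_apply (continuousOn_comp_toUnit A) u).toLp)
      (fun A A' u => by
        rw [← MemLp.toLp_add]
        exact MemLp.toLp_congr _ _ (by simp; rfl))
      (fun c A u => by
        rw [← MemLp.toLp_const_smul]
        exact MemLp.toLp_congr _ _ (by simp; rfl))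
      (fun A u u' => by
        rw [← MemLp.toLp_add]
        refine MemLp.toLp_congr _ _ ?_
        filter_upwards [Lp.coeFn_add u u'] with t ht
        rw [ht]; exact map_add _ _ _)
      (fun c A u => by
        rw [← MemLp.toLp_const_smul]
        refine MemLp.toLp_congr _ _ ?_
        filter_upwards [Lp.coeFn_smul c u] with t ht
        rw [ht]; exact map_smul _ _ _)) 1 (fun A u => by
        rw [one_mul]
        refine Lp.norm_le_mul_norm_of_ae_le_mul ?_
        simp only [LinearMap.mk₂_apply]
        filter_upwards [(memLp_apply (continuousOn_comp_toUnit A) u).coeFn_toLp] with t ht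
        rw [ht]
        exact (A _).le_of_opNorm_le (A.norm_coe_le_norm _) _)

theorem pathApplyL_ae (A : C(Icc (0 : ℝ) 1, H →L[ℝ] W)) (u : Lp H 2 unitVolume) :
    ∀ᵐ t ∂unitVolume, pathApplyL H W A u t = A (toUnit t) (u t) :=
  (memLp_apply (continuousOn_comp_toUnit A) u).coeFn_toLp

theorem continuousOn_primitive_unit {f : ℝ → W} (hf : Integrable f unitVolume) :
    ContinuousOn (fun t => ∫ s in (0 : ℝ)..t, f s) (Icc 0 1) := by
  have := intervalIntegral.continuousOn_primitive_interval (μ := volume) (f := f) (a := 0) (b := 1)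
    (by rwa [uIcc_of_le zero_le_one])
  rwa [uIcc_of_le zero_le_one] at this

variable (W) in
/-- The Volterra operator, which integrates a square integrable path from `0`. -/
def volterra : Lp W 2 unitVolume →L[ℝ] C(Icc (0 : ℝ) 1, W) :=
  LinearMap.mkContinuous
    { toFun := fun u => ⟨fun t => ∫ s in (0 : ℝ)..t, u s,
        (continuousOn_primitive_unit (integrable_lp_two u)).comp_continuous continuous_subtype_val
          fun t => t.2⟩
      map_add' := fun u v => by
        ext t
        have h0 : (0 : ℝ) ∈ Icc (0 : ℝ) 1 := by simp
        change ∫ s in (0 : ℝ)..t, (u + v : Lp W 2 unitVolume) s =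
          (∫ s in (0 : ℝ)..t, u s) + ∫ s in (0 : ℝ)..t, v s
        rw [intervalIntegral_congr_unit (Lp.coeFn_add u v) h0 t.2]
        exact intervalIntegral.integral_add
          (MeasureTheory.Integrable.intervalIntegrable_unit (integrable_lp_two u) h0 t.2)
          (MeasureTheory.Integrable.intervalIntegrable_unit (integrable_lp_two v) h0 t.2)
      map_smul' := fun c u => by
        ext t
        change ∫ s in (0 : ℝ)..t, (c • u : Lp W 2 unitVolume) s = c • ∫ s in (0 : ℝ)..t, u s
        rw [intervalIntegral_congr_unit (Lp.coeFn_smul c u) (by simp) t.2]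
        exact intervalIntegral.integral_smul _ _ } 1 (fun u => by
      rw [ContinuousMap.norm_le _ (by positivity), one_mul]
      intro t
      have h0 : (0 : ℝ) ∈ Icc (0 : ℝ) 1 := by simp
      refine (intervalIntegral.norm_integral_le_integral_norm t.2.1).trans ?_
      refine (intervalIntegral_norm_le u h0 t.2 t.2.1).trans ?_
      refine mul_le_of_le_one_right (norm_nonneg _) ?_
      rw [Real.sqrt_le_one]
      linarith [t.2.2])

@[simp]
theorem volterra_apply (u : Lp W 2 unitVolume) (t : Icc (0 : ℝ) 1) :
    volterra W u t = ∫ s in (0 : ℝ)..t, u s := rfl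

end SquareIntegrable

/-! ## Controlled differential equations in a vector space -/

section ControlledODE

/-- The local solution operator of the controlled equation `y' = F(y) u`, `y(0) = z₀`. -/
theorem exists_local_controlled_flow.{u} {L H : Type u} [NormedAddCommGroup L] [NormedSpace ℝ L]
    [FiniteDimensional ℝ L] [NormedAddCommGroup H] [NormedSpace ℝ H] [CompleteSpace H]
    (F : C(L, H →L[ℝ] L)) (hF : ContDiff ℝ ∞ F) (z₀ : L) :
    ∃ Y : Lp H 2 unitVolume → C(Icc (0 : ℝ) 1, L), ContDiffAt ℝ ∞ Y 0 ∧
      Y 0 = ContinuousMap.const _ z₀ ∧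
      HasFDerivAt Y ((volterra L).comp (pathApplyL H L (ContinuousMap.const _ (F z₀)))) 0 ∧
      ∀ᶠ u in 𝓝 0, Y u = ContinuousMap.const _ z₀ + volterra L (pathApplyL H L (F.comp (Y u)) u) := by
  have : CompleteSpace L := FiniteDimensional.complete ℝ L
  set y₀ : C(Icc (0 : ℝ) 1, L) := ContinuousMap.const _ z₀ with hy₀
  set T : Lp H 2 unitVolume →L[ℝ] C(Icc (0 : ℝ) 1, L) :=
    (volterra L).comp (pathApplyL H L (ContinuousMap.const _ (F z₀))) with hT
  -- The equation reads `Ψ (y, u) = (0, u)`. Carrying `u` along as a second component turns the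
  -- implicit function theorem into the inverse function theorem.
  set Ψ : C(Icc (0 : ℝ) 1, L) × Lp H 2 unitVolume → C(Icc (0 : ℝ) 1, L) × Lp H 2 unitVolume :=
    fun q => (q.1 - y₀ - volterra L (pathApplyL H L (F.comp q.1) q.2), q.2) with hΨ
  have hN := ContinuousMap.contDiff_comp_left (K := Icc (0 : ℝ) 1) F hF
  have hΨs : ContDiff ℝ ∞ Ψ := by
    refine ContDiff.prodMk (ContDiff.sub (contDiff_fst.sub contDiff_const) ?_) contDiff_snd
    exact (volterra L).contDiff.comp
      (((pathApplyL H L).contDiff.comp (hN.comp contDiff_fst)).clm_apply contDiff_snd)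
  have hFc : F.comp y₀ = ContinuousMap.const _ (F z₀) := rfl
  -- At `u = 0` the contribution of the derivative of `F` vanishes, so `Ψ` has the shear `(y, v) ↦
  -- (y - T v, v)` as its differential there.
  let e : (C(Icc (0 : ℝ) 1, L) × Lp H 2 unitVolume) ≃L[ℝ]
      (C(Icc (0 : ℝ) 1, L) × Lp H 2 unitVolume) :=
    ContinuousLinearEquiv.equivOfInverse
      ((ContinuousLinearMap.fst ℝ _ _ - T.comp (ContinuousLinearMap.snd ℝ _ _)).prod
        (ContinuousLinearMap.snd ℝ _ _))
      ((ContinuousLinearMap.fst ℝ _ _ + T.comp (ContinuousLinearMap.snd ℝ _ _)).prod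
        (ContinuousLinearMap.snd ℝ _ _))
      (fun q => by ext <;> simp) (fun q => by ext <;> simp)
  have hd : HasFDerivAt Ψ (e : (C(Icc (0 : ℝ) 1, L) × Lp H 2 unitVolume) →L[ℝ]
      (C(Icc (0 : ℝ) 1, L) × Lp H 2 unitVolume)) (y₀, 0) := by
    have hNd : HasFDerivAt (fun q : C(Icc (0 : ℝ) 1, L) × Lp H 2 unitVolume => F.comp q.1) _ (y₀, 0) :=
      HasFDerivAt.comp (g := fun y : C(Icc (0 : ℝ) 1, L) => F.comp y) (f := Prod.fst) (y₀, 0)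
        ((hN.differentiable (by simp)).differentiableAt.hasFDerivAt (x := y₀))
        (hasFDerivAt_fst (𝕜 := ℝ) (p := (y₀, (0 : Lp H 2 unitVolume))))
    have h1 := (pathApplyL H L).hasFDerivAt_of_bilinear hNd
      (hasFDerivAt_snd (𝕜 := ℝ) (p := (y₀, (0 : Lp H 2 unitVolume))))
    have h2 := ((hasFDerivAt_fst (𝕜 := ℝ) (p := (y₀, (0 : Lp H 2 unitVolume)))).sub_const y₀).sub
      ((volterra L).hasFDerivAt.comp _ h1)
    have h3 := h2.prodMk (hasFDerivAt_snd (𝕜 := ℝ) (p := (y₀, (0 : Lp H 2 unitVolume))))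
    refine h3.congr_fderiv ?_
    refine ContinuousLinearMap.ext fun q => ?_
    simp [e, hT, hFc]
  have hΨ0 : Ψ (y₀, 0) = 0 := by simp [hΨ]
  have hΨa : ContDiffAt ℝ ∞ Ψ (y₀, 0) := hΨs.contDiffAt
  set inv := hΨa.localInverse hd (by simp) with hinv
  have hinvs : ContDiffAt ℝ ∞ inv 0 := by
    have := hΨa.to_localInverse hd (by simp)
    rwa [hΨ0] at this
  have hstr := hΨa.hasStrictFDerivAt' hd (by simp)
  have hinvd : HasFDerivAt inv (e.symm : (C(Icc (0 : ℝ) 1, L) × Lp H 2 unitVolume) →L[ℝ]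
      (C(Icc (0 : ℝ) 1, L) × Lp H 2 unitVolume)) 0 := by
    have := hstr.to_localInverse.hasFDerivAt
    rwa [hΨ0] at this
  have hinv0 : inv 0 = (y₀, 0) := by
    have := hΨa.localInverse_apply_image hd (by simp)
    rwa [hΨ0] at this
  have hright : ∀ᶠ z in 𝓝 (0 : C(Icc (0 : ℝ) 1, L) × Lp H 2 unitVolume), Ψ (inv z) = z := by
    have := hstr.eventually_right_inverse
    rwa [hΨ0] at this
  have hι : Continuous (fun u : Lp H 2 unitVolume => ((0 : C(Icc (0 : ℝ) 1, L)), u)) := by fun_prop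
  refine ⟨fun u => (inv (0, u)).1, ?_, ?_, ?_, ?_⟩
  · exact contDiffAt_fst.comp _ (ContDiffAt.comp (g := inv) 0 hinvs
      (contDiffAt_const.prodMk contDiffAt_id))
  · change (inv 0).1 = _
    rw [hinv0]
  · have h1 : HasFDerivAt (fun u : Lp H 2 unitVolume => ((0 : C(Icc (0 : ℝ) 1, L)), u))
        (ContinuousLinearMap.inr ℝ _ _) 0 :=
      (ContinuousLinearMap.inr ℝ C(Icc (0 : ℝ) 1, L) (Lp H 2 unitVolume)).hasFDerivAt
    have h2 := (ContinuousLinearMap.fst ℝ C(Icc (0 : ℝ) 1, L)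
      (Lp H 2 unitVolume)).hasFDerivAt.comp 0 (HasFDerivAt.comp (g := inv) 0 hinvd h1)
    refine h2.congr_fderiv ?_
    refine ContinuousLinearMap.ext fun v => ?_
    exact zero_add (T v)
  · have := hι.tendsto 0 |>.eventually hright
    filter_upwards [this] with u hu
    have h2 : (inv (0, u)).2 = u := congrArg Prod.snd hu
    have h1 : (inv (0, u)).1 - y₀ - volterra L (pathApplyL H L (F.comp (inv (0, u)).1)
      (inv (0, u)).2) = 0 := congrArg Prod.fst hu
    rw [h2] at h1
    exact sub_eq_iff_eq_add'.1 (sub_eq_zero.1 h1)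

/-- The chain rule for the composition of a `C¹` function with an absolutely continuous path whose
velocity is square integrable. -/
theorem comp_volterra_eq {L : Type*} [NormedAddCommGroup L] [NormedSpace ℝ L]
    [FiniteDimensional ℝ L] {ψ : L → ℝ} {O : Set L} (hO : IsOpen O) (hψ : ContDiffOn ℝ 1 ψ O)
    {z₀ : L} {ρ : ℝ} (hρ : Metric.closedBall z₀ ρ ⊆ O) (y : C(Icc (0 : ℝ) 1, L))
    (hy : ∀ t, y t ∈ Metric.closedBall z₀ ρ) (a : Lp L 2 unitVolume) (c : L)
    (hya : y = ContinuousMap.const _ c + volterra L a) {t : ℝ} (ht : t ∈ Icc (0 : ℝ) 1) :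
    ψ (y (toUnit t)) = ψ (y (toUnit 0)) + ∫ s in (0 : ℝ)..t, fderiv ℝ ψ (y (toUnit s)) (a s) := by
  have : CompleteSpace L := FiniteDimensional.complete ℝ L
  have hψd : ∀ z ∈ O, HasFDerivAt ψ (fderiv ℝ ψ z) z := fun z hz =>
    ((hψ.differentiableOn (by simp)).differentiableAt (hO.mem_nhds hz)).hasFDerivAt
  have hψc : ContinuousOn (fderiv ℝ ψ) O := hψ.continuousOn_fderiv_of_isOpen hO (by simp)
  have hAc : ContinuousOn (fun s => fderiv ℝ ψ (y (toUnit s))) (Icc 0 1) :=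
    hψc.comp (continuousOn_comp_toUnit y) fun s _ => hρ (hy _)
  have hint := integrable_apply hAc a
  have h0 : (0 : ℝ) ∈ Icc (0 : ℝ) 1 := by simp
  have hyst : ∀ s ∈ Icc (0 : ℝ) 1, ∀ t ∈ Icc (0 : ℝ) 1,
      y (toUnit t) - y (toUnit s) = ∫ r in s..t, a r := by
    intro s hs t ht
    rw [hya]
    simp only [ContinuousMap.add_apply, ContinuousMap.const_apply, volterra_apply, toUnit,
      projIcc_of_mem zero_le_one hs, projIcc_of_mem zero_le_one ht, add_sub_add_left_eq_sub]
    exact intervalIntegral.integral_interval_sub_left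
      ((integrable_lp_two a).intervalIntegrable_unit h0 ht)
      ((integrable_lp_two a).intervalIntegrable_unit h0 hs)
  have hinc : ∀ s ∈ Icc (0 : ℝ) 1, ∀ t ∈ Icc (0 : ℝ) 1, s ≤ t →
      ‖y (toUnit t) - y (toUnit s)‖ ≤ ∫ r in s..t, ‖a r‖ := fun s hs t ht hst => by
    rw [hyst s hs t ht]; exact intervalIntegral.norm_integral_le_integral_norm hst
  -- `D` is the defect in the chain rule and `K` the total variation. Half of `ε` pays for
  -- linearizing `ψ` over a short time, the other half for freezing its derivative at the initial
  -- time.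
  have key := eq_of_increment_le
    (D := fun t => ψ (y (toUnit t)) - ∫ s in (0 : ℝ)..t, fderiv ℝ ψ (y (toUnit s)) (a s))
    (K := fun t => ∫ s in (0 : ℝ)..t, ‖a s‖) ?_ ht
  · simp only [intervalIntegral.integral_same, sub_zero] at key
    linarith
  intro ε hε
  have hu := (isCompact_closedBall z₀ ρ).uniformContinuousOn_of_continuous (hψc.mono hρ)
  rw [Metric.uniformContinuousOn_iff] at hu
  obtain ⟨δ₁, hδ₁, hu⟩ := hu (ε / 2) (by positivity)
  have hyu := CompactSpace.uniformContinuous_of_continuous y.continuous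
  rw [Metric.uniformContinuous_iff] at hyu
  obtain ⟨δ, hδ, hyu⟩ := hyu δ₁ hδ₁
  have hyu' : ∀ s ∈ Icc (0 : ℝ) 1, ∀ t ∈ Icc (0 : ℝ) 1, |t - s| < δ →
      dist (y (toUnit t)) (y (toUnit s)) < δ₁ := by
    intro s hs t ht hst
    apply hyu
    rw [toUnit, toUnit, projIcc_of_mem zero_le_one hs, projIcc_of_mem zero_le_one ht]
    exact hst
  refine ⟨δ, hδ, fun s hs t ht hst hstδ => ?_⟩
  have hi := hint.intervalIntegrable_unit hs ht
  have hia := (integrable_lp_two a).intervalIntegrable_unit hs ht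
  have hian := (integrable_lp_two a).norm.intervalIntegrable_unit hs ht
  have hK : (∫ r in (0 : ℝ)..t, ‖a r‖) - ∫ r in (0 : ℝ)..s, ‖a r‖ = ∫ r in s..t, ‖a r‖ :=
    intervalIntegral.integral_interval_sub_left
      ((integrable_lp_two a).norm.intervalIntegrable_unit h0 ht)
      ((integrable_lp_two a).norm.intervalIntegrable_unit h0 hs)
  have hD : (∫ r in (0 : ℝ)..t, fderiv ℝ ψ (y (toUnit r)) (a r)) -
      ∫ r in (0 : ℝ)..s, fderiv ℝ ψ (y (toUnit r)) (a r) =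
      ∫ r in s..t, fderiv ℝ ψ (y (toUnit r)) (a r) :=
    intervalIntegral.integral_interval_sub_left (hint.intervalIntegrable_unit h0 ht)
      (hint.intervalIntegrable_unit h0 hs)
  have hmain : ‖ψ (y (toUnit t)) - ψ (y (toUnit s)) -
      fderiv ℝ ψ (y (toUnit s)) (y (toUnit t) - y (toUnit s))‖ ≤
      ε / 2 * ‖y (toUnit t) - y (toUnit s)‖ := by
    have hsub : segment ℝ (y (toUnit s)) (y (toUnit t)) ⊆ Metric.closedBall z₀ ρ :=
      (convex_closedBall z₀ ρ).segment_subset (hy _) (hy _)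
    refine (convex_segment (𝕜 := ℝ) (y (toUnit s)) (y (toUnit t))).norm_image_sub_le_of_norm_hasFDerivWithin_le'
      (f' := fderiv ℝ ψ) (fun z hz => (hψd z (hρ (hsub hz))).hasFDerivWithinAt) (fun z hz => ?_)
      (left_mem_segment ℝ _ _) (right_mem_segment ℝ _ _)
    have := hu z (hsub hz) (y (toUnit s)) (hy _) ?_
    · rw [dist_eq_norm] at this; exact this.le
    · have h1 := hyu' s hs t ht (by rwa [abs_of_nonneg (by linarith)])
      refine lt_of_le_of_lt ?_ h1
      rw [dist_eq_norm, dist_eq_norm]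
      exact norm_sub_le_of_mem_segment hz
  have hlin : fderiv ℝ ψ (y (toUnit s)) (y (toUnit t) - y (toUnit s)) =
      ∫ r in s..t, fderiv ℝ ψ (y (toUnit s)) (a r) := by
    rw [hyst s hs t ht, ContinuousLinearMap.intervalIntegral_comp_comm _ hia]
  have hic : IntervalIntegrable (fun r => fderiv ℝ ψ (y (toUnit s)) (a r)) volume s t :=
    (integrable_apply (A := fun _ => fderiv ℝ ψ (y (toUnit s))) continuousOn_const
      a).intervalIntegrable_unit hs ht
  have hrest : ‖(∫ r in s..t, fderiv ℝ ψ (y (toUnit s)) (a r)) -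
      ∫ r in s..t, fderiv ℝ ψ (y (toUnit r)) (a r)‖ ≤ ε / 2 * ∫ r in s..t, ‖a r‖ := by
    rw [← intervalIntegral.integral_sub hic hi, ← intervalIntegral.integral_const_mul]
    refine intervalIntegral.norm_integral_le_of_norm_le hst ?_ (hian.const_mul _)
    refine Filter.Eventually.of_forall fun r hr => ?_
    rw [← sub_apply]
    refine ContinuousLinearMap.le_of_opNorm_le _ ?_ _
    have hr' : r ∈ Icc (0 : ℝ) 1 := ⟨hs.1.trans hr.1.le, hr.2.trans ht.2⟩
    have := hu (y (toUnit s)) (hy _) (y (toUnit r)) (hy _)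
      (hyu' r hr' s hs (by rw [abs_sub_comm, abs_of_nonneg (by linarith [hr.1])]; linarith [hr.2]))
    rw [dist_eq_norm] at this
    exact this.le
  have hincst := hinc s hs t ht hst
  rw [hK]
  have hsplit : (ψ (y (toUnit t)) - ∫ s in (0 : ℝ)..t, fderiv ℝ ψ (y (toUnit s)) (a s)) -
      (ψ (y (toUnit s)) - ∫ r in (0 : ℝ)..s, fderiv ℝ ψ (y (toUnit r)) (a r)) =
      (ψ (y (toUnit t)) - ψ (y (toUnit s)) -
      fderiv ℝ ψ (y (toUnit s)) (y (toUnit t) - y (toUnit s))) +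
      ((∫ r in s..t, fderiv ℝ ψ (y (toUnit s)) (a r)) -
      ∫ r in s..t, fderiv ℝ ψ (y (toUnit r)) (a r)) := by
    rw [hlin, ← hD]; ring
  rw [hsplit, ← Real.norm_eq_abs]
  refine (norm_add_le _ _).trans ?_
  nlinarith

end ControlledODE

/-! ## Tangent spaces of submanifolds -/

/-- The implicit function parametrizes the level set by the kernel, and the curve is the image of
the line `t • v`. The kernel is complemented because the range is finite dimensional. -/
theorem HasStrictFDerivAt.exists_curve_of_mem_ker {E W : Type*} [NormedAddCommGroup E]
    [NormedSpace ℝ E] [CompleteSpace E] [NormedAddCommGroup W] [NormedSpace ℝ W]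
    [FiniteDimensional ℝ W] {f : E → W} {f' : E →L[ℝ] W} {a : E} (hf : HasStrictFDerivAt f f' a)
    (hsurj : Function.Surjective f') {v : E} (hv : f' v = 0) :
    ∃ c : ℝ → E, c 0 = a ∧ HasDerivAt c v 0 ∧ ∀ᶠ t in 𝓝 0, f (c t) = f a := by
  have hr : f'.range = ⊤ := LinearMap.range_eq_top.2 hsurj
  have := FiniteDimensional.complete ℝ W
  have hker : f'.ker.ClosedComplemented := f'.ker_closedComplemented_of_finiteDimensional_range
  set g := hf.implicitFunctionOfComplemented f f' hr hker with hg
  have hline : HasDerivAt (fun t : ℝ => t • (⟨v, hv⟩ : f'.ker)) ⟨v, hv⟩ 0 := by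
    simpa using (hasDerivAt_id (0 : ℝ)).smul_const (⟨v, hv⟩ : f'.ker)
  have hgd := (hf.to_implicitFunctionOfComplemented hr hker).hasFDerivAt
  refine ⟨fun t => g (f a) (t • ⟨v, hv⟩), ?_, ?_, ?_⟩
  · simp [hg]
  · have hgd' : HasFDerivAt (g (f a)) f'.ker.subtypeL ((0 : ℝ) • (⟨v, hv⟩ : f'.ker)) := by
      rw [zero_smul]; exact hgd
    exact hgd'.comp_hasDerivAt (0 : ℝ) hline
  · have ht : Filter.Tendsto (fun t : ℝ => (f a, t • (⟨v, hv⟩ : f'.ker))) (𝓝 0) (𝓝 (f a, 0)) := by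
      have h1 : Continuous fun t : ℝ => (f a, t • (⟨v, hv⟩ : f'.ker)) := by fun_prop
      simpa using h1.tendsto 0
    exact ht.eventually (hf.map_implicitFunctionOfComplemented_eq hr hker)

section Tangent

variable {F : Type*} [NormedAddCommGroup F] [NormedSpace ℝ F]
  {X : Type*} [TopologicalSpace X] [ChartedSpace F X]
  {F' : Type*} [NormedAddCommGroup F'] [NormedSpace ℝ F']
  {Y : Type*} [TopologicalSpace Y] [ChartedSpace F' Y]
  {F'' : Type*} [NormedAddCommGroup F''] [NormedSpace ℝ F'']
  {Z : Type*} [TopologicalSpace Z] [ChartedSpace F'' Z]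

theorem mfderiv_comp_apply_of_eq' {f : X → Y} {g : Y → Z} {x : X} {y : Y} (hy : f x = y)
    (hg : MDifferentiableAt 𝓘(ℝ, F') 𝓘(ℝ, F'') g y) (hf : MDifferentiableAt 𝓘(ℝ, F) 𝓘(ℝ, F') f x)
    (v : F) : (mfderiv 𝓘(ℝ, F) 𝓘(ℝ, F'') (fun x => g (f x)) x v : F'') =
      (mfderiv 𝓘(ℝ, F') 𝓘(ℝ, F'') g y (mfderiv 𝓘(ℝ, F) 𝓘(ℝ, F') f x v : F') : F'') := by
  subst hy
  exact mfderiv_comp_apply x hg hf v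

/-- Differentiating `f ∘ γ = 0` gives one inclusion. For the other, the implicit function theorem in
a chart realizes each kernel vector as the velocity of a single curve. -/
theorem mem_tangentSub_iff [CompleteSpace F] {W : Type*} [NormedAddCommGroup W] [NormedSpace ℝ W]
    [FiniteDimensional ℝ W] {A : Set X} {x : X} (hx : x ∈ A) {U : Set X} (hU : U ∈ 𝓝 x) {f : X → W}
    (hf : ContMDiffAt 𝓘(ℝ, F) 𝓘(ℝ, W) 1 f x) (hA : ∀ y ∈ U, y ∈ A ↔ f y = 0)
    (hsurj : Function.Surjective (mfderiv 𝓘(ℝ, F) 𝓘(ℝ, W) f x)) (v : TangentSpace 𝓘(ℝ, F) x) :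
    v ∈ tangentSub F A x ↔ (mfderiv 𝓘(ℝ, F) 𝓘(ℝ, W) f x v : W) = 0 := by
  have hfd := hf.mdifferentiableAt (by simp)
  constructor
  · intro hv
    suffices h : tangentSub F A x ≤ LinearMap.ker (mfderiv 𝓘(ℝ, F) 𝓘(ℝ, W) f x).toLinearMap from h hv
    refine Submodule.span_le.2 ?_
    rintro v ⟨γ, rfl, hγA, hγ⟩
    have h1 := hfd.hasMFDerivAt.comp 0 hγ
    have h2 : HasMFDerivAt 𝓘(ℝ, ℝ) 𝓘(ℝ, W) (f ∘ γ) 0 0 := by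
      refine (hasMFDerivAt_const (0 : W) (0 : ℝ)).congr_of_eventuallyEq ?_
      filter_upwards [hγ.continuousAt.eventually hU] with t ht
      exact (hA _ ht).1 (hγA t)
    have h3 := hasMFDerivAt_unique h1 h2
    have h4 := congrArg (fun T : ℝ →L[ℝ] W => T 1) h3
    have h5 : ((ContinuousLinearMap.toSpanSingleton ℝ (v : F)) 1 : F) = v := by simp
    change (mfderiv 𝓘(ℝ, F) 𝓘(ℝ, W) f (γ 0)
      ((ContinuousLinearMap.toSpanSingleton ℝ (v : F)) 1 : F) : W) = 0 at h4
    rw [h5] at h4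
    exact h4
  · intro hv
    set φ := extChartAt 𝓘(ℝ, F) x with hφ
    set fh : F → W := f ∘ φ.symm with hfh
    have hfs : ContDiffAt ℝ 1 fh (φ x) := by
      have := (contMDiffAt_iff.1 hf).2
      rw [← contDiffWithinAt_univ, ← range_id]
      exact this
    have hfe : (mfderiv 𝓘(ℝ, F) 𝓘(ℝ, W) f x : F →L[ℝ] W) = fderiv ℝ fh (φ x) := by
      rw [hfd.mfderiv, ← fderivWithin_univ, ← range_id]
      rfl
    have hstr := hfs.hasStrictFDerivAt (by simp)
    obtain ⟨c, hc0, hcd, hcf⟩ := hstr.exists_curve_of_mem_ker (v := v)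
      (by rw [← hfe]; exact hsurj) (by rw [← hfe]; exact hv)
    have hcc : ContinuousAt c 0 := hcd.continuousAt
    have hφx : φ.symm (φ x) = x := extChartAt_to_inv x
    have hγc : ContinuousAt (fun t => φ.symm (c t)) 0 := by
      refine ContinuousAt.comp (g := φ.symm) ?_ hcc
      rw [hc0]; exact continuousAt_extChartAt_symm x
    have hev : ∀ᶠ t in 𝓝 (0 : ℝ), φ.symm (c t) ∈ A := by
      have hU' : ∀ᶠ t in 𝓝 (0 : ℝ), φ.symm (c t) ∈ U := by
        apply hγc
        simpa only [hc0, hφx] using hU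
      filter_upwards [hU', hcf] with t h1 h2
      rw [hA _ h1]
      change fh (c t) = 0
      rw [h2]
      change f (φ.symm (φ x)) = 0
      rw [hφx]
      exact (hA x (mem_of_mem_nhds hU)).1 hx
    classical
    -- A curve in the definition of `tangentSub` must lie in `A` at all times, but the implicit one
    -- does so only near `0`; elsewhere it is replaced by the constant `x`.
    refine Submodule.subset_span ⟨fun t => if φ.symm (c t) ∈ A then φ.symm (c t) else x, ?_, ?_, ?_⟩
    · simp [hc0, hφx, hx]
    · intro t
      dsimp only
      split_ifs with h
      exacts [h, hx]
    · have hγ0 : (fun t => if φ.symm (c t) ∈ A then φ.symm (c t) else x) =ᶠ[𝓝 0]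
          fun t => φ.symm (c t) := by
        filter_upwards [hev] with t ht
        simp [ht]
      refine ⟨hγc.congr hγ0.symm, ?_⟩
      have hx0 : (if φ.symm (c 0) ∈ A then φ.symm (c 0) else x) = x := by simp [hc0, hφx, hx]
      have hT : ∀ᶠ t in 𝓝 (0 : ℝ), c t ∈ φ.target := by
        apply hcc
        rw [hc0]; exact extChartAt_target_mem_nhds x
      have : HasFDerivAt (fun t => φ (if φ.symm (c t) ∈ A then φ.symm (c t) else x))
          (ContinuousLinearMap.toSpanSingleton ℝ (v : F)) 0 := by
        refine HasFDerivAt.congr_of_eventuallyEq (f := c) hcd.hasFDerivAt ?_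
        filter_upwards [hev, hT] with t h1 h2
        rw [if_pos h1, φ.right_inv h2]
      change HasFDerivWithinAt (fun t => extChartAt 𝓘(ℝ, F)
        (if φ.symm (c 0) ∈ A then φ.symm (c 0) else x)
          (if φ.symm (c t) ∈ A then φ.symm (c t) else x)) _ (range id) 0
      rw [hx0]
      exact this.hasFDerivWithinAt

theorem IsClosedSubmanifold.mem_tangentSub_iff [CompleteSpace F] {A : Set X}
    (hA : IsClosedSubmanifold F A) : ∃ k : ℕ, ∀ x ∈ A, ∃ U : Set X, IsOpen U ∧ x ∈ U ∧
    ∃ f : X → EuclideanSpace ℝ (Fin k),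
      ContMDiffOn 𝓘(ℝ, F) 𝓘(ℝ, EuclideanSpace ℝ (Fin k)) ∞ f U ∧
      (∀ y ∈ U, y ∈ A ↔ f y = 0) ∧
      (∀ y ∈ U, Function.Surjective (mfderiv 𝓘(ℝ, F) 𝓘(ℝ, EuclideanSpace ℝ (Fin k)) f y)) ∧
      ∀ y ∈ U, y ∈ A → ∀ v : TangentSpace 𝓘(ℝ, F) y, v ∈ tangentSub F A y ↔
        (mfderiv 𝓘(ℝ, F) 𝓘(ℝ, EuclideanSpace ℝ (Fin k)) f y v : EuclideanSpace ℝ (Fin k)) = 0 := by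
  obtain ⟨-, k, h⟩ := hA
  refine ⟨k, fun x hx => ?_⟩
  obtain ⟨U, hU, hxU, f, hf, hfA, hfs⟩ := h x hx
  refine ⟨U, hU, hxU, f, hf, hfA, hfs, fun y hy hyA v => ?_⟩
  exact _root_.mem_tangentSub_iff hyA (hU.mem_nhds hy)
    (((hf y hy).contMDiffAt (hU.mem_nhds hy)).of_le (by simp)) hfA (hfs y hy) v

end Tangent

/-! ## Riemannian submersions and reflections -/

section Submersion

variable {F : Type*} [NormedAddCommGroup F] [NormedSpace ℝ F] [CompleteSpace F]
  {X : Type*} [TopologicalSpace X] [ChartedSpace F X]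
  {F' : Type*} [NormedAddCommGroup F'] [NormedSpace ℝ F'] [CompleteSpace F']
  {Y : Type*} [TopologicalSpace Y] [ChartedSpace F' Y]

/-- `π` is a Riemannian submersion at the points of the open set `X₀`: every tangent vector at
`π x` has a horizontal lift, expressed through the adjoint of the differential of `π`. -/
structure IsRiemannianSubmersionOn
    (mX : ∀ x : X, TangentSpace 𝓘(ℝ, F) x → TangentSpace 𝓘(ℝ, F) x → ℝ)
    (mY : ∀ y : Y, TangentSpace 𝓘(ℝ, F') y → TangentSpace 𝓘(ℝ, F') y → ℝ)
    (π : X → Y) (X₀ : Set X) : Prop where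
  isOpen : IsOpen X₀
  contMDiffAt : ∀ x ∈ X₀, ContMDiffAt 𝓘(ℝ, F) 𝓘(ℝ, F') ∞ π x
  exists_lift : ∀ x ∈ X₀, ∀ η : TangentSpace 𝓘(ℝ, F') (π x), ∃ ξ : TangentSpace 𝓘(ℝ, F) x,
    mfderiv 𝓘(ℝ, F) 𝓘(ℝ, F') π x ξ = η ∧
      ∀ ζ, mX x ζ ξ = mY (π x) (mfderiv 𝓘(ℝ, F) 𝓘(ℝ, F') π x ζ) η

namespace IsRiemannianSubmersionOn

variable {mX : ∀ x : X, TangentSpace 𝓘(ℝ, F) x → TangentSpace 𝓘(ℝ, F) x → ℝ}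
  {mY : ∀ y : Y, TangentSpace 𝓘(ℝ, F') y → TangentSpace 𝓘(ℝ, F') y → ℝ}
  {π : X → Y} {X₀ : Set X} {N : Set Y}

theorem mdifferentiableAt (h : IsRiemannianSubmersionOn mX mY π X₀) {x : X} (hx : x ∈ X₀) :
    MDifferentiableAt 𝓘(ℝ, F) 𝓘(ℝ, F') π x :=
  (h.contMDiffAt x hx).mdifferentiableAt (by simp)

/-- A local defining submersion `f` of `N` pulls back to the defining submersion `f ∘ π`. The chain
rule and the tangent spaces of `N` are recorded with it, so that tangent vectors above and below can
be compared. -/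
theorem exists_submersion_comp (h : IsRiemannianSubmersionOn mX mY π X₀)
    (hN : IsClosedSubmanifold F' N) : ∃ k : ℕ, ∀ x ∈ X₀ ∩ π ⁻¹' N, ∃ U : Set X, IsOpen U ∧ x ∈ U ∧
    U ⊆ X₀ ∧
    ∃ f : Y → EuclideanSpace ℝ (Fin k),
      ContMDiffOn 𝓘(ℝ, F) 𝓘(ℝ, EuclideanSpace ℝ (Fin k)) ∞ (fun y => f (π y)) U ∧
      (∀ y ∈ U, y ∈ X₀ ∩ π ⁻¹' N ↔ f (π y) = 0) ∧
      (∀ y ∈ U, ∀ v : TangentSpace 𝓘(ℝ, F) y,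
        (mfderiv 𝓘(ℝ, F) 𝓘(ℝ, EuclideanSpace ℝ (Fin k)) (fun y => f (π y)) y v :
          EuclideanSpace ℝ (Fin k)) =
        (mfderiv 𝓘(ℝ, F') 𝓘(ℝ, EuclideanSpace ℝ (Fin k)) f (π y)
          (mfderiv 𝓘(ℝ, F) 𝓘(ℝ, F') π y v) : EuclideanSpace ℝ (Fin k))) ∧
      (∀ y ∈ U, Function.Surjective
        (mfderiv 𝓘(ℝ, F) 𝓘(ℝ, EuclideanSpace ℝ (Fin k)) (fun y => f (π y)) y)) ∧
      ∀ y ∈ U, π y ∈ N → ∀ v : TangentSpace 𝓘(ℝ, F') (π y), v ∈ tangentSub F' N (π y) ↔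
        (mfderiv 𝓘(ℝ, F') 𝓘(ℝ, EuclideanSpace ℝ (Fin k)) f (π y) v : EuclideanSpace ℝ (Fin k)) = 0 := by
  obtain ⟨k, hk⟩ := hN.mem_tangentSub_iff
  refine ⟨k, fun x hx => ?_⟩
  obtain ⟨U, hU, hxU, f, hf, hfA, hfs, hft⟩ := hk (π x) hx.2
  have hc : ContinuousOn π X₀ := fun y hy => (h.contMDiffAt y hy).continuousAt.continuousWithinAt
  have hfy : ∀ y ∈ X₀ ∩ π ⁻¹' U,
      ContMDiffAt 𝓘(ℝ, F') 𝓘(ℝ, EuclideanSpace ℝ (Fin k)) ∞ f (π y) := fun y hy =>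
    (hf (π y) hy.2).contMDiffAt (hU.mem_nhds hy.2)
  have hd : ∀ y ∈ X₀ ∩ π ⁻¹' U, ∀ v : TangentSpace 𝓘(ℝ, F) y,
        (mfderiv 𝓘(ℝ, F) 𝓘(ℝ, EuclideanSpace ℝ (Fin k)) (fun y => f (π y)) y v :
          EuclideanSpace ℝ (Fin k)) =
        (mfderiv 𝓘(ℝ, F') 𝓘(ℝ, EuclideanSpace ℝ (Fin k)) f (π y)
          (mfderiv 𝓘(ℝ, F) 𝓘(ℝ, F') π y v) : EuclideanSpace ℝ (Fin k)) := fun y hy v =>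
    mfderiv_comp_apply_of_eq' rfl ((hfy y hy).mdifferentiableAt (by simp))
      (h.mdifferentiableAt hy.1) v
  refine ⟨X₀ ∩ π ⁻¹' U, hc.isOpen_inter_preimage h.isOpen hU, ⟨hx.1, hxU⟩, inter_subset_left, f,
    ?_, ?_, hd, ?_, fun y hy hyN v => hft _ hy.2 hyN v⟩
  · intro y hy
    exact ((hfy y hy).comp y (h.contMDiffAt y hy.1)).contMDiffWithinAt
  · intro y hy
    rw [← hfA _ hy.2]
    exact ⟨fun h => h.2, fun h => ⟨hy.1, h⟩⟩
  · intro y hy w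
    obtain ⟨v', hv'⟩ := hfs _ hy.2 w
    obtain ⟨v, hv, -⟩ := h.exists_lift y hy.1 v'
    refine ⟨v, ?_⟩
    refine (hd y hy v).trans ?_
    rw [hv]
    exact hv'

theorem isClosedSubmanifold_preimage (h : IsRiemannianSubmersionOn mX mY π X₀)
    (hN : IsClosedSubmanifold F' N) (hcl : IsClosed (X₀ ∩ π ⁻¹' N)) :
    IsClosedSubmanifold F (X₀ ∩ π ⁻¹' N) := by
  obtain ⟨k, hk⟩ := h.exists_submersion_comp hN
  refine ⟨hcl, k, fun x hx => ?_⟩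
  obtain ⟨U, hU, hxU, -, f, hf, hfA, -, hfs, -⟩ := hk x hx
  exact ⟨U, hU, hxU, fun y => f (π y), hf, hfA, hfs⟩

theorem mem_tangentSub_preimage (h : IsRiemannianSubmersionOn mX mY π X₀)
    (hN : IsClosedSubmanifold F' N) {x : X} (hx : x ∈ X₀ ∩ π ⁻¹' N) (v : TangentSpace 𝓘(ℝ, F) x) :
    v ∈ tangentSub F (X₀ ∩ π ⁻¹' N) x ↔
      mfderiv 𝓘(ℝ, F) 𝓘(ℝ, F') π x v ∈ tangentSub F' N (π x) := by
  obtain ⟨k, hk⟩ := h.exists_submersion_comp hN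
  obtain ⟨U, hU, hxU, -, f, hf, hfA, hd, hfs, hft⟩ := hk x hx
  rw [hft x hxU hx.2, ← hd x hxU]
  exact mem_tangentSub_iff hx (hU.mem_nhds hxU)
    (((hf x hxU).contMDiffAt (hU.mem_nhds hxU)).of_le (by simp)) hfA (hfs x hxU) v

theorem isNormalVector_lift (h : IsRiemannianSubmersionOn mX mY π X₀)
    (hN : IsClosedSubmanifold F' N) {x : X} (hx : x ∈ X₀ ∩ π ⁻¹' N) {ξ : TangentSpace 𝓘(ℝ, F) x}
    {η : TangentSpace 𝓘(ℝ, F') (π x)} (hη : IsNormalVector F' mY N (π x) η)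
    (hξ : ∀ ζ, mX x ζ ξ = mY (π x) (mfderiv 𝓘(ℝ, F) 𝓘(ℝ, F') π x ζ) η) :
    IsNormalVector F mX (X₀ ∩ π ⁻¹' N) x ξ := fun v hv => by
  rw [hξ]
  exact hη _ ((h.mem_tangentSub_preimage hN hx v).1 hv)

/-- Vertical vectors are tangent to the preimage, so normal vectors are horizontal. -/
theorem eq_zero_of_mfderiv_eq_zero (h : IsRiemannianSubmersionOn mX mY π X₀)
    (hN : IsClosedSubmanifold F' N) {x : X} (hx : x ∈ X₀ ∩ π ⁻¹' N) {ξ : TangentSpace 𝓘(ℝ, F) x}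
    (hξ : IsNormalVector F mX (X₀ ∩ π ⁻¹' N) x ξ) {v : TangentSpace 𝓘(ℝ, F) x}
    (hv : mfderiv 𝓘(ℝ, F) 𝓘(ℝ, F') π x v = 0) : mX x v ξ = 0 := by
  refine hξ v ((h.mem_tangentSub_preimage hN hx v).2 ?_)
  rw [hv]
  exact Submodule.zero_mem _

/-- The difference between `ξ` and the horizontal lift of `dπ ξ` is vertical, and both of these are
orthogonal to vertical vectors, so the difference vanishes. The metrics are bare functions here,
which is why the required linearity and definiteness are assumed one by one. -/
theorem metric_eq_of_isNormalVector (h : IsRiemannianSubmersionOn mX mY π X₀)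
    (hsub : ∀ x ζ ξ ξ', mX x ζ (ξ - ξ') = mX x ζ ξ - mX x ζ ξ')
    (hdef : ∀ x ζ, mX x ζ ζ = 0 → ζ = 0) (hY : ∀ y η, mY y 0 η = 0)
    (hN : IsClosedSubmanifold F' N) {x : X} (hx : x ∈ X₀ ∩ π ⁻¹' N) {ξ : TangentSpace 𝓘(ℝ, F) x}
    (hξ : IsNormalVector F mX (X₀ ∩ π ⁻¹' N) x ξ) :
    ∀ ζ, mX x ζ ξ = mY (π x) (mfderiv 𝓘(ℝ, F) 𝓘(ℝ, F') π x ζ) (mfderiv 𝓘(ℝ, F) 𝓘(ℝ, F') π x ξ) := by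
  obtain ⟨ξ₀, h1, h2⟩ := h.exists_lift x hx.1 (mfderiv 𝓘(ℝ, F) 𝓘(ℝ, F') π x ξ)
  have hv : mfderiv 𝓘(ℝ, F) 𝓘(ℝ, F') π x (ξ - ξ₀) = 0 := by
    rw [map_sub, h1, sub_self]
  have : ξ - ξ₀ = 0 := by
    apply hdef
    rw [hsub, h.eq_zero_of_mfderiv_eq_zero hN hx hξ hv, h2, hv, hY, sub_zero]
  rw [sub_eq_zero.1 this]
  rw [h1]
  exact h2

theorem isNormalVector_mfderiv (h : IsRiemannianSubmersionOn mX mY π X₀)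
    (hsub : ∀ x ζ ξ ξ', mX x ζ (ξ - ξ') = mX x ζ ξ - mX x ζ ξ')
    (hdef : ∀ x ζ, mX x ζ ζ = 0 → ζ = 0) (hY : ∀ y η, mY y 0 η = 0)
    (hN : IsClosedSubmanifold F' N) {x : X} (hx : x ∈ X₀ ∩ π ⁻¹' N) {ξ : TangentSpace 𝓘(ℝ, F) x}
    (hξ : IsNormalVector F mX (X₀ ∩ π ⁻¹' N) x ξ) :
    IsNormalVector F' mY N (π x) (mfderiv 𝓘(ℝ, F) 𝓘(ℝ, F') π x ξ) := by
  intro w hw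
  obtain ⟨ζ, hζ, -⟩ := h.exists_lift x hx.1 w
  have h1 := h.metric_eq_of_isNormalVector hsub hdef hY hN hx hξ ζ
  rw [hζ] at h1
  rw [← h1]
  exact hξ ζ ((h.mem_tangentSub_preimage hN hx ζ).2 (by rwa [hζ]))

/-- A normal vector `ξ` pairs with any vector through `dπ`, and `dπ` intertwines `dν` with `ds`.
Thus the isometry `dν` inherits the sign change of `ds` on `dπ ξ`; only a lift `ν` of each
stabilizing `s` is needed. -/
theorem hasReflections_preimage (h : IsRiemannianSubmersionOn mX mY π X₀)
    (hsub : ∀ x ζ ξ ξ', mX x ζ (ξ - ξ') = mX x ζ ξ - mX x ζ ξ')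
    (hdef : ∀ x ζ, mX x ζ ζ = 0 → ζ = 0) (hY : ∀ y η, mY y 0 η = 0)
    (hneg : ∀ x ζ ξ, mX x ζ (-ξ) = - mX x ζ ξ) (hnegY : ∀ y ζ ξ, mY y ζ (-ξ) = - mY y ζ ξ)
    (hN : IsClosedSubmanifold F' N) {RX : Set (X → X)} {RY : Set (Y → Y)}
    (hR : ∀ s ∈ RY, ∀ y : Y, s y = y → MDifferentiableAt 𝓘(ℝ, F') 𝓘(ℝ, F') s y ∧
      ∀ v w : F', mY y (mfderiv 𝓘(ℝ, F') 𝓘(ℝ, F') s y v : F')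
        (mfderiv 𝓘(ℝ, F') 𝓘(ℝ, F') s y w : F') = mY y v w)
    (hlift : ∀ x ∈ X₀ ∩ π ⁻¹' N, ∀ s ∈ RY, s (π x) = π x → s '' N = N →
      ∃ ν ∈ RX, ν x = x ∧ ν '' (X₀ ∩ π ⁻¹' N) = X₀ ∩ π ⁻¹' N ∧ (∀ y, π (ν y) = s (π y)) ∧
        MDifferentiableAt 𝓘(ℝ, F) 𝓘(ℝ, F) ν x ∧
        (∀ v : F, ∃ w : F, (mfderiv 𝓘(ℝ, F) 𝓘(ℝ, F) ν x w : F) = v) ∧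
        ∀ v w : F, mX x (mfderiv 𝓘(ℝ, F) 𝓘(ℝ, F) ν x v : F)
          (mfderiv 𝓘(ℝ, F) 𝓘(ℝ, F) ν x w : F) = mX x v w)
    (hr : HasReflections F' mY RY N) : HasReflections F mX RX (X₀ ∩ π ⁻¹' N) := by
  intro x hx ξ hξ
  obtain ⟨s, hs, hsx, hsξ, hsN⟩ := hr (π x) hx.2 _
    (h.isNormalVector_mfderiv hsub hdef hY hN hx hξ)
  obtain ⟨ν, hν, hνx, hνA, hπν, hνd, hνs, hνi⟩ := hlift x hx s hs hsx hsN
  refine ⟨ν, hν, hνx, ?_, hνA⟩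
  obtain ⟨hsd, hsi⟩ := hR s hs _ hsx
  have hm := h.metric_eq_of_isNormalVector hsub hdef hY hN hx hξ
  have hcomm : ∀ v : F, (mfderiv 𝓘(ℝ, F) 𝓘(ℝ, F') π x (mfderiv 𝓘(ℝ, F) 𝓘(ℝ, F) ν x v : F) : F') =
      (mfderiv 𝓘(ℝ, F') 𝓘(ℝ, F') s (π x) (mfderiv 𝓘(ℝ, F) 𝓘(ℝ, F') π x v : F') : F') := by
    intro v
    have h1 := mfderiv_comp_apply_of_eq' hνx (h.mdifferentiableAt hx.1) hνd v
    have h2 := mfderiv_comp_apply_of_eq' rfl hsd (h.mdifferentiableAt hx.1) v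
    have h3 : (fun y => π (ν y)) = fun y => s (π y) := funext hπν
    rw [h3] at h1
    exact h1.symm.trans h2
  -- With `ζ = dν w`: `⟨dν w, dν ξ⟩ = ⟨w, ξ⟩ = ⟨dπ w, dπ ξ⟩ = ⟨ds dπ w, -dπ ξ⟩ = -⟨dπ dν w, dπ ξ⟩ =
  -- -⟨dν w, ξ⟩`.
  have key : ∀ ζ : F, mX x ζ (mfderiv 𝓘(ℝ, F) 𝓘(ℝ, F) ν x ξ : F) = mX x ζ (-ξ : F) := by
    intro ζ
    obtain ⟨w, rfl⟩ := hνs ζ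
    rw [hνi w ξ]
    have e1 := hm w
    have e2 := hm (mfderiv 𝓘(ℝ, F) 𝓘(ℝ, F) ν x w : F)
    have e3 := hsi (mfderiv 𝓘(ℝ, F) 𝓘(ℝ, F') π x w : F') (mfderiv 𝓘(ℝ, F) 𝓘(ℝ, F') π x ξ : F')
    rw [hsξ] at e3
    refine e1.trans (e3.symm.trans ?_)
    refine (hnegY _ _ _).trans ?_
    refine Eq.trans ?_ (hneg _ _ _).symm
    rw [← hcomm w]
    exact congrArg Neg.neg e2.symm
  obtain ⟨z, hz⟩ : ∃ z : TangentSpace 𝓘(ℝ, F) x, z = (mfderiv 𝓘(ℝ, F) 𝓘(ℝ, F) ν x ξ : F) := ⟨_, rfl⟩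
  have key' : ∀ ζ : TangentSpace 𝓘(ℝ, F) x, mX x ζ z = mX x ζ (-ξ) := by
    rw [hz]; exact key
  have : z - -ξ = 0 := by
    apply hdef x
    rw [hsub, key', sub_self]
  exact hz.symm.trans (sub_eq_zero.1 this)

/-- The horizontal lift of a normal vector is normal to the preimage. Applying `dπ` to its
reflection upstairs gives the reflection by the covered map, and surjectivity over `N` turns
invariance of the preimage into invariance of `N`. -/
theorem hasReflections_of_preimage (h : IsRiemannianSubmersionOn mX mY π X₀)
    (hN : IsClosedSubmanifold F' N) {RX : Set (X → X)} {RY : Set (Y → Y)}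
    (hsurj : ∀ y ∈ N, ∃ x ∈ X₀, π x = y)
    (hdesc : ∀ x ∈ X₀ ∩ π ⁻¹' N, ∀ ν ∈ RX, ν x = x → ν '' (X₀ ∩ π ⁻¹' N) = X₀ ∩ π ⁻¹' N →
      ∃ s ∈ RY, (∀ y, π (ν y) = s (π y)) ∧ MDifferentiableAt 𝓘(ℝ, F') 𝓘(ℝ, F') s (π x) ∧
        MDifferentiableAt 𝓘(ℝ, F) 𝓘(ℝ, F) ν x)
    (hr : HasReflections F mX RX (X₀ ∩ π ⁻¹' N)) : HasReflections F' mY RY N := by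
  intro y hy η hη
  obtain ⟨x, hx, rfl⟩ := hsurj y hy
  obtain ⟨ξ, hξ, hξm⟩ := h.exists_lift x hx η
  obtain ⟨ν, hν, hνx, hνξ, hνA⟩ := hr x ⟨hx, hy⟩ ξ (h.isNormalVector_lift hN ⟨hx, hy⟩ hη hξm)
  obtain ⟨s, hs, hπν, hsd, hνd⟩ := hdesc x ⟨hx, hy⟩ ν hν hνx hνA
  refine ⟨s, hs, by rw [← hπν, hνx], ?_, ?_⟩
  · have h1 := mfderiv_comp_apply_of_eq' hνx (h.mdifferentiableAt hx) hνd ξ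
    have h2 := mfderiv_comp_apply_of_eq' rfl hsd (h.mdifferentiableAt hx) ξ
    have h3 : (fun y => π (ν y)) = fun y => s (π y) := funext hπν
    rw [h3] at h1
    have h4 := h2.symm.trans h1
    rw [hνξ] at h4
    have h5 : (mfderiv 𝓘(ℝ, F) 𝓘(ℝ, F') π x ξ : F') = η := hξ
    rw [h5] at h4
    rw [h4]
    refine (map_neg (mfderiv 𝓘(ℝ, F) 𝓘(ℝ, F') π x) ξ).trans ?_
    rw [hξ]
  · have hNA : π '' (X₀ ∩ π ⁻¹' N) = N := by
      refine Subset.antisymm (by rintro _ ⟨z, hz, rfl⟩; exact hz.2) fun z hz => ?_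
      obtain ⟨w, hw, rfl⟩ := hsurj z hz
      exact ⟨w, ⟨hw, hz⟩, rfl⟩
    calc s '' N = s '' (π '' (X₀ ∩ π ⁻¹' N)) := by rw [hNA]
      _ = π '' (ν '' (X₀ ∩ π ⁻¹' N)) := by
        rw [image_image, image_image]
        exact image_congr fun z _ => (hπν z).symm
      _ = N := by rw [hνA, hNA]

end IsRiemannianSubmersionOn

end Submersion

/-! ## Gram operators -/

section Gram

variable {V E : Type*} [NormedAddCommGroup V] [InnerProductSpace ℝ V] [CompleteSpace V]
  [NormedAddCommGroup E] [InnerProductSpace ℝ E] [FiniteDimensional ℝ E] [CompleteSpace E]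

variable (V E) in
/-- The adjoint, as a continuous real linear map. -/
def adjointL : (V →L[ℝ] E) →L[ℝ] (E →L[ℝ] V) where
  toFun D := ContinuousLinearMap.adjoint D
  map_add' D D' := map_add _ D D'
  map_smul' c D := by simp
  cont := (ContinuousLinearMap.adjoint (𝕜 := ℝ) (E := V) (F := E)).continuous

theorem inner_adjointL (D : V →L[ℝ] E) (v : V) (c : E) :
    @inner ℝ V _ v (adjointL V E D c) = @inner ℝ E _ (D v) c :=
  ContinuousLinearMap.adjoint_inner_right D v c

/-- The Gram operator `D D†`. -/
def gramOperator (D : V →L[ℝ] E) : E →L[ℝ] E := D.comp (adjointL V E D)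

/-- Since `⟨D D† c, c⟩ = ‖D† c‖²` and `D†` is injective for surjective `D`, the operator is
injective on a finite dimensional space. -/
theorem isUnit_gramOperator {D : V →L[ℝ] E} (hD : Function.Surjective D) :
    IsUnit (gramOperator D) := by
  have hinj : Function.Injective (gramOperator D) := by
    rw [injective_iff_map_eq_zero]
    intro c hc
    have h1 : adjointL V E D c = 0 := by
      rw [← inner_self_eq_zero (𝕜 := ℝ), inner_adjointL]
      change @inner ℝ E _ (gramOperator D c) c = 0
      rw [hc, inner_zero_left]
    obtain ⟨v, rfl⟩ := hD c
    rw [← inner_self_eq_zero (𝕜 := ℝ), ← inner_adjointL, h1, inner_zero_right]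
  have hsurj : Function.Surjective (gramOperator D) :=
    LinearMap.surjective_of_injective (f := (gramOperator D).toLinearMap) hinj
  exact ContinuousLinearMap.isUnit_iff_bijective.2 ⟨hinj, hsurj⟩

/-- The coefficient `c` of a vector `D† c` in the range of `D†`. -/
def gramCoeff (D : V →L[ℝ] E) : V →L[ℝ] E := (Ring.inverse (gramOperator D)).comp D

theorem gramCoeff_adjointL {D : V →L[ℝ] E} (hD : Function.Surjective D) (c : E) :
    gramCoeff D (adjointL V E D c) = c := by
  have := Ring.inverse_mul_cancel _ (isUnit_gramOperator hD)
  exact congrArg (fun T : E →L[ℝ] E => T c) this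

theorem apply_adjointL_gramCoeff {D : V →L[ℝ] E} (hD : Function.Surjective D) (v : V) :
    D (adjointL V E D (gramCoeff D v)) = D v := by
  have := Ring.mul_inverse_cancel _ (isUnit_gramOperator hD)
  exact congrArg (fun T : E →L[ℝ] E => T (D v)) this

/-- The difference of the two sides lies in `ker D`, and both sides are orthogonal to `ker D`. This
identifies the orthogonal complement of the kernel with the range of `D†`, with a formula depending
smoothly on `D`. -/
theorem eq_adjointL_gramCoeff {D : V →L[ℝ] E} (hD : Function.Surjective D) {ξ : V}
    (hξ : ∀ v, D v = 0 → @inner ℝ V _ v ξ = 0) : adjointL V E D (gramCoeff D ξ) = ξ := by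
  have h0 : D (ξ - adjointL V E D (gramCoeff D ξ)) = 0 := by
    rw [map_sub, apply_adjointL_gramCoeff hD, sub_self]
  have h1 : ξ - adjointL V E D (gramCoeff D ξ) = 0 := by
    rw [← inner_self_eq_zero (𝕜 := ℝ), inner_sub_right, hξ _ h0, inner_adjointL, h0,
      inner_zero_left, sub_zero]
  exact (sub_eq_zero.1 h1).symm

theorem contDiffAt_gramCoeff {D : V →L[ℝ] E} (hD : Function.Surjective D) :
    ContDiffAt ℝ 1 (gramCoeff (V := V) (E := E)) D := by
  obtain ⟨S, hS⟩ := isUnit_gramOperator hD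
  have h1 : ContDiffAt ℝ 1 (Ring.inverse : (E →L[ℝ] E) → (E →L[ℝ] E)) (gramOperator D) := by
    rw [← hS]; exact contDiffAt_ringInverse ℝ S
  have h2 : ContDiffAt ℝ 1 (gramOperator (V := V) (E := E)) D :=
    (contDiff_id.clm_comp (adjointL V E).contDiff).contDiffAt
  exact (h1.comp D h2).clm_comp contDiffAt_id

end Gram

/-! ## Compactness and Fredholm operators -/

/-- Finite rank may be tested after an injection `j`, which is convenient for operators with values
in a submodule of `V × V`. -/
theorem LinearMap.hasNoetherianRange_of_forall_mem {A B C : Type*} [AddCommGroup A] [Module ℝ A]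
    [AddCommGroup B] [Module ℝ B] [AddCommGroup C] [Module ℝ C] (f : A →ₗ[ℝ] B) (j : B →ₗ[ℝ] C)
    (hj : Function.Injective j) (U : Submodule ℝ C) [FiniteDimensional ℝ U]
    (h : ∀ a, j (f a) ∈ U) : f.HasNoetherianRange := by
  rw [LinearMap.hasNoetherianRange_iff_range]
  let g : f.range →ₗ[ℝ] U := LinearMap.codRestrict U (j.comp f.range.subtype) (by
    rintro ⟨_, a, rfl⟩; exact h a)
  have hg : Function.Injective g := by
    intro x y hxy
    exact Subtype.ext (hj (congrArg Subtype.val hxy))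
  exact isNoetherian_of_injective g hg

/-- The derivative of a map into a compact set is a compact operator: on the unit ball `H` is
uniformly close to the difference quotients `t⁻¹ (n (x + t v) - n x)` for one fixed `t`, and a
finite net of `K` yields a net for these. -/
theorem HasFDerivAt.exists_finite_cover {V W : Type*} [NormedAddCommGroup V] [NormedSpace ℝ V]
    [NormedAddCommGroup W] [NormedSpace ℝ W] {n : V → W} {H : V →L[ℝ] W} {x : V}
    (hn : HasFDerivAt n H x) {K : Set W} (hK : IsCompact K) (hnK : ∀ᶠ u in 𝓝 x, n u ∈ K) {ε : ℝ}
    (hε : 0 < ε) : ∃ s : Set W, s.Finite ∧ ∀ v, ‖v‖ ≤ 1 → ∃ w ∈ s, ‖H v - w‖ ≤ ε := by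
  rw [hasFDerivAt_iff_isLittleO_nhds_zero, Asymptotics.isLittleO_iff] at hn
  have h1 := hn (half_pos hε)
  have h2 : ∀ᶠ h in 𝓝 (0 : V), n (x + h) ∈ K := by
    have : Filter.Tendsto (fun h : V => x + h) (𝓝 0) (𝓝 x) := by
      simpa using (continuous_const.add continuous_id).tendsto (0 : V) (f := fun h : V => x + h)
    exact this.eventually hnK
  obtain ⟨δ, hδ, hδ'⟩ := Metric.eventually_nhds_iff_ball.1 (h1.and h2)
  set t : ℝ := δ / 2 with ht
  have ht0 : 0 < t := by positivity
  -- The mesh `t * (ε / 2)` becomes `ε / 2` after division by `t`; the other `ε / 2` is the error of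
  -- the difference quotient.
  obtain ⟨s, -, hsf, hs⟩ := hK.totallyBounded.exists_subset (Metric.dist_mem_uniformity
    (show 0 < t * (ε / 2) by positivity))
  refine ⟨(fun k => t⁻¹ • (k - n x)) '' s, hsf.image _, fun v hv => ?_⟩
  have htv : t • v ∈ Metric.ball (0 : V) δ := by
    rw [mem_ball_zero_iff, norm_smul, Real.norm_of_nonneg ht0.le]
    nlinarith
  obtain ⟨h3, h4⟩ := hδ' _ htv
  obtain ⟨k, hk, hkd⟩ := mem_iUnion₂.1 (hs h4)
  refine ⟨_, ⟨k, hk, rfl⟩, ?_⟩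
  have e : H v - t⁻¹ • (k - n x) =
      t⁻¹ • ((n (x + t • v) - k) - (n (x + t • v) - n x - H (t • v))) := by
    rw [map_smul]
    have : H v = t⁻¹ • (t • H v) := by rw [smul_smul, inv_mul_cancel₀ ht0.ne', one_smul]
    nth_rewrite 1 [this]
    rw [← smul_sub]
    congr 1
    abel
  have hkd' : ‖n (x + t • v) - k‖ < t * (ε / 2) := by
    rw [← dist_eq_norm]; exact hkd
  rw [e, norm_smul, norm_inv, Real.norm_of_nonneg ht0.le, inv_mul_le_iff₀ ht0]
  refine (norm_sub_le _ _).trans ?_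
  have h5 : ‖t • v‖ ≤ t := by
    rw [norm_smul, Real.norm_of_nonneg ht0.le]; nlinarith
  nlinarith

/-- An operator whose values on the unit ball can be approximated by a finite set is a small
perturbation of a finite rank operator. -/
theorem ContinuousLinearMap.exists_isUnit_add {V : Type*} [NormedAddCommGroup V]
    [InnerProductSpace ℝ V] [CompleteSpace V] {H : V →L[ℝ] V} {s : Set V} (hs : s.Finite)
    (hH : ∀ v, ‖v‖ ≤ 1 → ∃ w ∈ s, ‖H v - w‖ ≤ 1 / 2) :
    ∃ (R : V →L[ℝ] V) (W : Submodule ℝ V), IsUnit R ∧ FiniteDimensional ℝ W ∧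
      ∀ v, v + H v - R v ∈ W := by
  let W : Submodule ℝ V := Submodule.span ℝ s
  have hW : FiniteDimensional ℝ W := FiniteDimensional.span_of_finite ℝ hs
  let P : V →L[ℝ] V := W.starProjection
  have hP : ∀ v, P v ∈ W := fun v => Submodule.starProjection_apply_mem W v
  have hPW : ∀ w ∈ W, P w = w := fun w hw => Submodule.starProjection_eq_self_iff.2 hw
  have hle : ∀ v, ‖v - P v‖ ≤ ‖v‖ := fun v => by
    have := Wᗮ.norm_starProjection_apply_le v
    rwa [Submodule.starProjection_orthogonal_val] at this
  -- The projection `P` fixes the net, so `G v = (1 - P)(H v - w)` has norm at most one half on the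
  -- unit ball. Hence `1 + G` is invertible by the Neumann series, and it differs from `1 + H` by `P
  -- H`, whose range is in `W`.
  let G : V →L[ℝ] V := H - P.comp H
  have hG1 : ∀ v, ‖v‖ ≤ 1 → ‖G v‖ ≤ 1 / 2 := by
    intro v hv
    obtain ⟨w, hw, hvw⟩ := hH v hv
    have : G v = (H v - w) - P (H v - w) := by
      rw [map_sub, hPW w (Submodule.subset_span hw)]
      change H v - P (H v) = _
      abel
    rw [this]
    exact (hle _).trans hvw
  have hG : ‖G‖ ≤ 1 / 2 := by
    refine ContinuousLinearMap.opNorm_le_of_unit_norm (by norm_num) fun v hv => hG1 v hv.le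
  refine ⟨1 + G, W, ?_, hW, fun v => ?_⟩
  · have := isUnit_one_sub_of_norm_lt_one (x := -G) (by rw [norm_neg]; linarith)
    rwa [sub_neg_eq_add] at this
  · have : v + H v - (1 + G) v = P (H v) := by
      change v + H v - (v + (H v - P (H v))) = _
      abel
    rw [this]
    exact hP _

open scoped LinearMap.FiniteRangeSetoid in
-- On `T` the sum map is `(v, H v + D† d) ↦ v + H v + D† d`, which is `R v` up to the finite
-- dimensional spaces `W` and `range D†`. With `P` the projection onto `ker D`, the map `y ↦ (P R⁻¹
-- y, H P R⁻¹ y)` is an inverse up to finite rank on both sides.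
theorem isFredholm_add_of_mem_iff {V E : Type*} [NormedAddCommGroup V] [InnerProductSpace ℝ V]
    [CompleteSpace V] [NormedAddCommGroup E] [InnerProductSpace ℝ E] [FiniteDimensional ℝ E]
    [CompleteSpace E] {D : V →L[ℝ] E} (hD : Function.Surjective D) {H R : V →L[ℝ] V} (hR : IsUnit R)
    {W : Submodule ℝ V} [FiniteDimensional ℝ W] (hW : ∀ v, v + H v - R v ∈ W)
    (T : Submodule ℝ (V × V))
    (hT : ∀ q : V × V, q ∈ T ↔ D q.1 = 0 ∧ ∃ d, q.2 = H q.1 + adjointL V E D d) :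
    ((ContinuousLinearMap.fst ℝ V V + ContinuousLinearMap.snd ℝ V V).comp
      (Submodule.subtypeL T)).IsFredholm := by
  obtain ⟨R, rfl⟩ := hR
  let N : E →L[ℝ] V := adjointL V E D
  let Rn : Submodule ℝ V := N.toLinearMap.range
  let P : V →L[ℝ] V := ContinuousLinearMap.id ℝ V - N.comp (gramCoeff D)
  have hP : ∀ v, D (P v) = 0 := fun v => by
    change D (v - N (gramCoeff D v)) = 0
    rw [map_sub, apply_adjointL_gramCoeff hD, sub_self]
  have hPR : ∀ v, v - P v ∈ Rn := fun v => by
    change v - (v - N (gramCoeff D v)) ∈ Rn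
    rw [sub_sub_cancel]
    exact ⟨_, rfl⟩
  have hPid : ∀ v, D v = 0 → P v = v := fun v hv => by
    change v - N (Ring.inverse (gramOperator D) (D v)) = v
    rw [hv, map_zero, map_zero, sub_zero]
  let Ri : V →L[ℝ] V := ↑(R⁻¹)
  have hRi : ∀ v, (R : V →L[ℝ] V) (Ri v) = v := fun v =>
    congrArg (fun T : V →L[ℝ] V => T v) R.mul_inv
  have hiR : ∀ v, Ri ((R : V →L[ℝ] V) v) = v := fun v =>
    congrArg (fun T : V →L[ℝ] V => T v) R.inv_mul
  let Q : V →L[ℝ] T := ContinuousLinearMap.codRestrict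
    (((ContinuousLinearMap.id ℝ V).prod H).comp (P.comp Ri)) T (fun y =>
      (hT _).2 ⟨hP _, 0, by simp⟩)
  have hQ : ∀ y, ((Q y : T) : V × V) = (P (Ri y), H (P (Ri y))) := fun y => rfl
  set u := (ContinuousLinearMap.fst ℝ V V + ContinuousLinearMap.snd ℝ V V).comp
      (Submodule.subtypeL T) with hu
  have hu' : ∀ q : T, u q = (q : V × V).1 + (q : V × V).2 := fun q => rfl
  refine ContinuousLinearMap.IsFredholm.of_isQuasiInverse (v := Q) ⟨?_, ?_⟩
  · rw [LinearMap.IsLeftQuasiInverse, LinearMap.FiniteRangeSetoid.equiv_iff_hasNoetherianRange]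
    -- Subtracting `R ∘ fst` leaves a finite rank operator `U`, and `Q ∘ R ∘ fst` differs from the
    -- identity of `T` only in the normal component.
    let U : T →ₗ[ℝ] V := u.toLinearMap -
      ((R : V →L[ℝ] V).comp ((ContinuousLinearMap.fst ℝ V V).comp T.subtypeL)).toLinearMap
    have hU : U.HasNoetherianRange := by
      refine U.hasNoetherianRange_of_forall_mem LinearMap.id Function.injective_id (W ⊔ Rn) ?_
      intro q
      obtain ⟨h1, d, h2⟩ := (hT q).1 q.2
      have : U q = ((q : V × V).1 + H (q : V × V).1 - (R : V →L[ℝ] V) (q : V × V).1) + N d := by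
        change (q : V × V).1 + (q : V × V).2 - (R : V →L[ℝ] V) (q : V × V).1 = _
        rw [h2]
        abel
      rw [LinearMap.id_apply, this]
      exact Submodule.add_mem_sup (hW _) ⟨d, rfl⟩
    have h2 : (Q.toLinearMap ∘ₗ (R : V →L[ℝ] V).toLinearMap ∘ₗ
        ((ContinuousLinearMap.fst ℝ V V).comp T.subtypeL).toLinearMap - LinearMap.id :
          T →ₗ[ℝ] T).HasNoetherianRange := by
      refine LinearMap.hasNoetherianRange_of_forall_mem _ T.subtype T.injective_subtype
        (Submodule.map (LinearMap.inr ℝ V V) Rn) ?_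
      intro q
      obtain ⟨h1, d, h2⟩ := (hT q).1 q.2
      refine ⟨-(N d), ⟨-d, by simp [N]⟩, ?_⟩
      change (0, -(N d)) = (P (Ri ((R : V →L[ℝ] V) (q : V × V).1)),
        H (P (Ri ((R : V →L[ℝ] V) (q : V × V).1)))) - (q : V × V)
      rw [hiR, hPid _ h1]
      ext
      · simp
      · simp [h2, N]
    have h3 := (hU.comp_left Q.toLinearMap).add h2
    have h4 : (Q.toLinearMap ∘ₗ u.toLinearMap - LinearMap.id : T →ₗ[ℝ] T) =
        Q.toLinearMap ∘ₗ U + (Q.toLinearMap ∘ₗ (R : V →L[ℝ] V).toLinearMap ∘ₗ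
        ((ContinuousLinearMap.fst ℝ V V).comp T.subtypeL).toLinearMap - LinearMap.id) := by
      refine LinearMap.ext fun q => ?_
      change Q (u q) - q = Q (u q - (R : V →L[ℝ] V) (q : V × V).1) +
        (Q ((R : V →L[ℝ] V) (q : V × V).1) - q)
      rw [map_sub]
      abel
    rw [← h4] at h3
    exact h3
  · rw [LinearMap.IsRightQuasiInverse, LinearMap.FiniteRangeSetoid.equiv_iff_hasNoetherianRange]
    refine LinearMap.hasNoetherianRange_of_forall_mem
      (u.toLinearMap ∘ₗ Q.toLinearMap - LinearMap.id : V →ₗ[ℝ] V) LinearMap.id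
      Function.injective_id (W ⊔ (Rn ⊔ Submodule.map H.toLinearMap Rn)) ?_
    intro y
    -- The error splits into the defect of `R` against `1 + H`, which is in `W`, and the effect of
    -- `P - 1` before and after `H`, which comes from `range D†`.
    have : (u.toLinearMap ∘ₗ Q.toLinearMap - LinearMap.id : V →ₗ[ℝ] V) y =
        (Ri y + H (Ri y) - (R : V →L[ℝ] V) (Ri y)) +
          (-(Ri y - P (Ri y)) + H (-(Ri y - P (Ri y)))) := by
      change P (Ri y) + H (P (Ri y)) - y = _
      rw [hRi, map_neg, map_sub]
      abel
    rw [LinearMap.id_apply, this]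
    refine Submodule.add_mem_sup (hW _) (Submodule.add_mem_sup (Rn.neg_mem (hPR _)) ?_)
    exact Submodule.mem_map_of_mem (f := H.toLinearMap) (Rn.neg_mem (hPR _))

theorem one_add_one_le_infty : (1 : WithTop ℕ∞) + 1 ≤ ∞ := by
  have : ((1 + 1 : ℕ∞) : WithTop ℕ∞) ≤ ((⊤ : ℕ∞) : WithTop ℕ∞) := WithTop.coe_le_coe.2 le_top
  simpa using! this

/-! ## A criterion for proper Fredholm submanifolds -/

section PFCriterion

variable {V : Type*} [NormedAddCommGroup V] [InnerProductSpace ℝ V] [CompleteSpace V]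
  {E : Type*} [NormedAddCommGroup E] [InnerProductSpace ℝ E] [FiniteDimensional ℝ E]

theorem mem_tangentSub_iff_fderiv {A : Set V} {x : V} (hx : x ∈ A) {U : Set V} (hU : U ∈ 𝓝 x)
    {f : V → E} (hf : ContDiffAt ℝ 1 f x) (hA : ∀ y ∈ U, y ∈ A ↔ f y = 0)
    (hsurj : Function.Surjective (fderiv ℝ f x)) (v : V) :
    v ∈ (tangentSub V A x : Submodule ℝ V) ↔ fderiv ℝ f x v = 0 := by
  have := mem_tangentSub_iff hx hU hf.contMDiffAt hA (by rw [mfderiv_eq_fderiv]; exact hsurj) v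
  rwa [mfderiv_eq_fderiv] at this

theorem mem_normalBundle_iff [CompleteSpace E] {A : Set V} {U : Set V} (hU : IsOpen U) {f : V → E}
    (hf : ContDiffOn ℝ ∞ f U) (hA : ∀ y ∈ U, y ∈ A ↔ f y = 0)
    (hsurj : ∀ y ∈ U, Function.Surjective (fderiv ℝ f y)) {y : V} (hy : y ∈ U) (hyA : y ∈ A) (ξ : V) :
    (y, ξ) ∈ normalBundle A ↔ ∃ c, ξ = adjointL V E (fderiv ℝ f y) c := by
  have ht := mem_tangentSub_iff_fderiv hyA (hU.mem_nhds hy)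
    ((hf.contDiffAt (hU.mem_nhds hy)).of_le (by simp)) hA (hsurj y hy)
  constructor
  · rintro ⟨-, h⟩
    exact ⟨_, (eq_adjointL_gramCoeff (hsurj y hy) fun v hv => h v ((ht v).2 hv)).symm⟩
  · rintro ⟨c, rfl⟩
    refine ⟨hyA, fun v hv => ?_⟩
    refine (inner_adjointL (fderiv ℝ f y) v c).trans ?_
    rw [(ht v).1 hv, inner_zero_left]

/-- Over `A`, normality of `ξ` is the equation `ξ = D† (gramCoeff D ξ)` with `D = df`, whose right
side is jointly continuous in the point and `ξ`; so it survives limits. -/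
theorem isClosed_normalBundle {A : Set V} (hA : IsClosedSubmanifold V A) :
    IsClosed (normalBundle A) := by
  obtain ⟨hcl, k, hloc⟩ := hA
  rw [← isSeqClosed_iff_isClosed]
  rintro q ⟨x, ξ⟩ hq hlim
  have hx : x ∈ A := hcl.mem_of_tendsto ((continuous_fst.tendsto _).comp hlim)
    (Filter.Eventually.of_forall fun n => (hq n).1)
  obtain ⟨U, hU, hxU, f, hf, hfA, hfs⟩ := hloc x hx
  have hf' : ContDiffOn ℝ ∞ f U := contMDiffOn_iff_contDiffOn.1 hf
  have hfs' : ∀ y ∈ U, Function.Surjective (fderiv ℝ f y) := fun y hy => by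
    have := hfs y hy
    rwa [mfderiv_eq_fderiv] at this
  rw [mem_normalBundle_iff hU hf' hfA hfs' hxU hx]
  refine ⟨gramCoeff (fderiv ℝ f x) ξ, ?_⟩
  have hD : ContinuousAt (fderiv ℝ f) x :=
    (hf'.continuousOn_fderiv_of_isOpen hU (by simp)).continuousAt (hU.mem_nhds hxU)
  have hg : ContinuousAt (fun r : V × V => adjointL V _ (fderiv ℝ f r.1)
      (gramCoeff (fderiv ℝ f r.1) r.2)) (x, ξ) := by
    have h1 : ContinuousAt (fun r : V × V => fderiv ℝ f r.1) (x, ξ) :=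
      ContinuousAt.comp (f := Prod.fst) (g := fderiv ℝ f) hD continuousAt_fst
    have h2 : ContinuousAt (fun r : V × V => gramCoeff (fderiv ℝ f r.1)) (x, ξ) :=
      ContinuousAt.comp (f := fun r : V × V => fderiv ℝ f r.1) (g := gramCoeff)
        (contDiffAt_gramCoeff (hfs' x hxU)).continuousAt h1
    exact (((adjointL V _).continuous.continuousAt).comp h1).clm_apply (h2.clm_apply continuousAt_snd)
  have h1 := hg.tendsto.comp hlim
  have h2 : Filter.Tendsto (fun n => (q n).2) Filter.atTop (𝓝 ξ) := (continuous_snd.tendsto _).comp hlim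
  refine tendsto_nhds_unique (h2.congr' ?_) h1
  filter_upwards [((continuous_fst.tendsto _).comp hlim).eventually (hU.mem_nhds hxU)] with n hn'
  have hn : (q n).1 ∈ U := hn'
  obtain ⟨c, hc⟩ := (mem_normalBundle_iff hU hf' hfA hfs' hn (hq n).1 _).1 (hq n)
  change _ = adjointL V _ (fderiv ℝ f (q n).1) (gramCoeff (fderiv ℝ f (q n).1) (q n).2)
  rw [hc, gramCoeff_adjointL (hfs' _ hn)]

/-- A curve in the normal bundle has second component `df_y† C` with `C` differentiable, because `C`
is a Gram coefficient. The product rule splits its velocity into `H y'`, with the coefficient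
frozen, and a normal part `df_x† C'`. -/
theorem hasDerivAt_curve_normalBundle [CompleteSpace E] {A : Set V} {U : Set V} (hU : IsOpen U)
    {f : V → E} (hf : ContDiffOn ℝ ∞ f U) (hA : ∀ y ∈ U, y ∈ A ↔ f y = 0)
    (hsurj : ∀ y ∈ U, Function.Surjective (fderiv ℝ f y)) {x : V} (hx : x ∈ U) (c : E)
    {H : V →L[ℝ] V} (hH : HasFDerivAt (fun u => adjointL V E (fderiv ℝ f u) c) H x)
    {γ : ℝ → V × V} (hγ0 : γ 0 = (x, adjointL V E (fderiv ℝ f x) c)) (hγA : ∀ t, γ t ∈ normalBundle A)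
    {w : V × V} (hγd : HasDerivAt γ w 0) :
    fderiv ℝ f x w.1 = 0 ∧ ∃ d, w.2 = H w.1 + adjointL V E (fderiv ℝ f x) d := by
  have hDd : DifferentiableAt ℝ (fderiv ℝ f) x :=
    ((hf.fderiv_of_isOpen hU (m := 1) one_add_one_le_infty).contDiffAt (hU.mem_nhds hx)).differentiableAt (by simp)
  have hNd : DifferentiableAt ℝ (fun u => adjointL V E (fderiv ℝ f u)) x :=
    (adjointL V E).differentiableAt.comp x hDd
  obtain ⟨N', hN'⟩ := hNd
  have hHN : ∀ v, H v = N' v c := by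
    have h1 := hN'.clm_apply (hasFDerivAt_const c x)
    intro v
    rw [hH.unique h1]
    simp
  have hmem := @mem_normalBundle_iff V _ _ _ E _ _ _ _ A U hU f hf hA hsurj
  have hfd : HasFDerivAt f (fderiv ℝ f x) x :=
    ((hf.contDiffAt (hU.mem_nhds hx)).differentiableAt (by simp)).hasFDerivAt
  have h1 : HasDerivAt (fun t => (γ t).1) w.1 0 := hγd.fst
  have h2 : HasDerivAt (fun t => (γ t).2) w.2 0 := hγd.snd
  have e1 : (γ 0).1 = x := by rw [hγ0]
  have e2 : (γ 0).2 = adjointL V E (fderiv ℝ f x) c := by rw [hγ0]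
  have hUev : ∀ᶠ t in 𝓝 (0 : ℝ), (γ t).1 ∈ U := by
    refine h1.continuousAt.eventually ?_
    dsimp only
    rw [e1]; exact hU.mem_nhds hx
  have hfd' : HasFDerivAt f (fderiv ℝ f x) (γ 0).1 := by rw [e1]; exact hfd
  have h3 : HasDerivAt (fun t => f (γ t).1) (fderiv ℝ f x w.1) 0 :=
    hfd'.comp_hasDerivAt (f := fun t => (γ t).1) 0 h1
  have h4 : HasDerivAt (fun t => f (γ t).1) 0 0 := by
    refine (hasDerivAt_const (0 : ℝ) (0 : E)).congr_of_eventuallyEq ?_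
    filter_upwards [hUev] with t ht
    exact (hA _ ht).1 (hγA t).1
  refine ⟨h3.unique h4, ?_⟩
  have hD' : HasDerivAt (fun t => fderiv ℝ f (γ t).1) (fderiv ℝ (fderiv ℝ f) x w.1) 0 := by
    have : HasFDerivAt (fderiv ℝ f) (fderiv ℝ (fderiv ℝ f) x) (γ 0).1 := by
      rw [e1]; exact hDd.hasFDerivAt
    exact HasFDerivAt.comp_hasDerivAt (l := fderiv ℝ f) (f := fun t => (γ t).1) 0 this h1
  obtain ⟨G', hG⟩ : DifferentiableAt ℝ (gramCoeff (V := V) (E := E)) (fderiv ℝ f (γ 0).1) := by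
    rw [e1]; exact (contDiffAt_gramCoeff (hsurj x hx)).differentiableAt (by simp)
  have hC' : HasDerivAt (fun t => gramCoeff (fderiv ℝ f (γ t).1)) _ 0 :=
    HasFDerivAt.comp_hasDerivAt (l := gramCoeff (V := V) (E := E)) (f := fun t => fderiv ℝ f (γ t).1)
      0 hG hD'
  have hC := hC'.clm_apply h2
  have hNγ : HasDerivAt (fun t => adjointL V E (fderiv ℝ f (γ t).1)) (N' w.1) 0 := by
    have : HasFDerivAt (fun u => adjointL V E (fderiv ℝ f u)) N' (γ 0).1 := by rw [e1]; exact hN'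
    exact HasFDerivAt.comp_hasDerivAt (l := fun u => adjointL V E (fderiv ℝ f u))
      (f := fun t => (γ t).1) 0 this h1
  have hprod := hNγ.clm_apply hC
  have heq : (fun t => (γ t).2) =ᶠ[𝓝 0] fun t => adjointL V E (fderiv ℝ f (γ t).1)
      (gramCoeff (fderiv ℝ f (γ t).1) (γ t).2) := by
    filter_upwards [hUev] with t ht
    obtain ⟨c', hc'⟩ := (hmem ht (hγA t).1 _).1 (hγA t)
    rw [hc', gramCoeff_adjointL (hsurj _ ht)]
  have hu := h2.unique (hprod.congr_of_eventuallyEq heq)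
  refine ⟨G' (fderiv ℝ (fderiv ℝ f) x w.1) (γ 0).2 + gramCoeff (fderiv ℝ f (γ 0).1) w.2,
    hu.trans ?_⟩
  rw [hHN, e1, e2, gramCoeff_adjointL (hsurj x hx)]

/-- The velocities of curves satisfy the linear conditions on the right, which define a subspace.
Conversely, over a curve `y` in `A` with velocity `q.1` the curve `t ↦ (y t, df_{y t}† (c + t d))`
has velocity `q`. -/
theorem mem_tangentSub_normalBundle_iff [CompleteSpace E] {A : Set V} {U : Set V} (hU : IsOpen U)
    {f : V → E} (hf : ContDiffOn ℝ ∞ f U) (hA : ∀ y ∈ U, y ∈ A ↔ f y = 0)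
    (hsurj : ∀ y ∈ U, Function.Surjective (fderiv ℝ f y)) {x : V} (hx : x ∈ U) (hxA : x ∈ A) (c : E)
    {H : V →L[ℝ] V} (hH : HasFDerivAt (fun u => adjointL V E (fderiv ℝ f u) c) H x) (q : V × V) :
    q ∈ (tangentSub (V × V) (normalBundle A) (x, adjointL V E (fderiv ℝ f x) c) :
      Submodule ℝ (V × V)) ↔
      fderiv ℝ f x q.1 = 0 ∧ ∃ d, q.2 = H q.1 + adjointL V E (fderiv ℝ f x) d := by
  have hDd : DifferentiableAt ℝ (fderiv ℝ f) x :=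
    ((hf.fderiv_of_isOpen hU (m := 1) one_add_one_le_infty).contDiffAt (hU.mem_nhds hx)).differentiableAt (by simp)
  have hNd : DifferentiableAt ℝ (fun u => adjointL V E (fderiv ℝ f u)) x :=
    (adjointL V E).differentiableAt.comp x hDd
  obtain ⟨N', hN'⟩ := hNd
  have hHN : ∀ v, H v = N' v c := by
    have h1 := hN'.clm_apply (hasFDerivAt_const c x)
    intro v
    rw [hH.unique h1]
    simp
  have hmem := @mem_normalBundle_iff V _ _ _ E _ _ _ _ A U hU f hf hA hsurj
  have hfd : HasFDerivAt f (fderiv ℝ f x) x :=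
    ((hf.contDiffAt (hU.mem_nhds hx)).differentiableAt (by simp)).hasFDerivAt
  have hxN : (x, adjointL V E (fderiv ℝ f x) c) ∈ normalBundle A := (hmem hx hxA _).2 ⟨c, rfl⟩
  constructor
  · intro hq
    let T : Submodule ℝ (V × V) :=
      { carrier := {q | fderiv ℝ f x q.1 = 0 ∧ ∃ d, q.2 = H q.1 + adjointL V E (fderiv ℝ f x) d}
        add_mem' := by
          rintro a b ⟨ha, d, hd⟩ ⟨hb, d', hd'⟩
          refine ⟨by simp [ha, hb], d + d', ?_⟩
          simp only [Prod.fst_add, Prod.snd_add, map_add, hd, hd']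
          abel
        zero_mem' := ⟨by simp, 0, by simp⟩
        smul_mem' := by
          rintro r a ⟨ha, d, hd⟩
          refine ⟨by simp [ha], r • d, ?_⟩
          simp [hd] }
    suffices h : (tangentSub (V × V) (normalBundle A) (x, adjointL V E (fderiv ℝ f x) c) :
      Submodule ℝ (V × V)) ≤ T from h hq
    refine Submodule.span_le.2 ?_
    rintro v ⟨γ, hγ0, hγA, hγ⟩
    exact hasDerivAt_curve_normalBundle hU hf hA hsurj hx c hH hγ0 hγA
      (hasDerivAt_iff_hasFDerivAt.2 (hasMFDerivAt_iff_hasFDerivAt.1 hγ))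
  · rintro ⟨hq1, d, hq2⟩
    obtain ⟨y, hy0, hyd, hyf⟩ := ((hf.contDiffAt (hU.mem_nhds hx)).hasStrictFDerivAt
      (by simp)).exists_curve_of_mem_ker (hsurj x hx) hq1
    have hfx : f x = 0 := (hA x hx).1 hxA
    have hyU : ∀ᶠ t in 𝓝 (0 : ℝ), y t ∈ U := by
      refine hyd.continuousAt.eventually ?_
      rw [hy0]; exact hU.mem_nhds hx
    let γ : ℝ → V × V := fun t => (y t, adjointL V E (fderiv ℝ f (y t)) (c + t • d))
    have hγev : ∀ᶠ t in 𝓝 (0 : ℝ), γ t ∈ normalBundle A := by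
      filter_upwards [hyU, hyf] with t ht1 ht2
      exact (hmem ht1 ((hA _ ht1).2 (ht2.trans hfx)) _).2 ⟨_, rfl⟩
    have hγ0 : γ 0 = (x, adjointL V E (fderiv ℝ f x) c) := by simp [γ, hy0]
    have hγd : HasDerivAt γ q 0 := by
      have hNy : HasDerivAt (fun t => adjointL V E (fderiv ℝ f (y t))) (N' q.1) 0 := by
        have : HasFDerivAt (fun u => adjointL V E (fderiv ℝ f u)) N' (y 0) := by rw [hy0]; exact hN'
        exact this.comp_hasDerivAt 0 hyd
      have hcd : HasDerivAt (fun t : ℝ => c + t • d) d 0 := by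
        simpa using ((hasDerivAt_id (0 : ℝ)).smul_const d).const_add c
      have := hyd.prodMk (hNy.clm_apply hcd)
      convert this using 1
      ext
      · rfl
      · simp [hq2, hHN, hy0]
    classical
    refine Submodule.subset_span ⟨fun t => if γ t ∈ normalBundle A then γ t else
      (x, adjointL V E (fderiv ℝ f x) c), ?_, ?_, ?_⟩
    · simp [hγ0]
    · intro t
      dsimp only
      split_ifs with h
      exacts [h, hxN]
    · refine HasFDerivAt.hasMFDerivAt
        (f' := ContinuousLinearMap.toSpanSingleton ℝ q) ?_
      refine HasFDerivAt.congr_of_eventuallyEq (f := γ) hγd.hasFDerivAt ?_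
      filter_upwards [hγev] with t ht
      simp [ht]

/-- A closed submanifold is proper Fredholm if its normal vectors belong to sets `Hor u` whose
bounded parts over bounded sets are relatively compact. -/
theorem isPFSubmanifold_of_horizontal {A : Set V} (hA : IsClosedSubmanifold V A) (Hor : V → Set V)
    (hHor : ∀ r : ℝ, ∃ K : Set V, IsCompact K ∧
      ∀ u ξ, ‖u‖ ≤ r → ‖ξ‖ ≤ r → ξ ∈ Hor u → ξ ∈ K)
    (hloc : ∃ k : ℕ, ∀ x ∈ A, ∃ U : Set V, IsOpen U ∧ x ∈ U ∧ ∃ f : V → EuclideanSpace ℝ (Fin k),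
      ContDiffOn ℝ ∞ f U ∧ (∀ y ∈ U, y ∈ A ↔ f y = 0) ∧
      (∀ y ∈ U, Function.Surjective (fderiv ℝ f y)) ∧
      ∀ y ∈ U, ∀ ξ, (∀ v, fderiv ℝ f y v = 0 → @inner ℝ V _ v ξ = 0) → ξ ∈ Hor y) :
    IsPFSubmanifold A := by
  obtain ⟨k, hloc⟩ := hloc
  have hinner : ∀ {D : V →L[ℝ] EuclideanSpace ℝ (Fin k)} (c) (v : V), D v = 0 →
      @inner ℝ V _ v (adjointL V _ D c) = 0 := fun c v hv => by
    rw [inner_adjointL, hv, inner_zero_left]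
  have hnor : ∀ q ∈ normalBundle A, q.2 ∈ Hor q.1 := by
    rintro ⟨x, ξ⟩ hq
    obtain ⟨U, hU, hxU, f, hf, hfA, hfs, hfh⟩ := hloc x hq.1
    obtain ⟨c, rfl⟩ := (mem_normalBundle_iff hU hf hfA hfs hxU hq.1 ξ).1 hq
    exact hfh x hxU _ (hinner c)
  refine ⟨hA, fun r hr => ?_, ?_⟩
  · rw [isProperMap_iff_ultrafilter]
    refine ⟨by fun_prop, fun 𝒰 z hz => ?_⟩
    -- End points near `z` and normal parts of norm at most `r` force the base points into this
    -- ball. So the normal parts have a limit in `K` along the ultrafilter, and the base points then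
    -- converge as well.
    obtain ⟨K, hK, hKm⟩ := hHor (‖z‖ + 1 + r)
    have hev : ∀ᶠ q in (𝒰 : Filter {q : V × V // q ∈ normalBundle A ∧ ‖q.2‖ ≤ r}), q.1.2 ∈ K := by
      have h1 : ∀ᶠ q in (𝒰 : Filter {q : V × V // q ∈ normalBundle A ∧ ‖q.2‖ ≤ r}),
          ‖q.1.1 + q.1.2‖ < ‖z‖ + 1 :=
        hz.norm.eventually_lt_const (by linarith)
      filter_upwards [h1] with q hq
      refine hKm q.1.1 q.1.2 ?_ ?_ (hnor _ q.2.1)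
      · calc ‖q.1.1‖ = ‖(q.1.1 + q.1.2) - q.1.2‖ := by rw [add_sub_cancel_right]
          _ ≤ ‖q.1.1 + q.1.2‖ + ‖q.1.2‖ := norm_sub_le _ _
          _ ≤ _ := by linarith [q.2.2]
      · have := norm_nonneg z
        linarith [q.2.2]
    obtain ⟨ξ, -, hξ⟩ := hK.ultrafilter_le_nhds
      (𝒰.map fun q : {q : V × V // q ∈ normalBundle A ∧ ‖q.2‖ ≤ r} => q.1.2)
      (by rw [Filter.le_principal_iff]; exact hev)
    have hξ' : Filter.Tendsto (fun q : {q : V × V // q ∈ normalBundle A ∧ ‖q.2‖ ≤ r} => q.1.2) 𝒰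
      (𝓝 ξ) := hξ
    have hx' : Filter.Tendsto (fun q : {q : V × V // q ∈ normalBundle A ∧ ‖q.2‖ ≤ r} => q.1.1) 𝒰
      (𝓝 (z - ξ)) := by
      simpa using hz.sub hξ'
    have hq : Filter.Tendsto (fun q : {q : V × V // q ∈ normalBundle A ∧ ‖q.2‖ ≤ r} => q.1) 𝒰
      (𝓝 (z - ξ, ξ)) := hx'.prodMk_nhds hξ'
    have hmem : (z - ξ, ξ) ∈ normalBundle A ∧ ‖ξ‖ ≤ r :=
      ⟨(isClosed_normalBundle hA).mem_of_tendsto hq (Filter.Eventually.of_forall fun q => q.2.1),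
        le_of_tendsto hξ'.norm (Filter.Eventually.of_forall fun q => q.2.2)⟩
    refine ⟨⟨(z - ξ, ξ), hmem⟩, by simp, ?_⟩
    rw [nhds_subtype_eq_comap]
    exact Filter.tendsto_iff_comap.1 hq
  · rintro ⟨x, ξ⟩ hq
    obtain ⟨U, hU, hxU, f, hf, hfA, hfs, hfh⟩ := hloc x hq.1
    obtain ⟨c, rfl⟩ := (mem_normalBundle_iff hU hf hfA hfs hxU hq.1 ξ).1 hq
    have hDd : DifferentiableAt ℝ (fderiv ℝ f) x :=
      ((hf.fderiv_of_isOpen hU (m := 1) one_add_one_le_infty).contDiffAt (hU.mem_nhds hxU)).differentiableAt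
        (by simp)
    have hnd : DifferentiableAt ℝ (fun u => adjointL V _ (fderiv ℝ f u) c) x :=
      ((adjointL V _).differentiableAt.comp x hDd).clm_apply (differentiableAt_const c)
    obtain ⟨H, hH⟩ := hnd
    set n := fun u => adjointL V _ (fderiv ℝ f u) c with hn
    -- Near `x` both `u` and `n u` stay within this radius, so the horizontal field `n` takes values
    -- in a compact set. Its derivative `H` is then compact, and `1 + H` is invertible modulo finite
    -- rank.
    obtain ⟨K, hK, hKm⟩ := hHor (‖x‖ + ‖n x‖ + 1)
    have hnK : ∀ᶠ u in 𝓝 x, n u ∈ K := by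
      have h1 : ∀ᶠ u in 𝓝 x, ‖u‖ < ‖x‖ + ‖n x‖ + 1 :=
        (continuous_norm.tendsto x).eventually_lt_const (by have := norm_nonneg (n x); linarith)
      have h2 : ∀ᶠ u in 𝓝 x, ‖n u‖ < ‖x‖ + ‖n x‖ + 1 :=
        hH.continuousAt.norm.tendsto.eventually_lt_const (by have := norm_nonneg x; linarith)
      filter_upwards [h1, h2, hU.mem_nhds hxU] with u hu1 hu2 huU
      exact hKm u _ hu1.le hu2.le (hfh u huU _ (hinner c))
    obtain ⟨s, hs, hsH⟩ := hH.exists_finite_cover hK hnK (ε := 1 / 2) (by norm_num)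
    obtain ⟨R, W, hR, hWf, hRW⟩ := ContinuousLinearMap.exists_isUnit_add hs hsH
    exact isFredholm_add_of_mem_iff (hfs x hxU) hR hRW _
      (mem_tangentSub_normalBundle_iff hU hf hfA hfs hxU hq.1 c hH)

end PFCriterion

/-! ## The product rule for functions of two absolutely continuous paths -/

/-- An increment along the diagonal is a step in the first variable followed by a step in the
second. Uniform continuity on the square moves the coefficients to the diagonal at a cost of `ε (‖u‖
+ ‖w‖)`. -/
theorem diagonal_eq_add_integral {H : Type*} [NormedAddCommGroup H] [NormedSpace ℝ H]
    {φ : ℝ → ℝ → ℝ} {M₁ M₂ : ℝ × ℝ → H →L[ℝ] ℝ} (hM₁ : ContinuousOn M₁ (Icc 0 1 ×ˢ Icc 0 1))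
    (hM₂ : ContinuousOn M₂ (Icc 0 1 ×ˢ Icc 0 1)) (u w : Lp H 2 unitVolume)
    (h₁ : ∀ s ∈ Icc (0 : ℝ) 1, ∀ t ∈ Icc (0 : ℝ) 1, ∀ b ∈ Icc (0 : ℝ) 1,
      φ t b - φ s b = ∫ r in s..t, M₁ (r, b) (u r))
    (h₂ : ∀ s ∈ Icc (0 : ℝ) 1, ∀ t ∈ Icc (0 : ℝ) 1, ∀ a ∈ Icc (0 : ℝ) 1,
      φ a t - φ a s = ∫ r in s..t, M₂ (a, r) (w r)) {t : ℝ} (ht : t ∈ Icc (0 : ℝ) 1) :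
    φ t t = φ 0 0 + ∫ r in (0 : ℝ)..t, (M₁ (r, r) (u r) + M₂ (r, r) (w r)) := by
  have h0 : (0 : ℝ) ∈ Icc (0 : ℝ) 1 := by simp
  have hdiag : ContinuousOn (fun r : ℝ => (r, r)) (Icc 0 1) := by fun_prop
  have hdm : MapsTo (fun r : ℝ => (r, r)) (Icc 0 1) (Icc (0 : ℝ) 1 ×ˢ Icc (0 : ℝ) 1) :=
    fun r hr => ⟨hr, hr⟩
  have hi₁ := integrable_apply (hM₁.comp hdiag hdm) u
  have hi₂ := integrable_apply (hM₂.comp hdiag hdm) w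
  have hi : Integrable (fun r => M₁ (r, r) (u r) + M₂ (r, r) (w r)) unitVolume := hi₁.add hi₂
  have hn : Integrable (fun r => ‖u r‖ + ‖w r‖) unitVolume :=
    (integrable_lp_two u).norm.add (integrable_lp_two w).norm
  have key := eq_of_increment_le
    (D := fun t => φ t t - ∫ r in (0 : ℝ)..t, (M₁ (r, r) (u r) + M₂ (r, r) (w r)))
    (K := fun t => ∫ r in (0 : ℝ)..t, (‖u r‖ + ‖w r‖)) ?_ ht
  · simp only [intervalIntegral.integral_same, sub_zero] at key
    linarith
  intro ε hε
  have hc : IsCompact (Icc (0 : ℝ) 1 ×ˢ Icc (0 : ℝ) 1) := isCompact_Icc.prod isCompact_Icc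
  have hu₁ := hc.uniformContinuousOn_of_continuous hM₁
  have hu₂ := hc.uniformContinuousOn_of_continuous hM₂
  rw [Metric.uniformContinuousOn_iff] at hu₁ hu₂
  obtain ⟨δ₁, hδ₁, hu₁⟩ := hu₁ ε hε
  obtain ⟨δ₂, hδ₂, hu₂⟩ := hu₂ ε hε
  refine ⟨min δ₁ δ₂, lt_min hδ₁ hδ₂, fun s hs t ht hst hstδ => ?_⟩
  rw [lt_min_iff] at hstδ
  have hK : (∫ r in (0 : ℝ)..t, (‖u r‖ + ‖w r‖)) - ∫ r in (0 : ℝ)..s, (‖u r‖ + ‖w r‖) =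
      ∫ r in s..t, (‖u r‖ + ‖w r‖) :=
    intervalIntegral.integral_interval_sub_left (hn.intervalIntegrable_unit h0 ht)
      (hn.intervalIntegrable_unit h0 hs)
  have hD : (∫ r in (0 : ℝ)..t, (M₁ (r, r) (u r) + M₂ (r, r) (w r))) -
      ∫ r in (0 : ℝ)..s, (M₁ (r, r) (u r) + M₂ (r, r) (w r)) =
      ∫ r in s..t, (M₁ (r, r) (u r) + M₂ (r, r) (w r)) :=
    intervalIntegral.integral_interval_sub_left (hi.intervalIntegrable_unit h0 ht)
      (hi.intervalIntegrable_unit h0 hs)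
  have hj₁ : IntervalIntegrable (fun r => M₁ (r, t) (u r)) volume s t :=
    (integrable_apply (A := fun r => M₁ (r, t)) (hM₁.comp (by fun_prop)
      fun r hr => ⟨hr, ht⟩) u).intervalIntegrable_unit hs ht
  have hj₂ : IntervalIntegrable (fun r => M₂ (s, r) (w r)) volume s t :=
    (integrable_apply (A := fun r => M₂ (s, r)) (hM₂.comp (by fun_prop)
      fun r hr => ⟨hs, hr⟩) w).intervalIntegrable_unit hs ht
  have e1 := h₁ s hs t ht t ht
  have e2 := h₂ s hs t ht s hs
  have hsplit : (φ t t - ∫ r in (0 : ℝ)..t, (M₁ (r, r) (u r) + M₂ (r, r) (w r))) -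
      (φ s s - ∫ r in (0 : ℝ)..s, (M₁ (r, r) (u r) + M₂ (r, r) (w r))) =
      ∫ r in s..t, ((M₁ (r, t) (u r) + M₂ (s, r) (w r)) -
        (M₁ (r, r) (u r) + M₂ (r, r) (w r))) := by
    rw [intervalIntegral.integral_sub (hj₁.add hj₂) (hi.intervalIntegrable_unit hs ht),
      intervalIntegral.integral_add hj₁ hj₂, ← e1, ← e2, ← hD]
    ring
  rw [hsplit, hK, ← Real.norm_eq_abs, ← intervalIntegral.integral_const_mul]
  refine intervalIntegral.norm_integral_le_of_norm_le hst ?_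
    ((hn.intervalIntegrable_unit hs ht).const_mul _)
  refine Filter.Eventually.of_forall fun r hr => ?_
  have hr' : r ∈ Icc (0 : ℝ) 1 := ⟨hs.1.trans hr.1.le, hr.2.trans ht.2⟩
  have b1 : ‖M₁ (r, t) - M₁ (r, r)‖ ≤ ε := by
    rw [← dist_eq_norm]
    refine (hu₁ _ ⟨hr', ht⟩ _ ⟨hr', hr'⟩ ?_).le
    rw [Prod.dist_eq, dist_self, Real.dist_eq, abs_of_nonneg (by linarith [hr.2])]
    exact max_lt hδ₁ (by linarith [hr.1])
  have b2 : ‖M₂ (s, r) - M₂ (r, r)‖ ≤ ε := by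
    rw [← dist_eq_norm]
    refine (hu₂ _ ⟨hs, hr'⟩ _ ⟨hr', hr'⟩ ?_).le
    rw [Prod.dist_eq, dist_self, Real.dist_eq, abs_sub_comm, abs_of_nonneg (by linarith [hr.1])]
    exact max_lt (by linarith [hr.2]) hδ₂
  calc ‖(M₁ (r, t) (u r) + M₂ (s, r) (w r)) - (M₁ (r, r) (u r) + M₂ (r, r) (w r))‖
      = ‖(M₁ (r, t) - M₁ (r, r)) (u r) + (M₂ (s, r) - M₂ (r, r)) (w r)‖ := by
        rw [sub_apply, sub_apply]; congr 1; ring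
    _ ≤ ε * ‖u r‖ + ε * ‖w r‖ := (norm_add_le _ _).trans (add_le_add
        ((M₁ (r, t) - M₁ (r, r)).le_of_opNorm_le b1 _) ((M₂ (s, r) - M₂ (r, r)).le_of_opNorm_le b2 _))
    _ = _ := by ring

/-! ## The adjoint representation -/

section Adjoint

variable {L : Type*} [NormedAddCommGroup L] [NormedSpace ℝ L]
  {G : Type*} [TopologicalSpace G] [ChartedSpace L G] [Group G] [LieGroup 𝓘(ℝ, L) ∞ G]

/-- The differential at `1` of a function with values in a vector space. -/
def derivOne (L : Type*) [NormedAddCommGroup L] [NormedSpace ℝ L] {G : Type*} [TopologicalSpace G]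
    [ChartedSpace L G] [Group G] {W : Type*} [NormedAddCommGroup W] [NormedSpace ℝ W] (f : G → W) :
    L →L[ℝ] W :=
  mfderiv 𝓘(ℝ, L) 𝓘(ℝ, W) f 1

/-- Smooth dependence of differentials is available in tangent coordinates. As the base point is
always `1` and the target is a vector space, the coordinate changes are identities. -/
theorem contMDiff_derivOne {EP HP P : Type*} [NormedAddCommGroup EP] [NormedSpace ℝ EP]
    [TopologicalSpace HP] (IP : ModelWithCorners ℝ EP HP) [TopologicalSpace P] [ChartedSpace HP P]
    [IsManifold IP ∞ P] {W : Type*} [NormedAddCommGroup W] [NormedSpace ℝ W] {F : P → G → W}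
    (hF : ContMDiff (IP.prod 𝓘(ℝ, L)) 𝓘(ℝ, W) ∞ (Function.uncurry F)) :
    ContMDiff IP 𝓘(ℝ, L →L[ℝ] W) ∞ (fun p => derivOne L (F p)) := by
  intro p₀
  have h := ContMDiffAt.mfderiv (m := ∞) (n := ∞) F (fun _ => (1 : G)) (x₀ := p₀)
    hF.contMDiffAt contMDiffAt_const (by simp)
  have e : ∀ p, inTangentCoordinates 𝓘(ℝ, L) 𝓘(ℝ, W) (fun _ => (1 : G)) (fun p => F p 1)
      (fun p => derivOne L (F p)) p₀ p = derivOne L (F p) := by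
    intro p
    refine (inTangentCoordinates_eq (I := 𝓘(ℝ, L)) (I' := 𝓘(ℝ, W)) (fun _ => (1 : G))
      (fun p => F p 1) (fun p => derivOne L (F p)) (mem_chart_source _ _) (mem_univ _)).trans ?_
    refine ContinuousLinearMap.ext fun v => ?_
    rw [tangentBundleCore_coordChange_model_space]
    exact congrArg (derivOne L (F p))
      ((tangentBundleCore 𝓘(ℝ, L) G).coordChange_self _ _ (mem_chart_source _ _) v)
  exact h.congr_of_eventuallyEq (Filter.Eventually.of_forall fun p => (e p).symm)

/-- The differential of `x ↦ a x a⁻¹` at `1`. -/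
def adL (L : Type*) [NormedAddCommGroup L] [NormedSpace ℝ L] {G : Type*} [TopologicalSpace G]
    [ChartedSpace L G] [Group G] (a : G) : L →L[ℝ] L :=
  mfderiv 𝓘(ℝ, L) 𝓘(ℝ, L) (fun x : G => a * x * a⁻¹) 1

theorem contMDiff_conj : ContMDiff (𝓘(ℝ, L).prod 𝓘(ℝ, L)) 𝓘(ℝ, L) ∞
    (fun q : G × G => q.1 * q.2 * q.1⁻¹) :=
  (contMDiff_fst.mul contMDiff_snd).mul contMDiff_fst.inv

theorem contMDiff_adL : ContMDiff 𝓘(ℝ, L) 𝓘(ℝ, L →L[ℝ] L) ∞ (adL L : G → L →L[ℝ] L) := by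
  intro a₀
  have h := ContMDiffAt.mfderiv (m := ∞) (n := ∞) (I := 𝓘(ℝ, L)) (I' := 𝓘(ℝ, L)) (J := 𝓘(ℝ, L))
    (fun a x : G => a * x * a⁻¹) (fun _ => (1 : G)) (x₀ := a₀)
    (contMDiff_conj (L := L) (G := G)).contMDiffAt contMDiffAt_const (by simp)
  have e : ∀ p, inTangentCoordinates 𝓘(ℝ, L) 𝓘(ℝ, L) (fun _ => (1 : G)) (fun a : G => a * 1 * a⁻¹)
      (adL L) a₀ p = adL L p := by
    intro p
    -- Conjugation fixes `1`, so the coordinate change in the target is trivial too.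
    have hc : (fun a : G => a * 1 * a⁻¹) = fun _ => 1 := by
      funext a; rw [mul_one, mul_inv_cancel]
    rw [hc]
    refine (inTangentCoordinates_eq (I := 𝓘(ℝ, L)) (I' := 𝓘(ℝ, L)) (fun _ => (1 : G))
      (fun _ => (1 : G)) (adL L) (mem_chart_source _ _) (mem_chart_source _ _)).trans ?_
    refine ContinuousLinearMap.ext fun v => ?_
    refine ((tangentBundleCore 𝓘(ℝ, L) G).coordChange_self _ _ (mem_chart_source _ _) _).trans ?_
    exact congrArg (adL L p)
      ((tangentBundleCore 𝓘(ℝ, L) G).coordChange_self _ _ (mem_chart_source _ _) v)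
  exact h.congr_of_eventuallyEq (Filter.Eventually.of_forall fun p => (e p).symm)

end Adjoint

/-! ## Left-trivialized derivatives on a Lie group -/

section LieGroupCalculus

variable {L : Type*} [NormedAddCommGroup L] [NormedSpace ℝ L]
  {G : Type*} [TopologicalSpace G] [ChartedSpace L G] [Group G] [LieGroup 𝓘(ℝ, L) ∞ G]
  {W : Type*} [NormedAddCommGroup W] [NormedSpace ℝ W]

theorem contMDiff_mul_left_right (a b : G) :
    ContMDiff 𝓘(ℝ, L) 𝓘(ℝ, L) ∞ (fun x : G => a * x * b) :=
  (contMDiff_const.mul contMDiff_id).mul contMDiff_const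

theorem mdifferentiableAt_mul_left_right (a b x : G) :
    MDifferentiableAt 𝓘(ℝ, L) 𝓘(ℝ, L) (fun x : G => a * x * b) x :=
  (contMDiff_mul_left_right a b).mdifferentiableAt (by simp)

theorem adL_mul (a b : G) : adL L (a * b) = (adL L a).comp (adL L b) := by
  ext v
  have h := mfderiv_comp_apply_of_eq' (x := (1 : G)) (f := fun x : G => b * x * b⁻¹)
    (g := fun x : G => a * x * a⁻¹) (y := 1) (F := L) (F' := L) (F'' := L) (by group)
    (mdifferentiableAt_mul_left_right a a⁻¹ 1) (mdifferentiableAt_mul_left_right b b⁻¹ 1) v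
  have e : (fun x : G => a * (b * x * b⁻¹) * a⁻¹) = fun x => a * b * x * (a * b)⁻¹ := by
    funext x; group
  rw [e] at h
  exact h

theorem adL_one : adL L (1 : G) = ContinuousLinearMap.id ℝ L := by
  have e : (fun x : G => 1 * x * 1⁻¹) = id := by funext x; simp
  unfold adL
  rw [e]
  exact mfderiv_id

theorem adL_inv_apply (a : G) (v : L) : adL L a⁻¹ (adL L a v) = v := by
  have := congrArg (fun A : L →L[ℝ] L => A v) (adL_mul (L := L) a⁻¹ a)
  rw [inv_mul_cancel, adL_one] at this
  exact this.symm

theorem adL_apply_inv (a : G) (v : L) : adL L a (adL L a⁻¹ v) = v := by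
  simpa using adL_inv_apply (L := L) a⁻¹ v

theorem derivOne_conj {f : G → W} (hf : ContMDiff 𝓘(ℝ, L) 𝓘(ℝ, W) ∞ f) (a : G) (v : L) :
    derivOne L (fun x => f (a * x * a⁻¹)) v = derivOne L f (adL L a v) :=
  mfderiv_comp_apply_of_eq' (x := (1 : G)) (f := fun x : G => a * x * a⁻¹) (g := f) (y := 1)
    (F := L) (F' := L) (F'' := W) (by group) (hf.mdifferentiableAt (by simp))
    (mdifferentiableAt_mul_left_right a a⁻¹ 1) v

/-- The function `(x, y) ↦ f (x⁻¹ y)` is constant on the diagonal, so its two partial derivatives at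
`(1, 1)` cancel. -/
theorem derivOne_inv {f : G → W} (hf : ContMDiff 𝓘(ℝ, L) 𝓘(ℝ, W) ∞ f) (v : L) :
    derivOne L (fun x => f x⁻¹) v = - derivOne L f v := by
  have hF : ContMDiff (𝓘(ℝ, L).prod 𝓘(ℝ, L)) 𝓘(ℝ, W) ∞ (fun q : G × G => f (q.1⁻¹ * q.2)) :=
    hf.comp (contMDiff_fst.inv.mul contMDiff_snd)
  have hFd : MDifferentiableAt (𝓘(ℝ, L).prod 𝓘(ℝ, L)) 𝓘(ℝ, W) (fun q : G × G => f (q.1⁻¹ * q.2))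
    ((1 : G), (1 : G)) := hF.mdifferentiableAt (by simp)
  have hdiag : MDifferentiableAt 𝓘(ℝ, L) (𝓘(ℝ, L).prod 𝓘(ℝ, L)) (fun x : G => (x, x)) (1 : G) :=
    mdifferentiableAt_id.prodMk mdifferentiableAt_id
  have h1 := mfderiv_comp_apply (f := fun x : G => (x, x)) (1 : G) hFd hdiag v
  have h2 : mfderiv 𝓘(ℝ, L) (𝓘(ℝ, L).prod 𝓘(ℝ, L)) (fun x : G => (x, x)) (1 : G) v = (v, v) := by
    have := mfderiv_prodMk (I := 𝓘(ℝ, L)) (I' := 𝓘(ℝ, L)) (I'' := 𝓘(ℝ, L)) (x := (1 : G))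
      (f := fun x : G => x) (g := fun x : G => x) mdifferentiableAt_id mdifferentiableAt_id
    refine (congrArg (fun A => A v) this).trans ?_
    exact congrArg₂ Prod.mk (congrArg (fun A : L →L[ℝ] L => A v) (mfderiv_id (I := 𝓘(ℝ, L)) (x := (1:G))))
      (congrArg (fun A : L →L[ℝ] L => A v) (mfderiv_id (I := 𝓘(ℝ, L)) (x := (1:G))))
  have h3 := mfderiv_prod_eq_add_apply (v := ((v, v) : L × L)) hFd
  have h4 : ((fun q : G × G => f (q.1⁻¹ * q.2)) ∘ fun x : G => (x, x)) = fun _ => f 1 := by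
    funext x; simp
  rw [h4] at h1
  have h5 : (fun z : G => f (z⁻¹ * 1)) = fun z => f z⁻¹ := by funext z; simp
  have h6 : (fun z : G => f ((1 : G)⁻¹ * z)) = f := by funext z; simp
  have h7 : (0 : W) = derivOne L (fun z : G => f (z⁻¹ * 1)) v +
      derivOne L (fun z : G => f ((1 : G)⁻¹ * z)) v := by
    refine Eq.trans ?_ ((h1.trans (congrArg _ h2)).trans h3)
    have := mfderiv_const (I := 𝓘(ℝ, L)) (I' := 𝓘(ℝ, W)) (x := (1 : G)) (c := f 1)
    exact (congrArg (fun A : L →L[ℝ] W => A v) this).symm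
  rw [h5, h6] at h7
  exact eq_neg_of_add_eq_zero_left h7.symm

variable (B : AdInvariantInner L G)

instance [FiniteDimensional ℝ L] : FiniteDimensional ℝ (LieAlg B) :=
  inferInstanceAs (FiniteDimensional ℝ L)

instance [FiniteDimensional ℝ L] : CompleteSpace (LieAlg B) := FiniteDimensional.complete ℝ _

variable [FiniteDimensional ℝ L]

namespace LieAlg

/-- The identity map from the Lie algebra with the norm of `B` to the model space. -/
def equivL : LieAlg B ≃L[ℝ] L :=
  LinearEquiv.toContinuousLinearEquiv
    { toFun := fun v => v
      invFun := fun v => v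
      map_add' := fun _ _ => rfl
      map_smul' := fun _ _ => rfl
      left_inv := fun _ => rfl
      right_inv := fun _ => rfl }

/-- The adjoint action as a continuous linear map. -/
def adB (a : G) : LieAlg B →L[ℝ] LieAlg B :=
  ((equivL B).symm : L →L[ℝ] LieAlg B).comp ((adL L a).comp (equivL B : LieAlg B →L[ℝ] L))

variable {B}

theorem ad_eq_adB (a : G) (v : LieAlg B) : LieAlg.ad B a v = adB B a v := rfl

theorem adB_mul_apply (a b : G) (v : LieAlg B) : adB B (a * b) v = adB B a (adB B b v) :=
  congrArg (fun A : L →L[ℝ] L => A v) (adL_mul (L := L) a b)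

@[simp]
theorem adB_inv_apply_self (a : G) (v : LieAlg B) : adB B a⁻¹ (adB B a v) = v :=
  adL_inv_apply (L := L) a v

@[simp]
theorem adB_apply_inv_self (a : G) (v : LieAlg B) : adB B a (adB B a⁻¹ v) = v :=
  adL_apply_inv (L := L) a v

theorem inner_adB_adB (a : G) (v w : LieAlg B) : inner ℝ (adB B a v) (adB B a w) = inner ℝ v w :=
  B.ad_invariant a v w

theorem inner_adB_left (a : G) (v w : LieAlg B) :
    inner ℝ (adB B a v) w = inner ℝ v (adB B a⁻¹ w) := by
  rw [← inner_adB_adB a v, adB_apply_inv_self]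

@[simp]
theorem norm_adB (a : G) (v : LieAlg B) : ‖adB B a v‖ = ‖v‖ := by
  rw [@norm_eq_sqrt_real_inner _ _ _ v, @norm_eq_sqrt_real_inner _ _ _ (adB B a v), inner_adB_adB]

variable (B) in
theorem contMDiff_adB : ContMDiff 𝓘(ℝ, L) 𝓘(ℝ, LieAlg B →L[ℝ] LieAlg B) ∞ (adB B) := by
  have h : ContDiff ℝ ∞ (fun A : L →L[ℝ] L =>
      ((equivL B).symm : L →L[ℝ] LieAlg B).comp (A.comp (equivL B : LieAlg B →L[ℝ] L))) := by
    fun_prop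
  exact h.contMDiff.comp contMDiff_adL

variable (B) in
theorem continuous_adB : Continuous (adB B) := (contMDiff_adB B).continuous

variable (B) in
/-- The left-trivialized differential `v ↦ d f_a (a v)`. -/
def ld (f : G → W) (a : G) : LieAlg B →L[ℝ] W :=
  (derivOne L (fun x => f (a * x))).comp (equivL B : LieAlg B →L[ℝ] L)

theorem leftDeriv_eq_ld (f : G → ℝ) (a : G) (v : LieAlg B) : leftDeriv f a v = ld B f a v := rfl

theorem contMDiff_ld {f : G → W} (hf : ContMDiff 𝓘(ℝ, L) 𝓘(ℝ, W) ∞ f) :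
    ContMDiff 𝓘(ℝ, L) 𝓘(ℝ, LieAlg B →L[ℝ] W) ∞ (ld B f) := by
  have h : ContDiff ℝ ∞ (fun A : L →L[ℝ] W => A.comp (equivL B : LieAlg B →L[ℝ] L)) := by
    fun_prop
  exact h.contMDiff.comp (contMDiff_derivOne 𝓘(ℝ, L) (F := fun a x : G => f (a * x))
    (hf.comp (contMDiff_fst.mul contMDiff_snd)))

theorem continuous_ld {f : G → W} (hf : ContMDiff 𝓘(ℝ, L) 𝓘(ℝ, W) ∞ f) :
    Continuous (ld B f) := (contMDiff_ld hf).continuous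

theorem contMDiff_comp_mul_left {f : G → W} (hf : ContMDiff 𝓘(ℝ, L) 𝓘(ℝ, W) ∞ f) (a : G) :
    ContMDiff 𝓘(ℝ, L) 𝓘(ℝ, W) ∞ (fun x => f (a * x)) :=
  hf.comp (contMDiff_const.mul contMDiff_id)

theorem contMDiff_comp_mul_right {f : G → W} (hf : ContMDiff 𝓘(ℝ, L) 𝓘(ℝ, W) ∞ f) (a : G) :
    ContMDiff 𝓘(ℝ, L) 𝓘(ℝ, W) ∞ (fun x => f (x * a)) :=
  hf.comp (contMDiff_id.mul contMDiff_const)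

theorem contMDiff_comp_inv {f : G → W} (hf : ContMDiff 𝓘(ℝ, L) 𝓘(ℝ, W) ∞ f) :
    ContMDiff 𝓘(ℝ, L) 𝓘(ℝ, W) ∞ (fun x => f x⁻¹) :=
  hf.comp contMDiff_id.inv

theorem ld_comp_mul_left (f : G → W) (c a : G) (v : LieAlg B) :
    ld B (fun x => f (c * x)) a v = ld B f (c * a) v := by
  simp only [ld, mul_assoc]

/-- Write `a x b = (a b)(b⁻¹ x b)`. -/
theorem ld_comp_mul_right {f : G → W} (hf : ContMDiff 𝓘(ℝ, L) 𝓘(ℝ, W) ∞ f) (b a : G)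
    (v : LieAlg B) : ld B (fun x => f (x * b)) a v = ld B f (a * b) (adB B b⁻¹ v) := by
  have h := derivOne_conj (contMDiff_comp_mul_left hf (a * b)) b⁻¹ v
  have e : (fun x => f (a * b * (b⁻¹ * x * b⁻¹⁻¹))) = fun x => f (a * x * b) := by
    funext x; congr 1; group
  rw [e] at h
  exact h

/-- Write `(a x)⁻¹ = a⁻¹ (a x a⁻¹)⁻¹` and differentiate the inversion at `1`. -/
theorem ld_comp_inv {f : G → W} (hf : ContMDiff 𝓘(ℝ, L) 𝓘(ℝ, W) ∞ f) (a : G)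
    (v : LieAlg B) : ld B (fun x => f x⁻¹) a v = - ld B f a⁻¹ (adB B a v) := by
  have h1 := derivOne_inv (contMDiff_comp_mul_left hf a⁻¹) (adL L a v)
  have h2 := derivOne_conj (contMDiff_comp_inv (contMDiff_comp_mul_left hf a⁻¹)) a v
  have e : (fun x => f (a⁻¹ * (a * x * a⁻¹)⁻¹)) = fun x => f (a * x)⁻¹ := by
    funext x; congr 1; group
  rw [e] at h2
  exact h2.trans h1

theorem rightDeriv_eq_ld {f : G → ℝ} (hf : ContMDiff 𝓘(ℝ, L) 𝓘(ℝ, ℝ) ∞ f) (a : G) (v : LieAlg B) :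
    rightDeriv f a v = ld B f a (adB B a⁻¹ v) := by
  have h := derivOne_conj (contMDiff_comp_mul_left hf a) a⁻¹ v
  have e : (fun x => f (a * (a⁻¹ * x * a⁻¹⁻¹))) = fun x => f (x * a) := by
    funext x; congr 1; group
  rw [e] at h
  exact h

end LieAlg

open LieAlg

variable {B}

/-! ## Logarithmic derivatives of products and inverses -/

theorem hasLeftLogDeriv_iff {E : ℝ → G} {u : PathAlg B} : HasLeftLogDeriv E u ↔
    ContinuousOn E (Icc 0 1) ∧ ∀ f : G → ℝ, ContMDiff 𝓘(ℝ, L) 𝓘(ℝ, ℝ) ∞ f → ∀ t ∈ Icc (0 : ℝ) 1,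
      f (E t) = f (E 0) + ∫ s in (0 : ℝ)..t, ld B f (E s) (u s) := Iff.rfl

theorem intervalIntegral_congr_unit' {f g : ℝ → W}
    (hfg : ∀ᵐ t ∂unitVolume, t ∈ Icc (0 : ℝ) 1 → f t = g t) {s t : ℝ}
    (hs : s ∈ Icc (0 : ℝ) 1) (ht : t ∈ Icc (0 : ℝ) 1) : ∫ r in s..t, f r = ∫ r in s..t, g r := by
  refine intervalIntegral_congr_unit ?_ hs ht
  filter_upwards [hfg, ae_restrict_mem measurableSet_Icc] with t h1 h2 using h1 h2

theorem HasLeftLogDeriv.continuousOn {E : ℝ → G} {u : PathAlg B} (h : HasLeftLogDeriv E u) :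
    ContinuousOn E (Icc 0 1) := h.1

theorem HasLeftLogDeriv.integrable {E : ℝ → G} {u : PathAlg B} (h : HasLeftLogDeriv E u)
    {f : G → W} (hf : ContMDiff 𝓘(ℝ, L) 𝓘(ℝ, W) ∞ f) :
    Integrable (fun s => ld B f (E s) (u s)) unitVolume :=
  integrable_apply ((continuous_ld hf).comp_continuousOn h.1) u

theorem HasLeftLogDeriv.sub_eq {E : ℝ → G} {u : PathAlg B} (h : HasLeftLogDeriv E u)
    {f : G → ℝ} (hf : ContMDiff 𝓘(ℝ, L) 𝓘(ℝ, ℝ) ∞ f) {s t : ℝ}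
    (hs : s ∈ Icc (0 : ℝ) 1) (ht : t ∈ Icc (0 : ℝ) 1) :
    f (E t) - f (E s) = ∫ r in s..t, ld B f (E r) (u r) := by
  have h0 : (0 : ℝ) ∈ Icc (0 : ℝ) 1 := by simp
  rw [(hasLeftLogDeriv_iff.1 h).2 f hf t ht, (hasLeftLogDeriv_iff.1 h).2 f hf s hs,
    add_sub_add_left_eq_sub]
  exact intervalIntegral.integral_interval_sub_left
    ((h.integrable hf).intervalIntegrable_unit h0 ht)
    ((h.integrable hf).intervalIntegrable_unit h0 hs)

theorem HasLeftLogDeriv.congr {E E' : ℝ → G} {u : PathAlg B} (h : HasLeftLogDeriv E u)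
    (hE : EqOn E' E (Icc 0 1)) : HasLeftLogDeriv E' u := by
  have h0 : (0 : ℝ) ∈ Icc (0 : ℝ) 1 := by simp
  refine hasLeftLogDeriv_iff.2 ⟨h.1.congr hE, fun f hf t ht => ?_⟩
  rw [hE ht, hE h0, (hasLeftLogDeriv_iff.1 h).2 f hf t ht]
  congr 1
  exact intervalIntegral_congr_unit' (Filter.Eventually.of_forall fun s hs => by rw [hE hs]) h0 ht

/-- This is `(g h)⁻¹ (g h)' = Ad(h⁻¹)(g⁻¹ g') + h⁻¹ h'`. For each test function `f`, the function `f
(g s * h t)` of two separate times is integrated in each variable and then restricted to the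
diagonal. -/
theorem HasLeftLogDeriv.mul {g h : ℝ → G} {u w z : PathAlg B} (hg : HasLeftLogDeriv g u)
    (hh : HasLeftLogDeriv h w) (hz : ∀ᵐ t ∂unitVolume, z t = adB B (h t)⁻¹ (u t) + w t) :
    HasLeftLogDeriv (fun t => g t * h t) z := by
  have h0 : (0 : ℝ) ∈ Icc (0 : ℝ) 1 := by simp
  have hgc := hg.1
  have hhc := hh.1
  have htg : LieGroup 𝓘(ℝ, L) ∞ G := inferInstance
  have : IsTopologicalGroup G := topologicalGroup_of_lieGroup 𝓘(ℝ, L) ∞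
  refine hasLeftLogDeriv_iff.2 ⟨hgc.mul hhc, fun f hf t ht => ?_⟩
  have hcc : ContinuousOn (fun q : ℝ × ℝ => g q.1 * h q.2) (Icc 0 1 ×ˢ Icc 0 1) :=
    (hgc.comp continuousOn_fst fun q hq => hq.1).mul (hhc.comp continuousOn_snd fun q hq => hq.2)
  have hhi : ContinuousOn (fun q : ℝ × ℝ => adB B (h q.2)⁻¹) (Icc 0 1 ×ˢ Icc 0 1) :=
    (continuous_adB B).comp_continuousOn (hhc.comp continuousOn_snd fun q hq => hq.2).inv
  have key := diagonal_eq_add_integral (φ := fun s t => f (g s * h t))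
    (M₁ := fun q => (ld B f (g q.1 * h q.2)).comp (adB B (h q.2)⁻¹))
    (M₂ := fun q => ld B f (g q.1 * h q.2))
    (((continuous_ld hf).comp_continuousOn hcc).clm_comp hhi)
    ((continuous_ld hf).comp_continuousOn hcc) u w
    (fun s hs t ht b hb => by
      rw [hg.sub_eq (contMDiff_comp_mul_right hf (h b)) hs ht]
      simp only [ld_comp_mul_right hf, ContinuousLinearMap.comp_apply])
    (fun s hs t ht a ha => by
      rw [hh.sub_eq (contMDiff_comp_mul_left hf (g a)) hs ht]
      simp only [ld_comp_mul_left]) ht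
  dsimp only at key
  rw [key]
  congr 1
  refine intervalIntegral_congr_unit ?_ h0 ht
  filter_upwards [hz] with r hr
  rw [hr, map_add, ContinuousLinearMap.comp_apply]

theorem HasLeftLogDeriv.inv {g : ℝ → G} {u z : PathAlg B} (hg : HasLeftLogDeriv g u)
    (hz : ∀ᵐ t ∂unitVolume, z t = - adB B (g t) (u t)) : HasLeftLogDeriv (fun t => (g t)⁻¹) z := by
  have h0 : (0 : ℝ) ∈ Icc (0 : ℝ) 1 := by simp
  have : IsTopologicalGroup G := topologicalGroup_of_lieGroup 𝓘(ℝ, L) ∞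
  refine hasLeftLogDeriv_iff.2 ⟨hg.1.inv, fun f hf t ht => ?_⟩
  rw [(hasLeftLogDeriv_iff.1 hg).2 _ (contMDiff_comp_inv hf) t ht]
  congr 1
  refine intervalIntegral_congr_unit ?_ h0 ht
  filter_upwards [hz] with r hr
  rw [hr, map_neg, ld_comp_inv hf]

theorem HasLeftLogDeriv.const_mul {g : ℝ → G} {u : PathAlg B} (hg : HasLeftLogDeriv g u) (c : G) :
    HasLeftLogDeriv (fun t => c * g t) u := by
  have : IsTopologicalGroup G := topologicalGroup_of_lieGroup 𝓘(ℝ, L) ∞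
  refine hasLeftLogDeriv_iff.2 ⟨continuousOn_const.mul hg.1, fun f hf t ht => ?_⟩
  rw [(hasLeftLogDeriv_iff.1 hg).2 _ (contMDiff_comp_mul_left hf c) t ht]
  simp only [ld_comp_mul_left]

theorem hasLeftLogDeriv_const (c : G) : HasLeftLogDeriv (fun _ => c) (0 : PathAlg B) := by
  refine hasLeftLogDeriv_iff.2 ⟨continuousOn_const, fun f hf t ht => ?_⟩
  have : ∫ s in (0 : ℝ)..t, ld B f c ((0 : PathAlg B) s) = ∫ s in (0 : ℝ)..t, (0 : ℝ) := by
    refine intervalIntegral_congr_unit ?_ (by simp) ht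
    filter_upwards [Lp.coeFn_zero (LieAlg B) 2 unitVolume] with s hs
    rw [hs, Pi.zero_apply, map_zero]
  rw [this]
  simp

theorem hasRightLogDeriv_iff {g : ℝ → G} {w z : PathAlg B}
    (hz : ∀ᵐ t ∂unitVolume, z t = adB B (g t)⁻¹ (w t)) :
    HasRightLogDeriv g w ↔ HasLeftLogDeriv g z := by
  unfold HasRightLogDeriv HasLeftLogDeriv
  refine and_congr_right fun _ => forall_congr' fun f => forall_congr' fun hf =>
    forall_congr' fun t => forall_congr' fun ht => ?_
  rw [intervalIntegral_congr_unit (f := fun s => leftDeriv f (g s) (z s))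
    (g := fun s => rightDeriv f (g s) (w s)) ?_ (by simp) ht]
  filter_upwards [hz] with s hs
  rw [leftDeriv_eq_ld, rightDeriv_eq_ld hf, hs]

/-- Bump functions separate points. -/
theorem eq_of_forall_contMDiff_eq {X : Type*} [TopologicalSpace X] [ChartedSpace L X]
    [IsManifold 𝓘(ℝ, L) ∞ X] [T2Space X] {a b : X}
    (h : ∀ f : X → ℝ, ContMDiff 𝓘(ℝ, L) 𝓘(ℝ, ℝ) ∞ f → f a = f b) : a = b := by
  by_contra hab
  obtain ⟨f, hf, -⟩ := SmoothBumpFunction.nhds_basis_support (I := 𝓘(ℝ, L))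
    (s := {b}ᶜ) (c := a) (by simpa using isOpen_compl_singleton.mem_nhds hab) |>.mem_iff.1
      (isOpen_compl_singleton.mem_nhds hab)
  · have h1 := h f f.contMDiff
    rw [f.eq_one] at h1
    exact hf (subset_tsupport _ (by rw [Function.mem_support, ← h1]; exact one_ne_zero)) rfl

/-- The path `E E'⁻¹` has logarithmic derivative `Ad(E') u - Ad(E') u = 0`, so every smooth function
is constant along it. -/
theorem HasLeftLogDeriv.unique [T2Space G] {E E' : ℝ → G} {u : PathAlg B}
    (h : HasLeftLogDeriv E u) (h' : HasLeftLogDeriv E' u) (h0 : E 0 = E' 0) :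
    EqOn E E' (Icc 0 1) := by
  intro t ht
  have : IsTopologicalGroup G := topologicalGroup_of_lieGroup 𝓘(ℝ, L) ∞
  have hA : ContinuousOn (fun t => adB B (E' t)) (Icc 0 1) :=
    (continuous_adB B).comp_continuousOn h'.1
  have hi := h'.inv (z := -(memLp_apply hA u).toLp) (by
    filter_upwards [Lp.coeFn_neg (memLp_apply hA u).toLp, (memLp_apply hA u).coeFn_toLp]
      with t h1 h2
    rw [h1, Pi.neg_apply, h2])
  have hm := h.mul (z := 0) hi (by
    filter_upwards [Lp.coeFn_neg (memLp_apply hA u).toLp, (memLp_apply hA u).coeFn_toLp,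
      Lp.coeFn_zero (LieAlg B) 2 unitVolume] with t h1 h2 h3
    rw [h1, Pi.neg_apply, h2, h3, inv_inv, add_neg_cancel]
    rfl)
  have key : E t * (E' t)⁻¹ = E 0 * (E' 0)⁻¹ := by
    refine eq_of_forall_contMDiff_eq (L := L) fun f hf => ?_
    have e : ∫ s in (0 : ℝ)..t, ld B f (E s * (E' s)⁻¹) ((0 : PathAlg B) s) =
        ∫ s in (0 : ℝ)..t, (0 : ℝ) := by
      refine intervalIntegral_congr_unit ?_ (by simp) ht
      filter_upwards [Lp.coeFn_zero (LieAlg B) 2 unitVolume] with s hs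
      rw [hs, Pi.zero_apply, map_zero]
    have h1 := (hasLeftLogDeriv_iff.1 hm).2 f hf t ht
    rw [e] at h1
    simpa using h1
  rw [h0, mul_inv_cancel] at key
  exact mul_inv_eq_one.1 key

end LieGroupCalculus

/-! ## Paths with a given small logarithmic derivative -/

section LocalExistence

open LieAlg

variable {L : Type*} [NormedAddCommGroup L] [NormedSpace ℝ L]
  {G : Type*} [TopologicalSpace G] [ChartedSpace L G] [Group G] [LieGroup 𝓘(ℝ, L) ∞ G]
  {W : Type*} [NormedAddCommGroup W] [NormedSpace ℝ W]
  {W' : Type*} [NormedAddCommGroup W'] [NormedSpace ℝ W']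
  (B : AdInvariantInner L G) [FiniteDimensional ℝ L]

variable {B} in
theorem LieAlg.ld_congr {f g : G → W} {a : G} (h : f =ᶠ[𝓝 a] g) : ld B f a = ld B g a := by
  have : IsTopologicalGroup G := topologicalGroup_of_lieGroup 𝓘(ℝ, L) ∞
  have hc : Filter.Tendsto (fun x : G => a * x) (𝓝 1) (𝓝 a) := by
    have := (continuous_const_mul a).tendsto (1 : G)
    rwa [mul_one] at this
  have h1 : (fun x => f (a * x)) =ᶠ[𝓝 1] fun x => g (a * x) := hc.eventually h
  exact congrArg (fun A : L →L[ℝ] W => A.comp (equivL B : LieAlg B →L[ℝ] L))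
    (h1.mfderiv_eq (I := 𝓘(ℝ, L)) (I' := 𝓘(ℝ, W)))

variable {B} in
theorem LieAlg.ld_comp {h : G → W} (hh : ContMDiff 𝓘(ℝ, L) 𝓘(ℝ, W) ∞ h) {ψ : W → W'} {a : G}
    (hψ : DifferentiableAt ℝ ψ (h a)) (v : LieAlg B) :
    ld B (fun x => ψ (h x)) a v = fderiv ℝ ψ (h a) (ld B h a v) := by
  have h1 := mfderiv_comp_apply_of_eq' (F := L) (F' := W) (F'' := W') (x := (1 : G))
    (f := fun x => h (a * x)) (g := ψ) (y := h a) (by rw [mul_one]) hψ.mdifferentiableAt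
    ((contMDiff_comp_mul_left hh a).mdifferentiableAt (by simp)) v
  rw [mfderiv_eq_fderiv] at h1
  exact h1

/-- In a chart at `1` the equation becomes `y' = F(y) u`, where `F` is the left-trivialized
differential of the chart. Two cutoffs globalize the data: `κ` extends the chart to `G`, and `ρ`
extends `F` to the model space. Small `u` keep the path where both cutoffs equal one. -/
theorem exists_local_transport [T2Space G] :
    ∃ E : PathAlg B → ℝ → G, (∀ᶠ u in 𝓝 0, E u 0 = 1 ∧ HasLeftLogDeriv (E u) u) ∧
      ContMDiffAt 𝓘(ℝ, PathAlg B) 𝓘(ℝ, L) ∞ (fun u => E u 1) 0 ∧ E 0 1 = 1 ∧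
      ∀ v : PathAlg B, (mfderiv 𝓘(ℝ, PathAlg B) 𝓘(ℝ, L) (fun u => E u 1) 0 v : L) =
        equivL B (∫ t in (0 : ℝ)..1, v t) := by
  set c := chartAt L (1 : G) with hc
  set z₀ : L := c 1 with hz₀
  have h1c : (1 : G) ∈ c.source := mem_chart_source L 1
  have hc1 : c.symm z₀ = 1 := c.left_inv h1c
  have hz₀t : z₀ ∈ c.target := c.map_source h1c
  obtain ⟨b⟩ : Nonempty (SmoothBumpFunction 𝓘(ℝ, L) (1 : G)) := inferInstance
  set κ : G → L := fun x => b x • c x with hκ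
  have hκs : ContMDiff 𝓘(ℝ, L) 𝓘(ℝ, L) ∞ κ := b.contMDiff_smul contMDiffOn_chart
  obtain ⟨G₁, hG₁, hG₁o, h1G₁⟩ := eventually_nhds_iff.1
    (b.eventuallyEq_one.and (c.open_source.mem_nhds h1c))
  have hκc : ∀ x ∈ G₁, κ x = c x := fun x hx => by
    change b x • c x = c x
    rw [(hG₁ x hx).1]
    exact one_smul ℝ (c x)
  have hOopen : IsOpen (c.target ∩ c.symm ⁻¹' G₁) := c.isOpen_inter_preimage_symm hG₁o
  have hz₀O : z₀ ∈ c.target ∩ c.symm ⁻¹' G₁ := ⟨hz₀t, by rw [mem_preimage, hc1]; exact h1G₁⟩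
  obtain ⟨ε, hε, hεO⟩ := Metric.nhds_basis_closedBall.mem_iff.1 (hOopen.mem_nhds hz₀O)
  let ρ : ContDiffBump z₀ := ⟨ε / 2, ε, half_pos hε, half_lt_self hε⟩
  have hsymm : ContMDiffOn 𝓘(ℝ, L) 𝓘(ℝ, L) ∞ c.symm c.target := contMDiffOn_chart_symm
  have hFs : ContDiff ℝ ∞ (fun z => ρ z • ld B κ (c.symm z)) := by
    rw [← contMDiff_iff_contDiff]
    refine contMDiff_of_tsupport fun z hz => ?_
    have hz' : z ∈ c.target := by
      have : z ∈ tsupport ρ := closure_mono (fun x hx => by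
        rw [Function.mem_support] at hx ⊢
        intro h0
        exact hx (by simp only [h0, zero_smul])) hz
      rw [ρ.tsupport_eq] at this
      exact (hεO this).1
    have h1 : ContMDiffAt 𝓘(ℝ, L) 𝓘(ℝ, LieAlg B →L[ℝ] L) ∞ (fun z => ld B κ (c.symm z)) z :=
      (contMDiff_ld hκs).contMDiffAt.comp z (hsymm.contMDiffAt (c.open_target.mem_nhds hz'))
    exact ρ.contDiff.contMDiff.contMDiffAt.smul h1
  let F : C(L, LieAlg B →L[ℝ] L) := ⟨fun z => ρ z • ld B κ (c.symm z), hFs.continuous⟩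
  have hF1 : ∀ z ∈ Metric.closedBall z₀ (ε / 2), F z = ld B κ (c.symm z) := fun z hz => by
    change ρ z • ld B κ (c.symm z) = _
    rw [ρ.one_of_mem_closedBall hz, one_smul]
  have hFz₀ : F z₀ = ld B κ 1 := by
    rw [hF1 z₀ (Metric.mem_closedBall_self (by positivity)), hc1]
  obtain ⟨Y, hYs, hY0, hYd, hYeq⟩ := exists_local_controlled_flow F hFs z₀
  have h0 : (0 : ℝ) ∈ Icc (0 : ℝ) 1 := by simp
  let ev : C(Icc (0 : ℝ) 1, L) →L[ℝ] L := ContinuousMap.evalCLM ℝ (1 : Icc (0 : ℝ) 1)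
  have hY1 : ContDiffAt ℝ ∞ (fun u => Y u 1) 0 :=
    ContDiffAt.comp (g := ev) (f := Y) 0 ev.contDiff.contDiffAt hYs
  have htoUnit1 : toUnit 1 = 1 := projIcc_right _
  have hY01 : Y 0 1 = z₀ := by rw [hY0]; rfl
  have hE1 : ContMDiffAt 𝓘(ℝ, PathAlg B) 𝓘(ℝ, L) ∞ (fun u => c.symm (Y u 1)) 0 := by
    refine ContMDiffAt.comp (I' := 𝓘(ℝ, L)) (g := c.symm) (f := fun u => Y u 1) 0 ?_ hY1.contMDiffAt
    exact (hsymm z₀ hz₀t).contMDiffAt (c.open_target.mem_nhds hz₀t) |> (by rw [hY01]; exact ·)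
  refine ⟨fun u t => c.symm (Y u (toUnit t)), ?_, ?_, ?_, ?_⟩
  · have hnear : ∀ᶠ u in 𝓝 (0 : PathAlg B), dist (Y u) (Y 0) < ε / 4 :=
      hYs.continuousAt (Metric.ball_mem_nhds _ (by positivity))
    filter_upwards [hYeq, hnear] with u hu hun
    have hball : ∀ t, Y u t ∈ Metric.closedBall z₀ (ε / 4) := fun t => by
      have := (ContinuousMap.dist_apply_le_dist t).trans hun.le
      rwa [hY0] at this
    have hsub : Metric.closedBall z₀ (ε / 4) ⊆ Metric.ball z₀ (ε / 2) :=
      Metric.closedBall_subset_ball (by linarith)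
    have hsub' : Metric.ball z₀ (ε / 2) ⊆ c.target ∩ c.symm ⁻¹' G₁ :=
      (Metric.ball_subset_closedBall.trans (Metric.closedBall_subset_closedBall (by linarith))).trans hεO
    have hu0 : Y u (toUnit 0) = z₀ := by
      rw [hu]
      have : toUnit 0 = ⟨0, h0⟩ := projIcc_left _
      rw [this]
      simp
    refine ⟨by rw [hu0, hc1], hasLeftLogDeriv_iff.2 ⟨?_, fun f hf t ht => ?_⟩⟩
    · exact c.continuousOn_symm.comp (continuousOn_comp_toUnit (Y u))
        fun t _ => (hsub' (hsub (hball _))).1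
    have hψ : ContDiffOn ℝ ∞ (fun z => f (c.symm z)) (Metric.ball z₀ (ε / 2)) := by
      rw [← contMDiffOn_iff_contDiffOn]
      exact hf.comp_contMDiffOn (hsymm.mono fun z hz => (hsub' hz).1)
    rw [comp_volterra_eq Metric.isOpen_ball (hψ.of_le (by simp)) hsub (Y u) hball _ z₀ hu ht]
    congr 1
    refine intervalIntegral_congr_unit ?_ h0 ht
    filter_upwards [pathApplyL_ae (F.comp (Y u)) u] with s hs
    rw [hs, ContinuousMap.comp_apply,
      hF1 _ (Metric.ball_subset_closedBall (hsub (hball _)))]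
    set z := Y u (toUnit s)
    have hz : z ∈ Metric.ball z₀ (ε / 2) := hsub (hball _)
    have hzG : c.symm z ∈ G₁ := (hsub' hz).2
    have hκz : κ (c.symm z) = z := by rw [hκc _ hzG, c.right_inv (hsub' hz).1]
    -- Factoring `f` through `κ` turns `ld B f` into the ordinary derivative of `f ∘ c.symm` applied
    -- to the vector field `F`.
    have e : f =ᶠ[𝓝 (c.symm z)] fun x => f (c.symm (κ x)) := by
      filter_upwards [hG₁o.mem_nhds hzG] with x hx
      rw [hκc x hx, c.left_inv (hG₁ x hx).2]
    rw [ld_congr e]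
    have hd : DifferentiableAt ℝ (fun z => f (c.symm z)) (κ (c.symm z)) := by
      rw [hκz]
      exact (hψ.differentiableOn (by simp)).differentiableAt (Metric.isOpen_ball.mem_nhds hz)
    rw [ld_comp (ψ := fun z => f (c.symm z)) hκs hd, hκz]
  · simp only [htoUnit1]; exact hE1
  · simp only [htoUnit1, hY01, hc1]
  · intro v
    have hfun : (fun u => c.symm (Y u (toUnit 1))) = fun u => c.symm (Y u 1) := by
      simp only [htoUnit1]
    refine (congrArg (fun g : PathAlg B → G =>
      (mfderiv 𝓘(ℝ, PathAlg B) 𝓘(ℝ, L) g 0 v : L)) hfun).trans ?_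
    have hκd : MDifferentiableAt 𝓘(ℝ, L) 𝓘(ℝ, L) κ (1 : G) := hκs.mdifferentiableAt (by simp)
    have h1 := mfderiv_comp_apply_of_eq' (F := PathAlg B) (F' := L) (F'' := L)
      (x := (0 : PathAlg B)) (f := fun u => c.symm (Y u 1)) (g := κ) (y := 1) (by rw [hY01, hc1])
      hκd (hE1.mdifferentiableAt (by simp)) v
    have e : (fun u => κ (c.symm (Y u 1))) =ᶠ[𝓝 0] fun u => Y u 1 := by
      have hcont : ContinuousAt (fun u => Y u 1) 0 := hY1.continuousAt
      have hmem : c.target ∩ c.symm ⁻¹' G₁ ∈ 𝓝 (Y 0 1) := by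
        rw [hY01]; exact hOopen.mem_nhds hz₀O
      filter_upwards [hcont hmem] with u hu
      rw [hκc _ hu.2, c.right_inv hu.1]
    have h2 : (mfderiv 𝓘(ℝ, PathAlg B) 𝓘(ℝ, L) (fun u => κ (c.symm (Y u 1))) 0 v : L) =
        mfderiv 𝓘(ℝ, L) 𝓘(ℝ, L) κ 1 (equivL B (∫ t in (0 : ℝ)..1, v t)) := by
      refine (congrArg (fun A : PathAlg B →L[ℝ] L => A v) (e.mfderiv_eq)).trans ?_
      rw [mfderiv_eq_fderiv]
      have h3 : HasFDerivAt (fun u => Y u 1) (ev.comp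
          ((volterra L).comp (pathApplyL (LieAlg B) L (ContinuousMap.const _ (F z₀))))) 0 :=
        HasFDerivAt.comp (g := ev) (f := Y) 0 ev.hasFDerivAt hYd
      rw [h3.fderiv]
      change ∫ s in (0 : ℝ)..1, pathApplyL (LieAlg B) L (ContinuousMap.const _ (F z₀)) v s = _
      rw [intervalIntegral_congr_unit (pathApplyL_ae (ContinuousMap.const _ (F z₀)) v) h0 (by simp)]
      simp only [ContinuousMap.const_apply]
      rw [(F z₀).intervalIntegral_comp_comm
        ((integrable_lp_two v).intervalIntegrable_unit h0 (by simp)), hFz₀]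
      change derivOne L (fun x => κ (1 * x)) _ = derivOne L κ _
      simp only [one_mul]
      rfl
    have hinj : Function.Injective (mfderiv 𝓘(ℝ, L) 𝓘(ℝ, L) κ (1 : G)) := by
      have hκe : κ =ᶠ[𝓝 (1 : G)] c := by
        filter_upwards [hG₁o.mem_nhds h1G₁] with x hx using hκc x hx
      rw [hκe.mfderiv_eq]
      have hd : MDifferentiableAt 𝓘(ℝ, L) 𝓘(ℝ, L) c (1 : G) :=
        (mdifferentiable_chart (I := 𝓘(ℝ, L)) (1 : G)).mdifferentiableAt h1c
      exact ((mdifferentiable_chart (I := 𝓘(ℝ, L)) (1 : G)).mfderiv_bijective h1c).1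
    exact hinj (h1.symm.trans h2)

end LocalExistence

/-! ## The left trivialization of the tangent bundle -/

section ParallelTransport

open LieAlg

variable {L : Type*} [NormedAddCommGroup L] [NormedSpace ℝ L]
  {G : Type*} [TopologicalSpace G] [ChartedSpace L G] [Group G] [LieGroup 𝓘(ℝ, L) ∞ G]
  (B : AdInvariantInner L G) [FiniteDimensional ℝ L]

section LeftTrivialization

variable {B}

variable (B) in
/-- The left trivialization of the tangent space at `a`. -/
def leftTriv (a : G) : L →L[ℝ] LieAlg B :=
  ((equivL B).symm : L →L[ℝ] LieAlg B).comp
    (mfderiv 𝓘(ℝ, L) 𝓘(ℝ, L) (fun x : G => a⁻¹ * x) a : L →L[ℝ] L)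

theorem biinvariantMetric_eq (a : G) (v w : L) :
    biinvariantMetric B a v w = inner ℝ (leftTriv B a v) (leftTriv B a w) := rfl

theorem mdifferentiableAt_mul_left' (a x : G) :
    MDifferentiableAt 𝓘(ℝ, L) 𝓘(ℝ, L) (fun x : G => a * x) x :=
  (contMDiff_const.mul contMDiff_id : ContMDiff 𝓘(ℝ, L) 𝓘(ℝ, L) ∞ (fun x : G => a * x)
    ).mdifferentiableAt (by simp)

variable (B) in
/-- The inverse of the left trivialization. -/
def leftTrivSymm (a : G) : LieAlg B →L[ℝ] L :=
  (mfderiv 𝓘(ℝ, L) 𝓘(ℝ, L) (fun x : G => a * x) 1 : L →L[ℝ] L).comp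
    (equivL B : LieAlg B →L[ℝ] L)

theorem leftTriv_leftTrivSymm (a : G) (v : LieAlg B) : leftTriv B a (leftTrivSymm B a v) = v := by
  have h := mfderiv_comp_apply_of_eq' (F := L) (F' := L) (F'' := L) (x := (1 : G))
    (f := fun x : G => a * x) (g := fun x : G => a⁻¹ * x) (y := a) (mul_one a)
    (mdifferentiableAt_mul_left' _ _) (mdifferentiableAt_mul_left' _ _) (equivL B v)
  have e : (fun x : G => a⁻¹ * (a * x)) = id := by funext x; simp
  rw [e] at h
  have h2 := congrArg (fun A : L →L[ℝ] L => A (equivL B v)) (mfderiv_id (I := 𝓘(ℝ, L)) (x := (1 : G)))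
  exact congrArg (equivL B).symm (h.symm.trans h2)

theorem leftTrivSymm_leftTriv (a : G) (v : L) : leftTrivSymm B a (leftTriv B a v) = v := by
  have h := mfderiv_comp_apply_of_eq' (F := L) (F' := L) (F'' := L) (x := a)
    (f := fun x : G => a⁻¹ * x) (g := fun x : G => a * x) (y := 1) (inv_mul_cancel a)
    (mdifferentiableAt_mul_left' _ _) (mdifferentiableAt_mul_left' _ _) v
  have e : (fun x : G => a * (a⁻¹ * x)) = id := by funext x; simp
  rw [e] at h
  have h2 := congrArg (fun A : L →L[ℝ] L => A v) (mfderiv_id (I := 𝓘(ℝ, L)) (x := a))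
  exact h.symm.trans h2

theorem leftTriv_injective (a : G) : Function.Injective (leftTriv B a) :=
  Function.LeftInverse.injective (leftTrivSymm_leftTriv a)

end LeftTrivialization

/-! ## The parallel transport map -/

/-- The path of operators `t ↦ Ad(g t)`. -/
def adPath (g : ℝ → G) (hg : ContinuousOn g (Icc 0 1)) :
    C(Icc (0 : ℝ) 1, LieAlg B →L[ℝ] LieAlg B) :=
  ⟨fun t => adB B (g t), (continuous_adB B).comp
    (hg.comp_continuous continuous_subtype_val fun t => t.2)⟩

theorem toUnit_of_mem {t : ℝ} (ht : t ∈ Icc (0 : ℝ) 1) : toUnit t = ⟨t, ht⟩ :=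
  projIcc_of_mem zero_le_one ht

/-- Pointwise application of `Ad(g t)` to the elements of `L²([0,1], 𝔤)`. -/
def adMulL (g : ℝ → G) (hg : ContinuousOn g (Icc 0 1)) : PathAlg B →L[ℝ] PathAlg B :=
  pathApplyL (LieAlg B) (LieAlg B) (adPath B g hg)

variable {B}

theorem adMulL_ae (g : ℝ → G) (hg : ContinuousOn g (Icc 0 1)) (u : PathAlg B) :
    ∀ᵐ t ∂unitVolume, adMulL B g hg u t = adB B (g t) (u t) := by
  filter_upwards [pathApplyL_ae (adPath B g hg) u, ae_restrict_mem measurableSet_Icc] with t h ht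
  refine h.trans ?_
  rw [toUnit_of_mem ht]
  rfl

theorem norm_adMulL (g : ℝ → G) (hg : ContinuousOn g (Icc 0 1)) (u : PathAlg B) :
    ‖adMulL B g hg u‖ = ‖u‖ := by
  refine le_antisymm (Lp.norm_le_norm_of_ae_le ?_) (Lp.norm_le_norm_of_ae_le ?_) <;>
  · filter_upwards [adMulL_ae g hg u] with t ht
    rw [ht, norm_adB]

/-- In the product rule for `F E` the factor `Ad(E⁻¹)` undoes `Ad(E)`. This is the cocycle identity
that carries local results at `0` to arbitrary `u`. -/
theorem HasLeftLogDeriv.add_adMulL {E F : ℝ → G} {u v : PathAlg B} (hE : HasLeftLogDeriv E u)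
    (hF : HasLeftLogDeriv F (adMulL B E hE.continuousOn v)) : HasLeftLogDeriv (fun t => F t * E t) (u + v) := by
  refine hF.mul hE ?_
  filter_upwards [Lp.coeFn_add u v, adMulL_ae E hE.continuousOn v] with t h1 h2
  rw [h1, h2, Pi.add_apply, adB_inv_apply_self, add_comm]

theorem HasLeftLogDeriv.inv_adMulL {E : ℝ → G} {u : PathAlg B} (hE : HasLeftLogDeriv E u) :
    HasLeftLogDeriv (fun t => (E t)⁻¹) (-adMulL B E hE.continuousOn u) := by
  refine hE.inv ?_
  filter_upwards [Lp.coeFn_neg (adMulL B E hE.continuousOn u), adMulL_ae E hE.continuousOn u] with t h1 h2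
  rw [h1, Pi.neg_apply, h2]

variable [T2Space G]

/-- Solutions exist for `‖u‖ < δ`. A longer `u` is split into small multiples of itself; since
`Ad(E)` preserves the norm, each added piece is still within the local range, and the solutions are
multiplied. -/
theorem exists_transport (u : PathAlg B) : ∃ E : ℝ → G, E 0 = 1 ∧ HasLeftLogDeriv E u := by
  obtain ⟨E₀, hE₀, -⟩ := exists_local_transport B
  obtain ⟨δ, hδ, hE₀⟩ := Metric.eventually_nhds_iff.1 hE₀
  have key : ∀ n : ℕ, ∀ u : PathAlg B, ‖u‖ < (n + 1) * δ →
      ∃ E : ℝ → G, E 0 = 1 ∧ HasLeftLogDeriv E u := by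
    intro n
    induction n with
    | zero =>
      intro u hu
      exact ⟨E₀ u, hE₀ (by simpa using hu)⟩
    | succ n ih =>
      intro u hu
      -- Here `‖u‖ < (n + 2) δ`, so this piece is shorter than `δ` and what remains is shorter than
      -- `(n + 1) δ`.
      set v : PathAlg B := ((n + 2 : ℝ)⁻¹) • u with hv
      have hn : (0 : ℝ) < n + 2 := by positivity
      have hvn : ‖v‖ < δ := by
        rw [hv, norm_smul, norm_inv, Real.norm_of_nonneg hn.le, inv_mul_lt_iff₀ hn]
        push_cast at hu
        linarith
      have huv : ‖u - v‖ < (n + 1) * δ := by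
        have e : u - v = ((n + 1 : ℝ) * (n + 2 : ℝ)⁻¹) • u := by
          rw [hv]
          nth_rewrite 1 [← one_smul ℝ u]
          rw [← sub_smul]
          congr 1
          field_simp
          ring
        rw [e, mul_smul, norm_smul, Real.norm_of_nonneg (by positivity)]
        exact mul_lt_mul_of_pos_left hvn (by positivity)
      obtain ⟨E, hE1, hE⟩ := ih _ huv
      obtain ⟨hF1, hF⟩ := hE₀ (y := adMulL B E hE.continuousOn v) (by
        rw [dist_zero_right, norm_adMulL]; exact hvn)
      refine ⟨fun t => E₀ (adMulL B E hE.continuousOn v) t * E t, ?_, ?_⟩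
      · change E₀ _ 0 * E 0 = 1
        rw [hF1, hE1, one_mul]
      · have := hE.add_adMulL hF
        rwa [sub_add_cancel] at this
  obtain ⟨n, hn⟩ := exists_nat_gt (‖u‖ / δ)
  refine key n u ?_
  rw [div_lt_iff₀ hδ] at hn
  linarith

variable (B) in
/-- The solution of `E⁻¹ E' = u`, `E 0 = 1`. -/
def transport (u : PathAlg B) : ℝ → G := (exists_transport u).choose

theorem transport_zero (u : PathAlg B) : transport B u 0 = 1 := (exists_transport u).choose_spec.1

theorem hasLeftLogDeriv_transport (u : PathAlg B) : HasLeftLogDeriv (transport B u) u :=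
  (exists_transport u).choose_spec.2

theorem continuousOn_transport (u : PathAlg B) : ContinuousOn (transport B u) (Icc 0 1) :=
  (hasLeftLogDeriv_transport u).continuousOn

theorem parallelTransport_eq_transport (u : PathAlg B) :
    parallelTransport B u = transport B u 1 := by
  unfold parallelTransport
  rw [dif_pos (exists_transport u)]
  rfl

theorem HasLeftLogDeriv.eqOn_transport {E : ℝ → G} {u : PathAlg B} (h : HasLeftLogDeriv E u) :
    EqOn E (fun t => E 0 * transport B u t) (Icc 0 1) :=
  h.unique ((hasLeftLogDeriv_transport u).const_mul _) (by rw [transport_zero, mul_one])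

theorem HasLeftLogDeriv.parallelTransport_eq {E : ℝ → G} {u : PathAlg B}
    (h : HasLeftLogDeriv E u) : parallelTransport B u = (E 0)⁻¹ * E 1 := by
  rw [parallelTransport_eq_transport, h.eqOn_transport (show (1 : ℝ) ∈ Icc (0 : ℝ) 1 by simp),
    inv_mul_cancel_left]

variable (B) in
/-- Pointwise application of `Ad(E_u t)`. -/
def adTransport (u : PathAlg B) : PathAlg B →L[ℝ] PathAlg B :=
  adMulL B (transport B u) (continuousOn_transport u)

theorem adTransport_ae (u v : PathAlg B) :
    ∀ᵐ t ∂unitVolume, adTransport B u v t = adB B (transport B u t) (v t) :=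
  adMulL_ae _ _ v

theorem parallelTransport_add (u v : PathAlg B) : parallelTransport B (u + v) =
    parallelTransport B (adTransport B u v) * parallelTransport B u := by
  rw [((hasLeftLogDeriv_transport u).add_adMulL
    (hasLeftLogDeriv_transport (adTransport B u v))).parallelTransport_eq]
  simp only [transport_zero, mul_one, inv_one, one_mul, parallelTransport_eq_transport]

theorem parallelTransport_zero : parallelTransport B (0 : PathAlg B) = 1 := by
  rw [(hasLeftLogDeriv_const (B := B) (1 : G)).parallelTransport_eq, inv_one, one_mul]

theorem contMDiffAt_parallelTransport_zero :
    ContMDiffAt 𝓘(ℝ, PathAlg B) 𝓘(ℝ, L) ∞ (parallelTransport B) 0 ∧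
      ∀ v : PathAlg B, (mfderiv 𝓘(ℝ, PathAlg B) 𝓘(ℝ, L) (parallelTransport B) 0 v : L) =
        equivL B (∫ t in (0 : ℝ)..1, v t) := by
  obtain ⟨E, hE, hEs, -, hEd⟩ := exists_local_transport B
  have e : parallelTransport B =ᶠ[𝓝 0] fun u => E u 1 := by
    filter_upwards [hE] with u hu
    rw [hu.2.parallelTransport_eq, hu.1, inv_one, one_mul]
  refine ⟨hEs.congr_of_eventuallyEq e, fun v => ?_⟩
  exact (congrArg (fun A : PathAlg B →L[ℝ] L => A v) e.mfderiv_eq).trans (hEd v)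

/-- Up to a right translation and an affine change of variable, `Φ` near `u` is `Φ` near `0`. -/
theorem parallelTransport_eq_conj (u x : PathAlg B) : parallelTransport B x =
    parallelTransport B (adTransport B u (x - u)) * parallelTransport B u := by
  rw [← parallelTransport_add, add_sub_cancel]

theorem contMDiff_parallelTransport :
    ContMDiff 𝓘(ℝ, PathAlg B) 𝓘(ℝ, L) ∞ (parallelTransport B) := by
  intro u
  have hA : ContMDiffAt 𝓘(ℝ, PathAlg B) 𝓘(ℝ, PathAlg B) ∞ (fun x => adTransport B u (x - u)) u := by
    refine ContDiffAt.contMDiffAt ?_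
    exact ((adTransport B u).contDiff.comp (contDiff_id.sub contDiff_const)).contDiffAt
  have hz : adTransport B u (u - u) = 0 := by rw [sub_self, map_zero]
  have h1 : ContMDiffAt 𝓘(ℝ, PathAlg B) 𝓘(ℝ, L) ∞
      (fun x => parallelTransport B (adTransport B u (x - u))) u := by
    refine ContMDiffAt.comp (I' := 𝓘(ℝ, PathAlg B)) (g := parallelTransport B) u ?_ hA
    rw [hz]
    exact contMDiffAt_parallelTransport_zero.1
  exact (h1.mul contMDiffAt_const).congr_of_eventuallyEq
    (Filter.Eventually.of_forall fun x => parallelTransport_eq_conj u x)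

theorem mdifferentiableAt_parallelTransport (u : PathAlg B) :
    MDifferentiableAt 𝓘(ℝ, PathAlg B) 𝓘(ℝ, L) (parallelTransport B) u :=
  contMDiff_parallelTransport.mdifferentiableAt (by simp)

/-- With `a = Φ(u)` one has `a⁻¹ Φ(x) = a⁻¹ Φ(Ad(E_u)(x - u)) a`, so the integral formula for `dΦ`
at `0` is only conjugated by `a⁻¹`. -/
theorem leftTriv_mfderiv_parallelTransport (u v : PathAlg B) :
    leftTriv B (parallelTransport B u)
      (mfderiv 𝓘(ℝ, PathAlg B) 𝓘(ℝ, L) (parallelTransport B) u v : L) =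
      adB B (parallelTransport B u)⁻¹ (∫ t in (0 : ℝ)..1, adTransport B u v t) := by
  set a := parallelTransport B u with ha
  have h1 := mfderiv_comp_apply_of_eq' (F := PathAlg B) (F' := L) (F'' := L) (x := u)
    (f := parallelTransport B) (g := fun x : G => a⁻¹ * x) (y := a) rfl
    (mdifferentiableAt_mul_left' _ _) (mdifferentiableAt_parallelTransport u) v
  have e : (fun x => a⁻¹ * parallelTransport B x) = fun x =>
      a⁻¹ * parallelTransport B (adTransport B u (x - u)) * a⁻¹⁻¹ := by
    funext x
    rw [parallelTransport_eq_conj u x, inv_inv, mul_assoc]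
  have hAd : HasFDerivAt (fun x => adTransport B u (x - u)) (adTransport B u) u := by
    have := (adTransport B u).hasFDerivAt (x := u - u) |>.comp (f := fun x => x - u) u
      ((hasFDerivAt_id u).sub_const u)
    exact this
  have hz : adTransport B u (u - u) = 0 := by rw [sub_self, map_zero]
  have h2 := mfderiv_comp_apply_of_eq' (F := PathAlg B) (F' := PathAlg B) (F'' := L) (x := u)
    (f := fun x => adTransport B u (x - u)) (g := parallelTransport B) (y := 0) hz
    (mdifferentiableAt_parallelTransport 0) hAd.differentiableAt.mdifferentiableAt v
  have h3 := mfderiv_comp_apply_of_eq' (F := PathAlg B) (F' := L) (F'' := L) (x := u)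
    (f := fun x => parallelTransport B (adTransport B u (x - u)))
    (g := fun x : G => a⁻¹ * x * a⁻¹⁻¹) (y := 1) (by rw [hz, parallelTransport_zero])
    (mdifferentiableAt_mul_left_right _ _ _)
    ((mdifferentiableAt_parallelTransport _).comp u hAd.differentiableAt.mdifferentiableAt) v
  rw [e] at h1
  have h4 : (mfderiv 𝓘(ℝ, PathAlg B) 𝓘(ℝ, PathAlg B) (fun x => adTransport B u (x - u)) u v :
      PathAlg B) = adTransport B u v := by
    rw [mfderiv_eq_fderiv, hAd.fderiv]
    rfl
  have h5 := contMDiffAt_parallelTransport_zero.2 (adTransport B u v)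
  refine congrArg (equivL B).symm (h1.symm.trans (h3.trans (congrArg (adL L a⁻¹) ?_)))
  exact h2.trans ((congrArg _ h4).trans h5)

/-! ## Horizontal vectors -/

variable (B) in
/-- The horizontal vector `Ad(E_u)⁻¹ c` at `u`. -/
def horizontalVector (u : PathAlg B) (c : LieAlg B) : PathAlg B :=
  adMulL B (fun t => (transport B u t)⁻¹)
    (hasLeftLogDeriv_transport u).inv_adMulL.continuousOn (Lp.const 2 unitVolume c)

theorem horizontalVector_ae (u : PathAlg B) (c : LieAlg B) :
    ∀ᵐ t ∂unitVolume, horizontalVector B u c t = adB B (transport B u t)⁻¹ c := by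
  filter_upwards [adMulL_ae (fun t => (transport B u t)⁻¹)
    (hasLeftLogDeriv_transport u).inv_adMulL.continuousOn (Lp.const 2 unitVolume c),
    Lp.coeFn_const (p := 2) (μ := unitVolume) c] with t h1 h2
  refine h1.trans ?_
  rw [h2]
  rfl

theorem norm_horizontalVector (u : PathAlg B) (c : LieAlg B) : ‖horizontalVector B u c‖ = ‖c‖ := by
  refine (norm_adMulL _ _ _).trans ?_
  refine (Lp.norm_const' (p := 2) (μ := unitVolume) (c := c) (by simp) (by simp)).trans ?_
  simp

theorem integral_adTransport_horizontalVector (u : PathAlg B) (c : LieAlg B) :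
    ∫ t in (0 : ℝ)..1, adTransport B u (horizontalVector B u c) t = c := by
  have : ∫ t in (0 : ℝ)..1, adTransport B u (horizontalVector B u c) t = ∫ t in (0 : ℝ)..1, c := by
    refine intervalIntegral_congr_unit ?_ (by simp) (by simp)
    filter_upwards [adTransport_ae u (horizontalVector B u c), horizontalVector_ae u c] with t h1 h2
    rw [h1, h2, adB_apply_inv_self]
  rw [this]
  simp

/-- By `Ad`-invariance, `c ↦ Ad(E_u)⁻¹ c` is the adjoint of `ζ ↦ ∫ Ad(E_u) ζ`, which is `dΦ_u` up to
trivialization. -/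
theorem inner_horizontalVector (u ζ : PathAlg B) (c : LieAlg B) :
    inner ℝ ζ (horizontalVector B u c) = inner ℝ (∫ t in (0 : ℝ)..1, adTransport B u ζ t) c := by
  rw [L2.inner_def, real_inner_comm, ← innerSL_apply_apply (𝕜 := ℝ), ←
    ContinuousLinearMap.intervalIntegral_comp_comm (innerSL ℝ c)
    ((integrable_lp_two _).intervalIntegrable_unit (by simp) (by simp)),
    intervalIntegral.integral_of_le zero_le_one, ← integral_Icc_eq_integral_Ioc]
  refine integral_congr_ae ?_
  filter_upwards [adTransport_ae u ζ, horizontalVector_ae u c] with t h1 h2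
  rw [h1, h2, innerSL_apply_apply, real_inner_comm, inner_adB_left, inv_inv]

theorem isRiemannianSubmersionOn_parallelTransport :
    IsRiemannianSubmersionOn (hilbertMetric (PathAlg B)) (biinvariantMetric B)
      (parallelTransport B) univ where
  isOpen := isOpen_univ
  contMDiffAt u _ := contMDiff_parallelTransport u
  exists_lift u _ η := by
    -- The factor `Ad(Φ(u))` cancels the `Ad(Φ(u)⁻¹)` in the formula for `dΦ`, and it is isometric.
    set c : LieAlg B := adB B (parallelTransport B u) (leftTriv B (parallelTransport B u) η) with hc
    have hη : (mfderiv 𝓘(ℝ, PathAlg B) 𝓘(ℝ, L) (parallelTransport B) u (horizontalVector B u c) : L)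
        = η := by
      apply leftTriv_injective (B := B) (parallelTransport B u)
      rw [leftTriv_mfderiv_parallelTransport, integral_adTransport_horizontalVector, hc,
        adB_inv_apply_self]
    refine ⟨horizontalVector B u c, hη, fun ζ => ?_⟩
    refine (inner_horizontalVector u ζ c).trans ?_
    refine Eq.trans ?_ (biinvariantMetric_eq _ _ _).symm
    have := leftTriv_mfderiv_parallelTransport u ζ
    rw [this, hc, inner_adB_left, inv_inv]

end ParallelTransport

/-! ### Local openness from a surjective derivative. -/

theorem HasStrictFDerivAt.map_nhds_eq_of_surjective {V W : Type*} [NormedAddCommGroup V]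
    [NormedSpace ℝ V] [CompleteSpace V] [NormedAddCommGroup W] [NormedSpace ℝ W] [CompleteSpace W]
    {f : V → W} {f' : V →L[ℝ] W} {x : V} (hf : HasStrictFDerivAt f f' x)
    (h : Function.Surjective f') : Filter.map f (𝓝 x) = 𝓝 (f x) :=
  hf.map_nhds_eq_of_surj (LinearMap.range_eq_top.2 h)

/-! ## The image of the parallel transport map -/

section ParallelTransportImage

open LieAlg

variable {L : Type*} [NormedAddCommGroup L] [NormedSpace ℝ L]
  {G : Type*} [TopologicalSpace G] [ChartedSpace L G] [Group G] [LieGroup 𝓘(ℝ, L) ∞ G]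
  {B : AdInvariantInner L G} [FiniteDimensional ℝ L] [T2Space G]

theorem transport_mem_connectedComponent (u : PathAlg B) {t : ℝ} (ht : t ∈ Icc (0 : ℝ) 1) :
    transport B u t ∈ connectedComponent (1 : G) := by
  refine (isPreconnected_Icc.image _ (continuousOn_transport u)).subset_connectedComponent
    ⟨0, by simp, transport_zero u⟩ ⟨t, ht, rfl⟩

theorem parallelTransport_mem_connectedComponent (u : PathAlg B) :
    parallelTransport B u ∈ connectedComponent (1 : G) := by
  rw [parallelTransport_eq_transport]
  exact transport_mem_connectedComponent u (by simp)

theorem exists_parallelTransport_eq_mul (u v : PathAlg B) :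
    ∃ w, parallelTransport B w = parallelTransport B u * parallelTransport B v := by
  have hc := (hasLeftLogDeriv_transport v).inv_adMulL.continuousOn
  refine ⟨v + adMulL B _ hc u, ?_⟩
  rw [parallelTransport_add]
  congr 2
  refine Lp.ext ?_
  filter_upwards [adTransport_ae v (adMulL B _ hc u), adMulL_ae _ hc u] with t h1 h2
  rw [h1, h2, adB_apply_inv_self]

theorem exists_parallelTransport_eq_inv (u : PathAlg B) :
    ∃ w, parallelTransport B w = (parallelTransport B u)⁻¹ :=
  ⟨_, (hasLeftLogDeriv_transport u).inv_adMulL.parallelTransport_eq.trans (by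
    rw [transport_zero, inv_one, inv_one, one_mul, parallelTransport_eq_transport])⟩

theorem hasStrictFDerivAt_chart_parallelTransport (c : OpenPartialHomeomorph G L)
    (hcs : ContMDiffOn 𝓘(ℝ, L) 𝓘(ℝ, L) ∞ c c.source)
    {u : PathAlg B} (hu : parallelTransport B u ∈ c.source) :
    HasStrictFDerivAt (fun u : PathAlg B => c (parallelTransport B u))
      (fderiv ℝ (fun u : PathAlg B => c (parallelTransport B u)) u) u := by
  have hcd : ContMDiffAt 𝓘(ℝ, L) 𝓘(ℝ, L) ∞ c (parallelTransport B u) :=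
    hcs.contMDiffAt (c.open_source.mem_nhds hu)
  have hg : ContMDiffAt 𝓘(ℝ, PathAlg B) 𝓘(ℝ, L) ∞ (fun u : PathAlg B => c (parallelTransport B u)) u :=
    hcd.comp u (contMDiff_parallelTransport u)
  exact hg.contDiffAt.hasStrictFDerivAt (by simp)

theorem surjective_fderiv_chart_parallelTransport (c : OpenPartialHomeomorph G L)
    (hc : c.MDifferentiable 𝓘(ℝ, L) 𝓘(ℝ, L))
    {u : PathAlg B} (hu : parallelTransport B u ∈ c.source) :
    Function.Surjective (fderiv ℝ (fun u : PathAlg B => c (parallelTransport B u)) u) := by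
  intro z
  obtain ⟨y, hy⟩ := (hc.mfderiv_bijective hu).2 z
  obtain ⟨ξ, hξ, -⟩ := isRiemannianSubmersionOn_parallelTransport.exists_lift u (mem_univ u) y
  refine ⟨ξ, ?_⟩
  have h1 := mfderiv_comp_apply_of_eq' (F := PathAlg B) (F' := L) (F'' := L)
    (x := u) (f := parallelTransport B) (g := c) rfl (hc.mdifferentiableAt hu)
    (mdifferentiableAt_parallelTransport u) ξ
  rw [mfderiv_eq_fderiv] at h1
  exact h1.trans ((congrArg _ hξ).trans hy)

theorem range_parallelTransport_mem_nhds_of_chart (c : OpenPartialHomeomorph G L)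
    (hc : c.MDifferentiable 𝓘(ℝ, L) 𝓘(ℝ, L)) (hcs : ContMDiffOn 𝓘(ℝ, L) 𝓘(ℝ, L) ∞ c c.source)
    {u : PathAlg B} (hu : parallelTransport B u ∈ c.source) :
    range (parallelTransport B) ∈ 𝓝 (parallelTransport B u) := by
  have : CompleteSpace L := FiniteDimensional.complete ℝ L
  have hmap : Filter.map (fun u : PathAlg B => c (parallelTransport B u)) (𝓝 u) =
      𝓝 (c (parallelTransport B u)) :=
    HasStrictFDerivAt.map_nhds_eq_of_surjective
      (f := fun u : PathAlg B => c (parallelTransport B u))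
      (hasStrictFDerivAt_chart_parallelTransport c hcs hu)
      (surjective_fderiv_chart_parallelTransport c hc hu)
  have hsrc : parallelTransport B ⁻¹' c.source ∈ 𝓝 u :=
    (c.open_source.preimage (contMDiff_parallelTransport (B := B)).continuous).mem_nhds hu
  have himg := Filter.image_mem_map (m := fun u : PathAlg B => c (parallelTransport B u)) hsrc
  rw [hmap] at himg
  filter_upwards [c.open_source.mem_nhds hu, c.continuousAt hu himg] with x hx hx'
  obtain ⟨u, hu, hux⟩ := hx'
  exact ⟨u, c.injOn hu hx hux⟩

theorem range_parallelTransport_mem_nhds : range (parallelTransport B) ∈ 𝓝 (1 : G) := by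
  have h := range_parallelTransport_mem_nhds_of_chart (B := B) (chartAt L (1 : G))
    (mdifferentiable_chart (I := 𝓘(ℝ, L)) (1 : G)) contMDiffOn_chart (u := 0)
    (by rw [parallelTransport_zero]; exact mem_chart_source L 1)
  rwa [parallelTransport_zero] at h

variable (B) in
-- The cocycle identity makes the image a subgroup, and the submersion property makes it a
-- neighbourhood of `1`. An open subgroup is closed, so it contains the component.
theorem range_parallelTransport : range (parallelTransport B) = connectedComponent (1 : G) := by
  have : IsTopologicalGroup G := topologicalGroup_of_lieGroup 𝓘(ℝ, L) ∞
  refine subset_antisymm (range_subset_iff.2 parallelTransport_mem_connectedComponent) ?_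
  let Γ : Subgroup G :=
    { carrier := range (parallelTransport B)
      one_mem' := ⟨0, parallelTransport_zero⟩
      mul_mem' := by
        rintro _ _ ⟨u, rfl⟩ ⟨v, rfl⟩
        exact exists_parallelTransport_eq_mul u v
      inv_mem' := by
        rintro _ ⟨u, rfl⟩
        exact exists_parallelTransport_eq_inv u }
  have ho : IsOpen (Γ : Set G) := Γ.isOpen_of_mem_nhds (g := 1) range_parallelTransport_mem_nhds
  exact (IsClopen.connectedComponent_subset ⟨Γ.isClosed_of_isOpen ho, ho⟩ Γ.one_mem)

theorem isClosedSubmanifold_parallelTransport_preimage {A : Set G}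
    (hA : IsClosedSubmanifold L A) : IsClosedSubmanifold (PathAlg B) (parallelTransport B ⁻¹' A) := by
  have h := isRiemannianSubmersionOn_parallelTransport (B := B)
  have := h.isClosedSubmanifold_preimage hA (by
    rw [univ_inter]; exact hA.1.preimage contMDiff_parallelTransport.continuous)
  rwa [univ_inter] at this

/-! ## Gauge transformations -/

theorem HasRightLogDeriv.hasLeftLogDeriv_inv {g : ℝ → G} {w : PathAlg B}
    (h : HasRightLogDeriv g w) : HasLeftLogDeriv (fun t => (g t)⁻¹) (-w) := by
  have : IsTopologicalGroup G := topologicalGroup_of_lieGroup 𝓘(ℝ, L) ∞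
  have hc : ContinuousOn (fun t => (g t)⁻¹) (Icc 0 1) := h.1.inv
  have hz := adMulL_ae _ hc w
  refine ((hasRightLogDeriv_iff hz).1 h).inv ?_
  filter_upwards [hz, Lp.coeFn_neg w] with t h1 h2
  rw [h1, h2, Pi.neg_apply, adB_apply_inv_self]

theorem IsGaugeTransformation.exists_eq {g : ℝ → G} {T : PathAlg B → PathAlg B}
    (h : IsGaugeTransformation g T) : ∃ hg : ContinuousOn g (Icc 0 1), ∃ w : PathAlg B,
      HasRightLogDeriv g w ∧ T = fun u => adMulL B g hg u - w := by
  obtain ⟨w, hw, hT⟩ := h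
  refine ⟨hw.1, w, hw, funext fun u => Lp.ext ?_⟩
  filter_upwards [hT u, adMulL_ae g hw.1 u, Lp.coeFn_sub (adMulL B g hw.1 u) w] with t h1 h2 h3
  rw [h1, h3, Pi.sub_apply, h2, ad_eq_adB]

/-- The path `E_u g⁻¹` has logarithmic derivative `Ad(g) u - g' g⁻¹ = T u` and starts at `g(0)⁻¹`.
-/
theorem IsGaugeTransformation.parallelTransport_eq {g : ℝ → G} {T : PathAlg B → PathAlg B}
    (h : IsGaugeTransformation g T) (u : PathAlg B) :
    parallelTransport B (T u) = g 0 * parallelTransport B u * (g 1)⁻¹ := by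
  obtain ⟨w, hw, hT⟩ := h
  have h1 := (hasLeftLogDeriv_transport u).mul hw.hasLeftLogDeriv_inv (z := T u) (by
    filter_upwards [hT u, Lp.coeFn_neg w] with t h1 h2
    rw [h1, h2, Pi.neg_apply, inv_inv, ad_eq_adB, sub_eq_add_neg])
  rw [h1.parallelTransport_eq, transport_zero, one_mul, inv_inv, ← mul_assoc,
    parallelTransport_eq_transport]

theorem inner_adMulL (g : ℝ → G) (hg : ContinuousOn g (Icc 0 1)) (u v : PathAlg B) :
    inner ℝ (adMulL B g hg u) (adMulL B g hg v) = inner ℝ u v :=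
  (LinearIsometry.mk (adMulL B g hg).toLinearMap (norm_adMulL g hg)).inner_map_map u v

theorem surjective_adMulL (g : ℝ → G) (hg : ContinuousOn g (Icc 0 1)) :
    Function.Surjective (adMulL B g hg) := by
  have : IsTopologicalGroup G := topologicalGroup_of_lieGroup 𝓘(ℝ, L) ∞
  intro u
  have hc : ContinuousOn (fun t => (g t)⁻¹) (Icc 0 1) := hg.inv
  refine ⟨adMulL B _ hc u, Lp.ext ?_⟩
  filter_upwards [adMulL_ae g hg (adMulL B _ hc u), adMulL_ae _ hc u] with t h1 h2
  rw [h1, h2, adB_apply_inv_self]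

theorem IsGaugeTransformation.exists_hasFDerivAt {g : ℝ → G} {T : PathAlg B → PathAlg B}
    (h : IsGaugeTransformation g T) : ∃ A : PathAlg B →L[ℝ] PathAlg B,
      Function.Surjective A ∧ (∀ u v, inner ℝ (A u) (A v) = inner ℝ u v) ∧
      ∀ u, HasFDerivAt T A u := by
  obtain ⟨hg, w, -, rfl⟩ := h.exists_eq
  exact ⟨adMulL B g hg, surjective_adMulL g hg, inner_adMulL g hg, fun u =>
    (adMulL B g hg).hasFDerivAt.sub_const w⟩

/-- For this `g` one has `E_u g⁻¹ = b⁻¹ E_u`, a constant left translate of `E_u`, so the logarithmic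
derivative is still `u`. This is the path through which a two-sided translation lifts to `L²`. -/
theorem exists_isGaugeTransformation_fixing (b : G) (u : PathAlg B) :
    ∃ T : PathAlg B → PathAlg B,
      IsGaugeTransformation (fun t => (transport B u t)⁻¹ * b * transport B u t) T ∧ T u = u := by
  have : IsTopologicalGroup G := topologicalGroup_of_lieGroup 𝓘(ℝ, L) ∞
  set g : ℝ → G := fun t => (transport B u t)⁻¹ * b * transport B u t with hgdef
  have hE := hasLeftLogDeriv_transport u
  have hg : ContinuousOn g (Icc 0 1) :=
    ((continuousOn_transport u).inv.mul continuousOn_const).mul (continuousOn_transport u)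
  have hgi : ContinuousOn (fun t => (g t)⁻¹) (Icc 0 1) := hg.inv
  -- The requirement `T u = u` forces this value of `g' g⁻¹`; the rest verifies it by the product
  -- rule.
  set w := adMulL B g hg u - u with hw
  have hz := adMulL_ae _ hgi w
  have hwr : HasRightLogDeriv g w := by
    rw [hasRightLogDeriv_iff hz]
    have h1 := hE.inv_adMulL.mul (hE.const_mul b) (z := adMulL B _ hgi w) (by
      filter_upwards [hz, Lp.coeFn_sub (adMulL B g hg u) u, adMulL_ae g hg u,
        Lp.coeFn_neg (adMulL B _ hE.continuousOn u), adMulL_ae _ hE.continuousOn u]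
        with t h1 h2 h3 h4 h5
      have e : (g t)⁻¹ = (b * transport B u t)⁻¹ * transport B u t := by
        simp only [hgdef]; group
      rw [h1, h2, Pi.sub_apply, h3, map_sub, adB_inv_apply_self, h4, Pi.neg_apply, h5, map_neg, e,
        ← adB_mul_apply, neg_add_eq_sub])
    refine h1.congr fun t _ => ?_
    simp only [hgdef, mul_assoc]
  refine ⟨fun x => adMulL B g hg x - w, ⟨w, hwr, fun x => ?_⟩, ?_⟩
  · filter_upwards [adMulL_ae g hg x, Lp.coeFn_sub (adMulL B g hg x) w] with t h1 h2
    rw [h2, Pi.sub_apply, h1, ad_eq_adB]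
  · simp only [hw, sub_sub_cancel]

/-! ## Compactness of families of horizontal vectors -/

/-- On compact `G` the differential of `f` is bounded, so an increment is at most a constant times
`∫ ‖u‖`. The constant does not depend on the path, which gives equicontinuity for bounded `u`. -/
theorem exists_holder_bound [CompactSpace G] {W : Type*} [NormedAddCommGroup W] [NormedSpace ℝ W]
    {f : G → W} (hf : ContMDiff 𝓘(ℝ, L) 𝓘(ℝ, W) ∞ f) : ∃ C : ℝ, 0 ≤ C ∧
      ∀ (E : ℝ → G) (u : PathAlg B), HasLeftLogDeriv E u → ∀ s ∈ Icc (0 : ℝ) 1,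
        ∀ t ∈ Icc (0 : ℝ) 1, ‖f (E t) - f (E s)‖ ≤ C * ‖u‖ * √|t - s| := by
  have hcont : ContinuousOn (ld B f) univ := (continuous_ld hf).continuousOn
  obtain ⟨C, hC⟩ := (isCompact_univ (X := G)).exists_bound_of_continuousOn (f := ld B f) hcont
  have hC0 : 0 ≤ C := (norm_nonneg _).trans (hC 1 (mem_univ _))
  have key : ∀ (E : ℝ → G) (u : PathAlg B), HasLeftLogDeriv E u → ∀ s ∈ Icc (0 : ℝ) 1,
      ∀ t ∈ Icc (0 : ℝ) 1, s ≤ t → ‖f (E t) - f (E s)‖ ≤ C * ‖u‖ * √|t - s| := by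
    intro E u hE s hs t ht hst
    -- The logarithmic derivative is tested on real functions only, so the vector-valued increment
    -- is measured by a norming functional.
    obtain ⟨ℓ, hℓ, hℓv⟩ := exists_dual_vector'' ℝ (f (E t) - f (E s))
    have hℓf : ContMDiff 𝓘(ℝ, L) 𝓘(ℝ, ℝ) ∞ (fun x => ℓ (f x)) :=
      ℓ.contDiff.contMDiff.comp hf
    have h1 := hE.sub_eq hℓf hs ht
    rw [← map_sub, hℓv] at h1
    have h2 : ‖f (E t) - f (E s)‖ = ∫ r in s..t, ld B (fun x => ℓ (f x)) (E r) (u r) := h1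
    rw [h2]
    calc ∫ r in s..t, ld B (fun x => ℓ (f x)) (E r) (u r)
        ≤ ∫ r in s..t, C * ‖u r‖ := by
          refine intervalIntegral.integral_mono hst
            ((hE.integrable hℓf).intervalIntegrable_unit hs ht)
            (((integrable_lp_two u).norm.intervalIntegrable_unit hs ht).const_mul C) fun r => ?_
          rw [ld_comp (ψ := ℓ) hf ℓ.differentiableAt, ℓ.fderiv]
          refine (Real.le_norm_self _).trans ?_
          refine (ℓ.le_of_opNorm_le hℓ _).trans ?_
          rw [one_mul]
          exact (ld B f (E r)).le_of_opNorm_le (hC _ (mem_univ _)) _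
      _ = C * ∫ r in s..t, ‖u r‖ := intervalIntegral.integral_const_mul _ _
      _ ≤ C * (‖u‖ * √(t - s)) := by gcongr; exact intervalIntegral_norm_le u hs ht hst
      _ = _ := by rw [abs_of_nonneg (by linarith), mul_assoc]
  refine ⟨C, hC0, fun E u hE s hs t ht => ?_⟩
  rcases le_total s t with h | h
  · exact key E u hE s hs t ht h
  · rw [norm_sub_rev, abs_sub_comm]
    exact key E u hE t ht s hs h

/-- Arzelà–Ascoli applies: the Hölder bound gives equicontinuity, and as it also implies continuity,
the family is a closed subset of a product of balls in the space of all functions. -/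
theorem isCompact_setOf_holder {W : Type*} [NormedAddCommGroup W] [ProperSpace W] (r C : ℝ) :
    IsCompact {A : C(Icc (0 : ℝ) 1, W) | (∀ t, ‖A t‖ ≤ r) ∧
      ∀ s t : Icc (0 : ℝ) 1, ‖A t - A s‖ ≤ C * √|(t : ℝ) - s|} := by
  have hsq : ∀ s : Icc (0 : ℝ) 1, Filter.Tendsto (fun t : Icc (0 : ℝ) 1 => C * √|(t : ℝ) - s|)
      (𝓝 s) (𝓝 0) := fun s => by
    have : Continuous (fun t : Icc (0 : ℝ) 1 => C * √|(t : ℝ) - s|) := by fun_prop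
    simpa using this.tendsto s
  refine ArzelaAscoli.isCompact_of_equicontinuous _ ?_ ?_
  · have e : ContinuousMap.toFun '' {A : C(Icc (0 : ℝ) 1, W) | (∀ t, ‖A t‖ ≤ r) ∧
        ∀ s t : Icc (0 : ℝ) 1, ‖A t - A s‖ ≤ C * √|(t : ℝ) - s|} =
        (univ.pi fun _ => Metric.closedBall 0 r) ∩ {f : Icc (0 : ℝ) 1 → W |
          ∀ s t : Icc (0 : ℝ) 1, ‖f t - f s‖ ≤ C * √|(t : ℝ) - s|} := by
      ext f
      constructor
      · rintro ⟨A, hA, rfl⟩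
        exact ⟨fun t _ => mem_closedBall_zero_iff.2 (hA.1 t), hA.2⟩
      · rintro ⟨h1, h2⟩
        refine ⟨⟨f, continuous_iff_continuousAt.2 fun s => ?_⟩,
          ⟨fun t => mem_closedBall_zero_iff.1 (h1 t trivial), h2⟩, rfl⟩
        exact tendsto_iff_norm_sub_tendsto_zero.2
          (squeeze_zero (fun _ => norm_nonneg _) (fun t => h2 s t) (hsq s))
    rw [e]
    refine (isCompact_univ_pi fun _ => isCompact_closedBall 0 r).inter_right ?_
    simp only [ofPred_forall]
    exact isClosed_iInter fun s => isClosed_iInter fun t =>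
      isClosed_le ((continuous_apply t).sub (continuous_apply s)).norm continuous_const
  · intro s
    rw [Metric.equicontinuousAt_iff_right]
    intro ε hε
    filter_upwards [(hsq s).eventually (gt_mem_nhds hε)] with t ht A
    rw [dist_comm, dist_eq_norm]
    exact (A.2.2 s t).trans_lt ht

variable (B) in
-- The paths `Ad(E_u)⁻¹` with `‖u‖ ≤ r` are uniformly Hölder and isometric, and `‖c‖` equals the
-- norm of the horizontal vector. Applying paths to constants is continuous, so a compact product of
-- such paths and a ball has compact image.
theorem exists_isCompact_horizontalVector [CompactSpace G] (r : ℝ) :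
    ∃ K : Set (PathAlg B), IsCompact K ∧ ∀ u ξ : PathAlg B, ‖u‖ ≤ r → ‖ξ‖ ≤ r →
      ξ ∈ range (horizontalVector B u) → ξ ∈ K := by
  obtain ⟨C, hC0, hC⟩ := exists_holder_bound (B := B) (contMDiff_comp_inv (contMDiff_adB B))
  have : ProperSpace (LieAlg B) := FiniteDimensional.proper ℝ _
  have : ProperSpace (LieAlg B →L[ℝ] LieAlg B) :=
    FiniteDimensional.proper ℝ (LieAlg B →L[ℝ] LieAlg B)
  have hK := (isCompact_setOf_holder (W := LieAlg B →L[ℝ] LieAlg B) 1 (C * r)).prod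
    (isCompact_closedBall (0 : LieAlg B) r)
  have hcont : Continuous (fun q : C(Icc (0 : ℝ) 1, LieAlg B →L[ℝ] LieAlg B) × LieAlg B =>
      pathApplyL (LieAlg B) (LieAlg B) q.1 (Lp.constL 2 unitVolume ℝ q.2)) := by
    fun_prop
  refine ⟨_, hK.image hcont, ?_⟩
  rintro u ξ hu hξ ⟨c, rfl⟩
  rw [norm_horizontalVector] at hξ
  have hE := hasLeftLogDeriv_transport u
  refine ⟨(adPath B (fun t => (transport B u t)⁻¹) hE.inv_adMulL.continuousOn, c),
    ⟨⟨fun t => ?_, fun s t => ?_⟩, mem_closedBall_zero_iff.2 hξ⟩, rfl⟩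
  · exact ContinuousLinearMap.opNorm_le_bound _ zero_le_one fun v => by
      rw [one_mul]; exact (norm_adB _ v).le
  · refine (hC _ u hE s s.2 t t.2).trans ?_
    gcongr

variable (B) in
-- A vector orthogonal to the kernel of `d(f ∘ Φ)` is orthogonal to `ker dΦ`, hence horizontal, and
-- bounded families of horizontal vectors are relatively compact.
theorem isPFSubmanifold_parallelTransport_preimage [CompactSpace G] {A : Set G}
    (hA : IsClosedSubmanifold L A) : IsPFSubmanifold (parallelTransport B ⁻¹' A) := by
  have hsub := isRiemannianSubmersionOn_parallelTransport (B := B)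
  refine isPFSubmanifold_of_horizontal
    (isClosedSubmanifold_parallelTransport_preimage hA)
    (fun u => range (horizontalVector B u)) (exists_isCompact_horizontalVector B) ?_
  obtain ⟨k, hk⟩ := hsub.exists_submersion_comp hA
  refine ⟨k, fun u hu => ?_⟩
  obtain ⟨U, hU, huU, -, f, hf, hfA, hd, hfs, -⟩ := hk u ⟨mem_univ _, hu⟩
  refine ⟨U, hU, huU, fun y => f (parallelTransport B y), contMDiffOn_iff_contDiffOn.1 hf,
    fun y hy => ⟨fun h => (hfA y hy).1 ⟨mem_univ _, h⟩, fun h => ((hfA y hy).2 h).2⟩,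
    fun y hy => ?_, fun y hy ξ hξ => ?_⟩
  · have := hfs y hy
    rwa [mfderiv_eq_fderiv] at this
  · have hker : ∀ v : PathAlg B, (∫ t in (0 : ℝ)..1, adTransport B y v t) = 0 → inner ℝ v ξ = 0 := by
      intro v hv
      refine hξ v ?_
      have h1 := hd y hy v
      rw [mfderiv_eq_fderiv] at h1
      refine h1.trans ?_
      have h2 : (mfderiv 𝓘(ℝ, PathAlg B) 𝓘(ℝ, L) (parallelTransport B) y v : L) = 0 := by
        apply leftTriv_injective (B := B) (parallelTransport B y)
        refine (leftTriv_mfderiv_parallelTransport y v).trans ?_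
        rw [hv, map_zero]
        exact (map_zero (leftTriv B (parallelTransport B y))).symm
      refine (congrArg _ h2).trans ?_
      exact map_zero _
    -- This `c` makes `ξ - Ad(E_y)⁻¹ c` vertical. It is then orthogonal to both of its terms, and so
    -- zero.
    set c := ∫ t in (0 : ℝ)..1, adTransport B y ξ t with hc
    have h0 : ∫ t in (0 : ℝ)..1, adTransport B y (ξ - horizontalVector B y c) t = 0 := by
      have e : ∫ t in (0 : ℝ)..1, adTransport B y (ξ - horizontalVector B y c) t =
          ∫ t in (0 : ℝ)..1, (adTransport B y ξ t - adTransport B y (horizontalVector B y c) t) := by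
        refine intervalIntegral_congr_unit ?_ (by simp) (by simp)
        rw [map_sub]
        exact Lp.coeFn_sub _ _
      rw [e, intervalIntegral.integral_sub
        ((integrable_lp_two _).intervalIntegrable_unit (by simp) (by simp))
        ((integrable_lp_two _).intervalIntegrable_unit (by simp) (by simp)),
        integral_adTransport_horizontalVector, hc, sub_self]
    have h1 := hker _ h0
    have h2 := inner_horizontalVector y (ξ - horizontalVector B y c) c
    rw [h0, inner_zero_left] at h2
    have h3 : inner ℝ (ξ - horizontalVector B y c) (ξ - horizontalVector B y c) = 0 := by
      rw [inner_sub_right, h1, h2, sub_zero]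
    exact ⟨c, (sub_eq_zero.1 (inner_self_eq_zero.1 h3)).symm⟩

end ParallelTransportImage

/-! ## Schur's lemma for surjections onto irreducible representations -/

section Schur

variable {H : Type*} [NormedAddCommGroup H] [InnerProductSpace ℝ H] [FiniteDimensional ℝ H]
  {E : Type*} [NormedAddCommGroup E] [NormedSpace ℝ E]

/-- The symmetric operator representing the bilinear form `β (D v) (D w)`. -/
def pullbackOperator (D : H →L[ℝ] E) (β : E →L[ℝ] E →L[ℝ] ℝ) : H →ₗ[ℝ] H :=
  ∑ i, ((β.flip (D (stdOrthonormalBasis ℝ H i))).comp D : H →ₗ[ℝ] ℝ).smulRight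
    (stdOrthonormalBasis ℝ H i)

theorem inner_pullbackOperator (D : H →L[ℝ] E) (β : E →L[ℝ] E →L[ℝ] ℝ) (v w : H) :
    inner ℝ (pullbackOperator D β v) w = β (D v) (D w) := by
  conv_rhs => rw [← (stdOrthonormalBasis ℝ H).sum_repr' w]
  simp only [pullbackOperator, LinearMap.sum_apply, sum_inner, map_sum, map_smul,
    LinearMap.smulRight_apply, inner_smul_left]
  refine Finset.sum_congr rfl fun i _ => ?_
  simp [mul_comm]

/-- The pulled back form is represented by a symmetric operator commuting with all `A i`. It has an
eigenspace `U` for a nonzero eigenvalue `c`. This `U` is invariant, orthogonal to `ker D`, and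
mapped onto `E` by irreducibility, so it contains everything orthogonal to `ker D`. -/
theorem exists_pos_forall_eq_mul_inner (D : H →L[ℝ] E) (β : E →L[ℝ] E →L[ℝ] ℝ)
    (hβs : ∀ x y, β x y = β y x) (hβp : ∀ x, x ≠ 0 → 0 < β x x) (hD : Function.Surjective D)
    [Nontrivial E] {ι : Type*} (A : ι → H →L[ℝ] H) (k : ι → E →L[ℝ] E)
    (hA : ∀ i v w, inner ℝ (A i v) (A i w) = inner ℝ v w) (hAs : ∀ i, Function.Surjective (A i))
    (hk : ∀ i x y, β (k i x) (k i y) = β x y) (hDA : ∀ i v, D (A i v) = k i (D v))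
    (hirr : ∀ W : Submodule ℝ E, (∀ i, ∀ x ∈ W, k i x ∈ W) → W = ⊥ ∨ W = ⊤) :
    ∃ c : ℝ, 0 < c ∧ ∀ v, (∀ z, D z = 0 → inner ℝ z v = 0) → β (D v) (D v) = c * inner ℝ v v := by
  set P := pullbackOperator D β with hP
  have hPi := inner_pullbackOperator D β
  have hPs : P.IsSymmetric := fun v w => by
    rw [hPi, real_inner_comm, hPi, hβs]
  obtain ⟨x₀, hx₀⟩ := exists_ne (0 : E)
  obtain ⟨v₀, hv₀⟩ := hD x₀
  have hpos : 0 < inner ℝ (P v₀) v₀ := by rw [hPi, hv₀]; exact hβp _ hx₀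
  have hP0 : P ≠ 0 := fun h => by rw [h] at hpos; simp at hpos
  obtain ⟨c, hc, hcP⟩ : ∃ c : ℝ, c ≠ 0 ∧ Module.End.HasEigenvalue P c := by
    by_contra! hcon
    refine hP0 (LinearMap.ext fun v => ?_)
    have htop : Module.End.eigenspace P 0 = ⊤ := by
      have h1 := hPs.orthogonalComplement_iSup_eigenspaces_eq_bot
      rw [Submodule.orthogonal_eq_bot_iff] at h1
      rw [eq_top_iff, ← h1]
      refine iSup_le fun c => ?_
      by_cases hc0 : c = 0
      · rw [hc0]
      · have := hcon c hc0
        rw [Module.End.hasEigenvalue_iff, not_not] at this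
        rw [this]
        exact bot_le
    have : v ∈ Module.End.eigenspace P 0 := by rw [htop]; trivial
    rw [Module.End.mem_eigenspace_iff] at this
    simpa using this
  set U := Module.End.eigenspace P c with hU
  have hUm : ∀ v, v ∈ U ↔ P v = c • v := fun v => Module.End.mem_eigenspace_iff
  have hUA : ∀ i, ∀ v ∈ U, A i v ∈ U := by
    intro i v hv
    rw [hUm] at hv ⊢
    refine ext_inner_right ℝ fun w => ?_
    obtain ⟨w, rfl⟩ := hAs i w
    rw [hPi, hDA, hDA, hk, ← hPi, hv, inner_smul_left, inner_smul_left, hA]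
  obtain ⟨v₁, hv₁, hv₁0⟩ := hcP.exists_hasEigenvector
  have hUpos : ∀ v ∈ U, D v = 0 → v = 0 := by
    intro v hv hDv
    have h1 := hPi v v
    rw [hDv, map_zero, (hUm v).1 hv, inner_smul_left] at h1
    simpa [hc] using h1
  have hmap : U.map (D : H →ₗ[ℝ] E) = ⊤ := by
    refine (hirr _ ?_).resolve_left fun h => hv₁0 (hUpos v₁ hv₁ ?_)
    · rintro i _ ⟨v, hv, rfl⟩
      exact ⟨A i v, hUA i v hv, hDA i v⟩
    · have : D v₁ ∈ U.map (D : H →ₗ[ℝ] E) := ⟨v₁, hv₁, rfl⟩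
      rwa [h, Submodule.mem_bot] at this
  have hval : ∀ v ∈ U, β (D v) (D v) = c * inner ℝ v v := fun v hv => by
    rw [← hPi, (hUm v).1 hv, inner_smul_left]; rfl
  refine ⟨c, ?_, fun v hv => ?_⟩
  · have h1 := hval v₁ hv₁
    have h2 := hβp (D v₁) fun h => hv₁0 (hUpos v₁ hv₁ h)
    have h3 : 0 < inner ℝ v₁ v₁ := real_inner_self_pos.2 hv₁0
    rw [h1] at h2
    exact pos_of_mul_pos_left h2 h3.le
  · obtain ⟨u, hu, huv⟩ : D v ∈ U.map (D : H →ₗ[ℝ] E) := by rw [hmap]; trivial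
    replace huv : D u = D v := huv
    have h0 : D (u - v) = 0 := by rw [map_sub, huv, sub_self]
    have h1 : inner ℝ (u - v) u = 0 := by
      have h2 := hPi u (u - v)
      rw [h0, map_zero, (hUm u).1 hu, inner_smul_left] at h2
      rw [real_inner_comm]
      simpa [hc] using h2
    have h2 : inner ℝ (u - v) (u - v) = 0 := by rw [inner_sub_right, h1, hv _ h0, sub_zero]
    rw [← sub_eq_zero.1 (inner_self_eq_zero.1 h2)]
    exact hval u hu

/-- Orthogonal projection off the kernel gives the lift, and polarizing the norm identity `h` gives
the pairing. -/
theorem exists_horizontal_lift (D : H →L[ℝ] E) (β : E →L[ℝ] E →L[ℝ] ℝ)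
    (hβs : ∀ x y, β x y = β y x) (hD : Function.Surjective D)
    (h : ∀ v, (∀ z, D z = 0 → inner ℝ z v = 0) → β (D v) (D v) = inner ℝ v v) (x : E) :
    ∃ v, D v = x ∧ ∀ z, inner ℝ z v = β (D z) x := by
  have hproj : ∀ v, ∃ w, D w = D v ∧ ∀ z, D z = 0 → inner ℝ z w = 0 := by
    intro v
    set K := LinearMap.ker (D : H →ₗ[ℝ] E)
    have hm : D (K.starProjection v) = 0 := K.starProjection_apply_mem v
    refine ⟨v - K.starProjection v, by rw [map_sub, hm, sub_zero], fun z hz => ?_⟩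
    exact (Submodule.mem_orthogonal _ _).1 (K.sub_starProjection_mem_orthogonal v) z hz
  obtain ⟨v₀, rfl⟩ := hD x
  obtain ⟨v, hv, hvo⟩ := hproj v₀
  refine ⟨v, hv, fun z => ?_⟩
  obtain ⟨w, hw, hwo⟩ := hproj z
  have h1 : inner ℝ z v = inner ℝ w v := by
    have : inner ℝ (z - w) v = 0 := hvo _ (by rw [map_sub, hw, sub_self])
    rw [inner_sub_left] at this
    linarith
  have h2 := h (w + v) fun z hz => by rw [inner_add_right, hwo z hz, hvo z hz, add_zero]
  have h3 := h w hwo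
  have h4 := h v hvo
  simp only [map_add, add_apply, inner_add_left, inner_add_right] at h2
  rw [hβs (D v) (D w), real_inner_comm w v] at h2
  rw [h1, ← hv, ← hw]
  linarith

end Schur

/-! ## Existence of invariant inner products -/

section Averaging

variable {L : Type*} [NormedAddCommGroup L] [NormedSpace ℝ L] [FiniteDimensional ℝ L]
  {G : Type*} [TopologicalSpace G] [ChartedSpace L G] [Group G] [LieGroup 𝓘(ℝ, L) ∞ G]

/-- Haar average of a Euclidean inner product over all `ρ(x⁻¹)`; left invariance of the measure
absorbs `ρ(a)`, as `ρ((a⁻¹ x)⁻¹) = ρ(x⁻¹) ρ(a)`. -/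
theorem exists_invariant_inner {G : Type*} [Group G] [TopologicalSpace G] [IsTopologicalGroup G]
    [CompactSpace G] [T2Space G] (ρ : G → L →L[ℝ] L) (hρ : Continuous ρ)
    (hmul : ∀ a b, ρ (a * b) = (ρ a).comp (ρ b)) (hone : ρ 1 = ContinuousLinearMap.id ℝ L) :
    ∃ β : L → L → ℝ, (∀ v w, β v w = β w v) ∧ (∀ u v w, β (u + v) w = β u w + β v w) ∧
      (∀ (c : ℝ) v w, β (c • v) w = c * β v w) ∧ (∀ v, 0 ≤ β v v) ∧ (∀ v, β v v = 0 → v = 0) ∧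
      ∀ a v w, β (ρ a v) (ρ a w) = β v w := by
  borelize G
  let μ : Measure G := Measure.haar
  let q : G → L → EuclideanSpace ℝ (Fin (Module.finrank ℝ L)) := fun a v => toEuclidean (ρ a⁻¹ v)
  have hq : ∀ v, Continuous fun a => q a v := fun v => by
    have : Continuous fun a : G => ρ a⁻¹ v := (hρ.comp continuous_inv).clm_apply continuous_const
    exact toEuclidean.continuous.comp this
  have hqc : ∀ v w, Continuous fun a => inner ℝ (q a v) (q a w) := fun v w => (hq v).inner (hq w)
  have hi : ∀ v w, Integrable (fun a => inner ℝ (q a v) (q a w)) μ := fun v w =>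
    (hqc v w).integrable_of_hasCompactSupport (HasCompactSupport.of_compactSpace _)
  have hqadd : ∀ a u v, q a (u + v) = q a u + q a v := fun a u v => by simp only [q, map_add]
  have hqsmul : ∀ a (c : ℝ) v, q a (c • v) = c • q a v := fun a c v => by simp only [q, map_smul]
  refine ⟨fun v w => ∫ a, inner ℝ (q a v) (q a w) ∂μ, fun v w => ?_, fun u v w => ?_,
    fun c v w => ?_, fun v => ?_, fun v hv => ?_, fun a v w => ?_⟩
  · simp only [real_inner_comm]
  · simp only [hqadd, inner_add_left]
    exact integral_add (hi u w) (hi v w)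
  · simp only [hqsmul, real_inner_smul_left]
    exact integral_const_mul _ _
  · exact integral_nonneg fun a => real_inner_self_nonneg
  · rw [integral_eq_zero_iff_of_nonneg (fun a => real_inner_self_nonneg) (hi v v)] at hv
    have h1 := congrFun ((Continuous.ae_eq_iff_eq μ (hqc v v) continuous_const).1 hv) 1
    have h2 : q 1 v = 0 := inner_self_eq_zero.1 h1
    simpa [q, hone] using h2
  · have h1 := integral_mul_left_eq_self (μ := μ) (fun x => inner ℝ (q x v) (q x w)) a⁻¹
    refine Eq.trans ?_ h1
    have h2 : ∀ x v, q (a⁻¹ * x) v = q x (ρ a v) := fun x v => by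
      simp only [q, mul_inv_rev, inv_inv, hmul, ContinuousLinearMap.comp_apply]
    simp only [h2]

variable (L G) in
theorem nonempty_adInvariantInner [CompactSpace G] [T2Space G] :
    Nonempty (AdInvariantInner L G) := by
  have : IsTopologicalGroup G := topologicalGroup_of_lieGroup 𝓘(ℝ, L) ∞
  obtain ⟨β, hs, ha, hc, hn, hd, hi⟩ := exists_invariant_inner (adL L : G → L →L[ℝ] L)
    contMDiff_adL.continuous adL_mul adL_one
  exact ⟨{
    core :=
      { inner := β
        conj_inner_symm := fun v w => hs w v
        re_inner_nonneg := hn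
        add_left := ha
        smul_left := fun v w c => hc c v w
        definite := hd }
    ad_invariant := hi }⟩

/-- A positive multiple of an invariant inner product. -/
def AdInvariantInner.smul (B : AdInvariantInner L G) (c : ℝ) (hc : 0 < c) :
    AdInvariantInner L G where
  core :=
    { inner := fun v w => c * B.core.inner v w
      conj_inner_symm := fun v w => congrArg (c * ·) (B.core.conj_inner_symm v w)
      re_inner_nonneg := fun v => mul_nonneg hc.le (B.core.re_inner_nonneg v)
      add_left := fun u v w =>
        (congrArg (c * ·) (B.core.add_left u v w)).trans (mul_add _ _ _)
      smul_left := fun v w r =>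
        (congrArg (c * ·) (B.core.smul_left v w r)).trans (mul_left_comm _ _ _)
      definite := fun v hv => B.core.definite v ((mul_eq_zero.1 hv).resolve_left hc.ne') }
  ad_invariant := fun a v w => congrArg (c * ·) (B.ad_invariant a v w)

end Averaging

/-! ### Sets preserved by a transformation. -/

theorem image_eq_of_mem_iff {X : Type*} {ν : X → X} {A : Set X} (hν : Function.Surjective ν)
    (h : ∀ y, ν y ∈ A ↔ y ∈ A) : ν '' A = A := by
  ext y
  constructor
  · rintro ⟨x, hx, rfl⟩
    exact (h x).2 hx
  · intro hy
    obtain ⟨x, rfl⟩ := hν y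
    exact ⟨x, (h x).1 hy, rfl⟩

theorem mem_iff_of_image_eq {X : Type*} {ν : X → X} {A : Set X} (hν : Function.Injective ν)
    (h : ν '' A = A) (y : X) : ν y ∈ A ↔ y ∈ A := by
  conv_lhs => rw [← h]
  exact hν.mem_set_image

/-! ## Two-sided translations of a Lie group -/

section TwoSidedTranslations

open LieAlg

variable {L : Type*} [NormedAddCommGroup L] [NormedSpace ℝ L]
  {G : Type*} [TopologicalSpace G] [ChartedSpace L G] [Group G] [LieGroup 𝓘(ℝ, L) ∞ G]
  {B : AdInvariantInner L G} [FiniteDimensional ℝ L]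

theorem bijective_mul_left_right (b₁ b₂ : G) : Function.Bijective (fun x : G => b₁ * x * b₂) :=
  ((Equiv.mulLeft b₁).trans (Equiv.mulRight b₂)).bijective

theorem image_connectedComponent_subset_of_fixed {G : Type*} [TopologicalSpace G] [Group G]
    [IsTopologicalGroup G] {b₁ b₂ a : G} (ha : a ∈ connectedComponent (1 : G))
    (hfix : b₁ * a * b₂ = a) :
    (fun x : G => b₁ * x * b₂) '' connectedComponent (1 : G) ⊆ connectedComponent (1 : G) := by
  have hc : Continuous (fun x : G => b₁ * x * b₂) := by fun_prop
  have h := hc.image_connectedComponent_subset a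
  rw [hfix] at h
  rwa [connectedComponent_eq ha]

theorem image_connectedComponent_eq_of_fixed {G : Type*} [TopologicalSpace G] [Group G]
    [IsTopologicalGroup G] {b₁ b₂ a : G} (ha : a ∈ connectedComponent (1 : G))
    (hfix : b₁ * a * b₂⁻¹ = a) :
    (fun x : G => b₁ * x * b₂⁻¹) '' connectedComponent (1 : G) = connectedComponent (1 : G) := by
  refine subset_antisymm (image_connectedComponent_subset_of_fixed ha hfix) fun y hy => ?_
  have hfix' : b₁⁻¹ * a * b₂ = a := by
    conv_lhs => rw [← hfix]
    group
  refine ⟨b₁⁻¹ * y * b₂, image_connectedComponent_subset_of_fixed ha hfix' ⟨y, hy, rfl⟩, ?_⟩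
  dsimp only
  group

/-- Fixing `a` means `b₁ = a b₂ a⁻¹`, whence `a⁻¹ (b₁ x b₂⁻¹) = b₂ (a⁻¹ x) b₂⁻¹`. So the
differential is `Ad(b₂)` in the left trivialization, which is isometric. -/
theorem leftTriv_mfderiv_of_fixed {b₁ b₂ a : G} (hfix : b₁ * a * b₂⁻¹ = a) (v : L) :
    leftTriv B a (mfderiv 𝓘(ℝ, L) 𝓘(ℝ, L) (fun x : G => b₁ * x * b₂⁻¹) a v : L) =
      adB B b₂ (leftTriv B a v) := by
  have h1 := mfderiv_comp_apply_of_eq' (F := L) (F' := L) (F'' := L) (x := a)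
    (f := fun x : G => b₁ * x * b₂⁻¹) (g := fun x : G => a⁻¹ * x) (y := a) hfix
    (mdifferentiableAt_mul_left' _ _) (mdifferentiableAt_mul_left_right _ _ _) v
  have h2 := mfderiv_comp_apply_of_eq' (F := L) (F' := L) (F'' := L) (x := a)
    (f := fun x : G => a⁻¹ * x) (g := fun x : G => b₂ * x * b₂⁻¹) (y := 1) (inv_mul_cancel a)
    (mdifferentiableAt_mul_left_right _ _ _) (mdifferentiableAt_mul_left' _ _) v
  have e : (fun x : G => a⁻¹ * (b₁ * x * b₂⁻¹)) = fun x => b₂ * (a⁻¹ * x) * b₂⁻¹ := by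
    funext x
    have h3 : b₁ = a * b₂ * a⁻¹ := by
      rw [eq_mul_inv_iff_mul_eq, ← mul_inv_eq_iff_eq_mul, hfix]
    rw [h3]
    group
  rw [e] at h1
  exact congrArg (equivL B).symm (h1.symm.trans h2)

theorem biinvariantMetric_mfderiv_of_fixed {b₁ b₂ a : G} (hfix : b₁ * a * b₂⁻¹ = a) (v w : L) :
    biinvariantMetric B a (mfderiv 𝓘(ℝ, L) 𝓘(ℝ, L) (fun x : G => b₁ * x * b₂⁻¹) a v : L)
      (mfderiv 𝓘(ℝ, L) 𝓘(ℝ, L) (fun x : G => b₁ * x * b₂⁻¹) a w : L) =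
      biinvariantMetric B a v w := by
  refine (biinvariantMetric_eq a _ _).trans ?_
  have h1 := leftTriv_mfderiv_of_fixed (B := B) hfix v
  have h2 := leftTriv_mfderiv_of_fixed (B := B) hfix w
  refine (congrArg₂ (inner ℝ) h1 h2).trans ?_
  exact inner_adB_adB _ _ _

theorem exists_mfderiv_eq_of_fixed (B : AdInvariantInner L G) {b₁ b₂ a : G}
    (hfix : b₁ * a * b₂⁻¹ = a) (v : L) :
    ∃ w : L, (mfderiv 𝓘(ℝ, L) 𝓘(ℝ, L) (fun x : G => b₁ * x * b₂⁻¹) a w : L) = v := by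
  refine ⟨leftTrivSymm B a (adB B b₂⁻¹ (leftTriv B a v)), leftTriv_injective (B := B) a ?_⟩
  refine (leftTriv_mfderiv_of_fixed hfix _).trans ?_
  rw [leftTriv_leftTrivSymm, adB_apply_inv_self]

theorem biinvariantMetric_sub_right (a : G) (ζ ξ ξ' : L) : biinvariantMetric B a ζ (ξ - ξ' : L) =
    biinvariantMetric B a ζ ξ - biinvariantMetric B a ζ ξ' := by
  refine (biinvariantMetric_eq a ζ (ξ - ξ')).trans ?_
  rw [map_sub, inner_sub_right]
  rfl

theorem biinvariantMetric_neg_right (a : G) (ζ ξ : L) : biinvariantMetric B a ζ (-ξ : L) =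
    - biinvariantMetric B a ζ ξ := by
  refine (biinvariantMetric_eq a ζ (-ξ)).trans ?_
  rw [map_neg, inner_neg_right]
  rfl

theorem biinvariantMetric_zero_left (a : G) (ζ : L) : biinvariantMetric B a (0 : L) ζ = 0 := by
  refine (biinvariantMetric_eq a 0 ζ).trans ?_
  rw [map_zero, inner_zero_left]

theorem eq_zero_of_biinvariantMetric_self (a : G) (ζ : L) (h : biinvariantMetric B a ζ ζ = 0) :
    ζ = 0 := by
  refine leftTriv_injective (B := B) a ?_
  rw [map_zero]
  exact inner_self_eq_zero.1 ((biinvariantMetric_eq a ζ ζ).symm.trans h)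

end TwoSidedTranslations

/-! ## The orbit map of the isometry group -/

section IsometryGroup

open LieAlg

variable {E : Type*} [NormedAddCommGroup E] [NormedSpace ℝ E]
  {M : Type*} [TopologicalSpace M] [ChartedSpace E M] [IsManifold 𝓘(ℝ, E) ∞ M]
  {m : Bundle.ContMDiffRiemannianMetric 𝓘(ℝ, E) ∞ E (fun x : M => TangentSpace 𝓘(ℝ, E) x)}

namespace RiemIsom

theorem inv_apply_self (a : RiemIsom m) (x : M) : a⁻¹ (a x) = x :=
  congrArg (fun b : RiemIsom m => b x) (inv_mul_cancel a)

theorem apply_inv_self (a : RiemIsom m) (x : M) : a (a⁻¹ x) = x :=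
  congrArg (fun b : RiemIsom m => b x) (mul_inv_cancel a)

theorem inv_apply_eq_of_apply_eq {a : RiemIsom m} {x y : M} (h : a x = y) : a⁻¹ y = x := by
  rw [← h, inv_apply_self]

theorem bijective (a : RiemIsom m) : Function.Bijective (a : M → M) :=
  ⟨fun x y h => by rw [← inv_apply_self a x, h, inv_apply_self],
    fun y => ⟨a⁻¹ y, apply_inv_self a y⟩⟩

instance [T2Space M] : T2Space (RiemIsom m) :=
  T2Space.of_injective_continuous (f := fun φ : RiemIsom m => (⟨φ, φ.contMDiff.continuous⟩ : C(M, M)))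
    (fun _ _ h => ext' fun x => congrArg (fun f : C(M, M) => f x) h) continuous_induced_dom

theorem mdifferentiableAt (a : RiemIsom m) (x : M) :
    MDifferentiableAt 𝓘(ℝ, E) 𝓘(ℝ, E) a x := a.contMDiff.mdifferentiableAt (by simp)

end RiemIsom

variable {L : Type*} [NormedAddCommGroup L] [NormedSpace ℝ L] [FiniteDimensional ℝ L]
  [ChartedSpace L (RiemIsom m)] [LieGroup 𝓘(ℝ, L) ∞ (RiemIsom m)]

/-- The differential at the identity of the orbit map, as a continuous linear map. -/
def orbitL (B : AdInvariantInner L (RiemIsom m)) (p : M) : LieAlg B →L[ℝ] E :=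
  (mfderiv 𝓘(ℝ, L) 𝓘(ℝ, E) (fun a : RiemIsom m => a p) 1 : L →L[ℝ] E).comp
    (equivL B : LieAlg B →L[ℝ] L)

variable (B : AdInvariantInner L (RiemIsom m))

theorem contMDiff_orbit
    (hsmooth : ContMDiff (𝓘(ℝ, L).prod 𝓘(ℝ, E)) 𝓘(ℝ, E) ∞ (fun q : RiemIsom m × M => q.1 q.2))
    (p : M) : ContMDiff 𝓘(ℝ, L) 𝓘(ℝ, E) ∞ (fun a : RiemIsom m => a p) :=
  hsmooth.comp (contMDiff_id.prodMk contMDiff_const)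

theorem mdifferentiableAt_orbit
    (hsmooth : ContMDiff (𝓘(ℝ, L).prod 𝓘(ℝ, E)) 𝓘(ℝ, E) ∞ (fun q : RiemIsom m × M => q.1 q.2))
    (p : M) (a : RiemIsom m) :
    MDifferentiableAt 𝓘(ℝ, L) 𝓘(ℝ, E) (fun a : RiemIsom m => a p) a :=
  (contMDiff_orbit hsmooth p).mdifferentiableAt (by simp)

/-- Since `k⁻¹ p = p`, one has `(k x k⁻¹) p = k (x p)`; differentiate at `x = 1`. -/
theorem orbitL_adB
    (hsmooth : ContMDiff (𝓘(ℝ, L).prod 𝓘(ℝ, E)) 𝓘(ℝ, E) ∞ (fun q : RiemIsom m × M => q.1 q.2))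
    {p : M} {k : RiemIsom m} (hk : k p = p) (v : LieAlg B) :
    orbitL B p (adB B k v) = (mfderiv 𝓘(ℝ, E) 𝓘(ℝ, E) k p (orbitL B p v : E) : E) := by
  have h1 := mfderiv_comp_apply_of_eq' (F := L) (F' := L) (F'' := E) (x := (1 : RiemIsom m))
    (f := fun x : RiemIsom m => k * x * k⁻¹) (g := fun a : RiemIsom m => a p) (y := 1) (by group)
    (mdifferentiableAt_orbit hsmooth p 1) (mdifferentiableAt_mul_left_right _ _ _) (equivL B v)
  have h2 := mfderiv_comp_apply_of_eq' (F := L) (F' := E) (F'' := E) (x := (1 : RiemIsom m))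
    (f := fun a : RiemIsom m => a p) (g := k) (y := p) rfl
    (k.mdifferentiableAt p) (mdifferentiableAt_orbit hsmooth p 1) (equivL B v)
  have e : (fun x : RiemIsom m => (k * x * k⁻¹) p) = fun x => k (x p) := by
    funext x
    change k (x (k⁻¹ p)) = _
    rw [RiemIsom.inv_apply_eq_of_apply_eq hk]
  rw [e] at h1
  exact h1.symm.trans h2

theorem mfderiv_orbit
    (hsmooth : ContMDiff (𝓘(ℝ, L).prod 𝓘(ℝ, E)) 𝓘(ℝ, E) ∞ (fun q : RiemIsom m × M => q.1 q.2))
    (p : M) (a : RiemIsom m) (v : L) :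
    (mfderiv 𝓘(ℝ, L) 𝓘(ℝ, E) (fun a : RiemIsom m => a p) a v : E) =
      (mfderiv 𝓘(ℝ, E) 𝓘(ℝ, E) a p (orbitL B p (leftTriv B a v) : E) : E) := by
  have h1 := mfderiv_comp_apply_of_eq' (F := L) (F' := L) (F'' := E) (x := a)
    (f := fun x : RiemIsom m => a⁻¹ * x) (g := fun a : RiemIsom m => a p) (y := 1)
    (inv_mul_cancel a) (mdifferentiableAt_orbit hsmooth p 1) (mdifferentiableAt_mul_left' _ _) v
  have h2 := mfderiv_comp_apply_of_eq' (F := L) (F' := E) (F'' := E) (x := a)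
    (f := fun x : RiemIsom m => (a⁻¹ * x) p) (g := a) (y := p)
    (RiemIsom.inv_apply_self a p)
    (a.mdifferentiableAt p) ((contMDiff_orbit hsmooth p).comp
      (contMDiff_const.mul contMDiff_id) |>.mdifferentiableAt (by simp)) v
  have e : (fun x : RiemIsom m => a ((a⁻¹ * x) p)) = fun x => x p := by
    funext x
    exact RiemIsom.apply_inv_self a (x p)
  rw [e] at h2
  exact h2.trans (congrArg _ h1)

/-- Every element of `G₀` is the end of a path with square integrable logarithmic derivative. By
homogeneity the orbit map has zero differential everywhere, so `f (E t p)` is constant for each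
smooth `f`. -/
theorem apply_eq_of_orbitL_eq_zero
    (hsmooth : ContMDiff (𝓘(ℝ, L).prod 𝓘(ℝ, E)) 𝓘(ℝ, E) ∞ (fun q : RiemIsom m × M => q.1 q.2))
    [FiniteDimensional ℝ E] [T2Space M] {p : M}
    (h : ∀ v, orbitL B p v = 0) {a : RiemIsom m} (ha : a ∈ identityComponent m) : a p = p := by
  rw [identityComponent, ← range_parallelTransport B] at ha
  obtain ⟨u, rfl⟩ := ha
  refine eq_of_forall_contMDiff_eq (L := E) fun f hf => ?_
  have h1 := (hasLeftLogDeriv_iff.1 (hasLeftLogDeriv_transport u)).2 (fun a => f (a p))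
    (hf.comp (contMDiff_orbit hsmooth p)) 1 (by simp)
  have h2 : ∀ b : RiemIsom m, ld B (fun a : RiemIsom m => f (a p)) b = 0 := fun b => by
    ext v
    have h3 := mfderiv_comp_apply_of_eq' (F := L) (F' := E) (F'' := ℝ) (x := (1 : RiemIsom m))
      (f := fun x : RiemIsom m => x p) (g := fun y => f (b y)) (y := p) rfl
      ((hf.comp b.contMDiff).mdifferentiableAt (by simp)) (mdifferentiableAt_orbit hsmooth p 1)
      (equivL B v)
    refine h3.trans ((congrArg _ (h v)).trans ?_)
    exact map_zero _
  simp only [h2, zero_apply, intervalIntegral.integral_zero, add_zero, transport_zero] at h1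
  rw [parallelTransport_eq_transport]
  exact h1

/-- The range is invariant under the isotropy group, so it is zero or everything. If it were zero,
transitivity would reduce `M` to a point, which contradicts `T_pM ≠ 0`. -/
theorem surjective_orbitL
    (hsmooth : ContMDiff (𝓘(ℝ, L).prod 𝓘(ℝ, E)) 𝓘(ℝ, E) ∞ (fun q : RiemIsom m × M => q.1 q.2))
    [FiniteDimensional ℝ E] [T2Space M]
    (htrans : ∀ x y : M, ∃ a ∈ identityComponent m, a x = y) {p : M}
    (hirr : IsIsotropyIrreducible m p) : Function.Surjective (orbitL B p) := by
  obtain ⟨hE, hirr⟩ := hirr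
  have hirr' : ∀ W : Submodule ℝ E, (∀ k ∈ identityComponent m, k p = p → ∀ v ∈ W,
      (mfderiv 𝓘(ℝ, E) 𝓘(ℝ, E) k p v : E) ∈ W) → W = ⊥ ∨ W = ⊤ := hirr
  have hinv : ∀ k ∈ identityComponent m, k p = p →
      ∀ v ∈ LinearMap.range (orbitL B p : LieAlg B →ₗ[ℝ] E),
      (mfderiv 𝓘(ℝ, E) 𝓘(ℝ, E) k p v : E) ∈ LinearMap.range (orbitL B p : LieAlg B →ₗ[ℝ] E) := by
    rintro k - hkp _ ⟨v, rfl⟩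
    exact ⟨adB B k v, orbitL_adB B hsmooth hkp v⟩
  rcases hirr' (LinearMap.range (orbitL B p : LieAlg B →ₗ[ℝ] E)) hinv with h | h
  · exfalso
    have h0 : ∀ v, orbitL B p v = 0 := fun v => by
      have : orbitL B p v ∈ LinearMap.range (orbitL B p : LieAlg B →ₗ[ℝ] E) := ⟨v, rfl⟩
      rw [h] at this
      exact this
    have hM : ∀ y : M, y = p := fun y => by
      obtain ⟨a, ha, rfl⟩ := htrans p y
      exact apply_eq_of_orbitL_eq_zero B hsmooth h0 ha
    have hE' : Nontrivial E := hE
    have : (𝓝[≠] (chartAt E p p)).NeBot := Module.punctured_nhds_neBot ℝ E _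
    -- The target of a chart of a one-point manifold would be an open singleton in a nonzero normed
    -- space.
    refine not_isOpen_singleton (chartAt E p p) ?_
    have e : (chartAt E p).target = {chartAt E p p} := by
      refine subset_antisymm (fun z hz => ?_) (singleton_subset_iff.2 (mem_chart_target E p))
      rw [mem_singleton_iff, ← (chartAt E p).right_inv hz, hM ((chartAt E p).symm z)]
    rw [← e]
    exact (chartAt E p).open_target
  · intro x
    have : (x : E) ∈ LinearMap.range (orbitL B p : LieAlg B →ₗ[ℝ] E) := by rw [h]; trivial
    exact this

theorem exists_isNormalHomogeneous
    (hsmooth : ContMDiff (𝓘(ℝ, L).prod 𝓘(ℝ, E)) 𝓘(ℝ, E) ∞ (fun q : RiemIsom m × M => q.1 q.2))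
    [FiniteDimensional ℝ E] [T2Space M] [CompactSpace (RiemIsom m)]
    (htrans : ∀ x y : M, ∃ a ∈ identityComponent m, a x = y) {p : M}
    (hirr : IsIsotropyIrreducible m p) :
    ∃ B : AdInvariantInner L (RiemIsom m), IsNormalHomogeneous B p := by
  obtain ⟨B⟩ := nonempty_adInvariantInner L (RiemIsom m)
  have hsurj := surjective_orbitL B hsmooth htrans hirr
  have hE : Nontrivial E := hirr.1
  obtain ⟨c, hc, hcv⟩ := exists_pos_forall_eq_mul_inner (orbitL B p)
    (m.inner p : E →L[ℝ] E →L[ℝ] ℝ) (m.symm p) (m.pos p) hsurj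
    (ι := {k : RiemIsom m // k ∈ identityComponent m ∧ k p = p})
    (fun k => adB B k.1) (fun k => (mfderiv 𝓘(ℝ, E) 𝓘(ℝ, E) k.1 p : E →L[ℝ] E))
    (fun k => inner_adB_adB k.1) (fun k v => ⟨adB B k.1⁻¹ v, adB_apply_inv_self k.1 v⟩)
    (fun k x y => by
      have h1 := k.1.preserves p x y
      have e : ∀ q : M, q = p → ∀ z w : E, (m.inner q : E →L[ℝ] E →L[ℝ] ℝ) z w =
          (m.inner p : E →L[ℝ] E →L[ℝ] ℝ) z w := by rintro q rfl z w; rfl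
      exact (e _ k.2.2 _ _).symm.trans h1)
    (fun k v => orbitL_adB B hsmooth k.2.2 v)
    (fun W hW => hirr.2 W fun k hk hkp v hv => hW ⟨k, hk, hkp⟩ v hv)
  -- Rescaling by the Schur factor leaves orthogonality unchanged.
  refine ⟨B.smul c hc, fun v hv => hcv v fun z hz => ?_, hsurj⟩
  exact (mul_eq_zero.1 (hv z hz)).resolve_left hc.ne'

/-- At `1` the lift comes from normal homogeneity. It is moved to `a` by left translation, which
covers the isometry `a` of `M`. -/
theorem isRiemannianSubmersionOn_orbit
    (hsmooth : ContMDiff (𝓘(ℝ, L).prod 𝓘(ℝ, E)) 𝓘(ℝ, E) ∞ (fun q : RiemIsom m × M => q.1 q.2))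
    {p : M} (hB : IsNormalHomogeneous B p) :
    IsRiemannianSubmersionOn (biinvariantMetric B) (fun x v w => m.inner x v w)
      (fun a : RiemIsom m => a p) (identityComponent m) where
  isOpen := by
    have : LocallyConnectedSpace (RiemIsom m) := ChartedSpace.locallyConnectedSpace L _
    exact isOpen_connectedComponent
  contMDiffAt a _ := contMDiff_orbit hsmooth p a
  exists_lift a _ η := by
    obtain ⟨v, hv, hvz⟩ := exists_horizontal_lift (orbitL B p)
      (m.inner p : E →L[ℝ] E →L[ℝ] ℝ) (m.symm p) hB.2 hB.1
      (mfderiv 𝓘(ℝ, E) 𝓘(ℝ, E) (a⁻¹ : RiemIsom m) (a p) η : E)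
    have h1 := mfderiv_comp_apply_of_eq' (F := E) (F' := E) (F'' := E) (x := a p)
      (f := (a⁻¹ : RiemIsom m)) (g := a) (y := p) (RiemIsom.inv_apply_self a p)
      (a.mdifferentiableAt p) ((a⁻¹).mdifferentiableAt (a p)) η
    have e : (fun x : M => a (a⁻¹ x)) = id := by
      funext x
      exact RiemIsom.apply_inv_self a x
    rw [e] at h1
    have h2 := h1.symm.trans (congrArg (fun A : E →L[ℝ] E => A η) (mfderiv_id (I := 𝓘(ℝ, E))))
    have hξ : (mfderiv 𝓘(ℝ, L) 𝓘(ℝ, E) (fun a : RiemIsom m => a p) a (leftTrivSymm B a v) : E) =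
        (η : E) := by
      refine (mfderiv_orbit B hsmooth p a _).trans ?_
      rw [leftTriv_leftTrivSymm, hv]
      exact h2
    refine ⟨leftTrivSymm B a v, hξ, fun ζ => ?_⟩
    have h3 : ∀ z : L, inner ℝ (leftTriv B a z) (leftTriv B a (leftTrivSymm B a v)) =
        (m.inner p : E →L[ℝ] E →L[ℝ] ℝ) (orbitL B p (leftTriv B a z))
          (mfderiv 𝓘(ℝ, E) 𝓘(ℝ, E) (a⁻¹ : RiemIsom m) (a p) η : E) := fun z => by
      rw [leftTriv_leftTrivSymm, hvz]
      rfl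
    refine (h3 ζ).trans ?_
    refine (a.preserves p (orbitL B p (leftTriv B a ζ))
      (mfderiv 𝓘(ℝ, E) 𝓘(ℝ, E) (a⁻¹ : RiemIsom m) (a p) η : E)).symm.trans ?_
    exact congrArg₂ (fun x y : E => (m.inner (a p) : E →L[ℝ] E →L[ℝ] ℝ) x y)
      (mfderiv_orbit B hsmooth p a ζ).symm h2

end IsometryGroup

/-! ## Transfer of reflections between `M`, its isometry group and the path space -/

section Transfer

open LieAlg

variable {E : Type*} [NormedAddCommGroup E] [NormedSpace ℝ E] [CompleteSpace E]
  {M : Type*} [TopologicalSpace M] [ChartedSpace E M] [IsManifold 𝓘(ℝ, E) ∞ M] [T2Space M]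
  {m : Bundle.ContMDiffRiemannianMetric 𝓘(ℝ, E) ∞ E (fun x : M => TangentSpace 𝓘(ℝ, E) x)}
  {L : Type*} [NormedAddCommGroup L] [NormedSpace ℝ L] [FiniteDimensional ℝ L]
  [ChartedSpace L (RiemIsom m)] [LieGroup 𝓘(ℝ, L) ∞ (RiemIsom m)]

/-- Parallel transport has values in `G₀`, so the restriction to `G₀` costs nothing. -/
theorem transportPreimage_eq (B : AdInvariantInner L (RiemIsom m)) (p : M) (N : Set M) :
    transportPreimage B p N = parallelTransport B ⁻¹' orbitPreimage p N := by
  ext u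
  exact ⟨fun h => ⟨parallelTransport_mem_connectedComponent u, h⟩, fun h => h.2⟩

variable {B : AdInvariantInner L (RiemIsom m)}
  {p : M} {N : Set M} {S : Subgroup (RiemIsom m)}

theorem isClosedSubmanifold_orbitPreimage
    (hsmooth : ContMDiff (𝓘(ℝ, L).prod 𝓘(ℝ, E)) 𝓘(ℝ, E) ∞ (fun q : RiemIsom m × M => q.1 q.2))
    (hB : IsNormalHomogeneous B p) (hN : IsClosedSubmanifold E N) :
    IsClosedSubmanifold L (orbitPreimage (m := m) p N) :=
  (isRiemannianSubmersionOn_orbit B hsmooth hB).isClosedSubmanifold_preimage hN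
    (isClosed_connectedComponent.inter (hN.1.preimage (contMDiff_orbit hsmooth p).continuous))

theorem conj_mem_of_normal (hS : ∀ a ∈ identityComponent m, ∀ s ∈ S, a * s * a⁻¹ ∈ S)
    [IsTopologicalGroup (RiemIsom m)] {a s : RiemIsom m} (ha : a ∈ identityComponent m)
    (hs : s ∈ S) : a⁻¹ * s * a ∈ S := by
  have h := hS a⁻¹ (inv_mem_connectedComponent_one ha) s hs
  rwa [inv_inv] at h

theorem hasReflections_orbitPreimage
    (hsmooth : ContMDiff (𝓘(ℝ, L).prod 𝓘(ℝ, E)) 𝓘(ℝ, E) ∞ (fun q : RiemIsom m × M => q.1 q.2))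
    (hB : IsNormalHomogeneous B p) (hN : IsClosedSubmanifold E N)
    (hS : ∀ a ∈ identityComponent m, ∀ s ∈ S, a * s * a⁻¹ ∈ S)
    (h : HasReflections E (fun x v w => m.inner x v w) (isometriesOf S) N) :
    HasReflections L (biinvariantMetric B) (twoSidedTranslations (prodIsotropy S p))
      (orbitPreimage p N) := by
  have : IsTopologicalGroup (RiemIsom m) := topologicalGroup_of_lieGroup 𝓘(ℝ, L) ∞
  refine (isRiemannianSubmersionOn_orbit B hsmooth hB).hasReflections_preimage
    biinvariantMetric_sub_right eq_zero_of_biinvariantMetric_self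
    (fun y η => by rw [map_zero]; rfl) biinvariantMetric_neg_right
    (fun y ζ ξ => map_neg _ _) hN ?_ ?_ h
  · rintro _ ⟨s, hs, rfl⟩ y hy
    refine ⟨s.mdifferentiableAt y, fun v w => ?_⟩
    have e : ∀ q : M, q = y → ∀ z w : E, (m.inner q : E →L[ℝ] E →L[ℝ] ℝ) z w =
        (m.inner y : E →L[ℝ] E →L[ℝ] ℝ) z w := by rintro q rfl z w; rfl
    exact (e _ hy _ _).symm.trans (s.preserves y v w)
  · rintro a ⟨ha, -⟩ _ ⟨s, hs, rfl⟩ hsa hsN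
    -- This choice makes `x ↦ s x b⁻¹` fix `a`. Then `b` fixes `p` because `s` fixes `a p`, and `b`
    -- is in `S` because `G₀` normalizes `S`.
    set b := a⁻¹ * s * a with hb
    have hbp : b p = p := by
      change a⁻¹ (s (a p)) = p
      rw [hsa, RiemIsom.inv_apply_self]
    have hbp' : b⁻¹ p = p := RiemIsom.inv_apply_eq_of_apply_eq hbp
    have hfix : s * a * b⁻¹ = a := by rw [hb]; group
    have hG := image_connectedComponent_eq_of_fixed ha hfix
    have hbij := bijective_mul_left_right s b⁻¹
    have hπ : ∀ y : RiemIsom m, (s * y * b⁻¹) p = s (y p) := fun y => by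
      change s (y (b⁻¹ p)) = _
      rw [hbp']
    refine ⟨fun x => s * x * b⁻¹, ⟨(s, b), ⟨hs, conj_mem_of_normal hS ha hs, hbp⟩, rfl, hG⟩, hfix,
      ?_, hπ, mdifferentiableAt_mul_left_right _ _ _, exists_mfderiv_eq_of_fixed B hfix,
      biinvariantMetric_mfderiv_of_fixed hfix⟩
    refine image_eq_of_mem_iff hbij.2 fun y => and_congr (mem_iff_of_image_eq hbij.1 hG y) ?_
    change (s * y * b⁻¹) p ∈ N ↔ y p ∈ N
    rw [hπ]
    exact mem_iff_of_image_eq s.bijective.1 hsN (y p)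

theorem hasReflections_of_orbitPreimage
    (hsmooth : ContMDiff (𝓘(ℝ, L).prod 𝓘(ℝ, E)) 𝓘(ℝ, E) ∞ (fun q : RiemIsom m × M => q.1 q.2))
    (htrans : ∀ x y : M, ∃ a ∈ identityComponent m, a x = y)
    (hB : IsNormalHomogeneous B p) (hN : IsClosedSubmanifold E N)
    (h : HasReflections L (biinvariantMetric B) (twoSidedTranslations (prodIsotropy S p))
      (orbitPreimage p N)) :
    HasReflections E (fun x v w => m.inner x v w) (isometriesOf S) N := by
  refine (isRiemannianSubmersionOn_orbit B hsmooth hB).hasReflections_of_preimage hN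
    (fun y _ => htrans p y) ?_ h
  rintro a - _ ⟨⟨s, b⟩, ⟨hs, -, hbp⟩, rfl, -⟩ - -
  refine ⟨s, ⟨s, hs, rfl⟩, fun y => ?_, s.mdifferentiableAt _,
    mdifferentiableAt_mul_left_right _ _ _⟩
  change s (y (b⁻¹ p)) = s (y p)
  rw [RiemIsom.inv_apply_eq_of_apply_eq hbp]

theorem hasReflections_transportPreimage
    (hS : ∀ a ∈ identityComponent m, ∀ s ∈ S, a * s * a⁻¹ ∈ S)
    (hA : IsClosedSubmanifold L (orbitPreimage (m := m) p N))
    (h : HasReflections L (biinvariantMetric B) (twoSidedTranslations (prodIsotropy S p))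
      (orbitPreimage p N)) :
    HasReflections (PathAlg B) (hilbertMetric (PathAlg B)) (gaugeGroup B S (prodIsotropy S p))
      (transportPreimage B p N) := by
  have : IsTopologicalGroup (RiemIsom m) := topologicalGroup_of_lieGroup 𝓘(ℝ, L) ∞
  have hsub := isRiemannianSubmersionOn_parallelTransport (B := B)
  rw [transportPreimage_eq, ← univ_inter (parallelTransport B ⁻¹' orbitPreimage p N)]
  refine hsub.hasReflections_preimage
    (fun _ ζ ξ ξ' => inner_sub_right (𝕜 := ℝ) (E := PathAlg B) ζ ξ ξ')
    (fun _ ζ hζ => inner_self_eq_zero (𝕜 := ℝ) (E := PathAlg B) |>.1 hζ)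
    biinvariantMetric_zero_left
    (fun _ ζ ξ => inner_neg_right (𝕜 := ℝ) (E := PathAlg B) ζ ξ) biinvariantMetric_neg_right
    hA ?_ ?_ h
  · rintro _ ⟨⟨s, b⟩, -, rfl, -⟩ y hy
    exact ⟨mdifferentiableAt_mul_left_right _ _ _, biinvariantMetric_mfderiv_of_fixed hy⟩
  · rintro u ⟨-, hu⟩ _ ⟨⟨s, b⟩, ⟨hs, hb, hbp⟩, rfl, -⟩ hfix himg
    -- The path `E_u⁻¹ s E_u` starts at `s`, ends at `Φ(u)⁻¹ s Φ(u) = b`, and stays in `S` since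
    -- `E_u` runs in `G₀`.
    obtain ⟨T, hT, hTu⟩ := exists_isGaugeTransformation_fixing (B := B) s u
    have hb' : (parallelTransport B u)⁻¹ * s * parallelTransport B u = b := by
      have h1 : s * parallelTransport B u * b⁻¹ = parallelTransport B u := hfix
      rw [mul_inv_eq_iff_eq_mul] at h1
      rw [mul_assoc, h1, inv_mul_cancel_left]
    have hg0 : (transport B u 0)⁻¹ * s * transport B u 0 = s := by rw [transport_zero]; group
    have hg1 : (transport B u 1)⁻¹ * s * transport B u 1 = b := by
      rw [← parallelTransport_eq_transport, hb']
    have hΦ : ∀ y, parallelTransport B (T y) = s * parallelTransport B y * b⁻¹ := fun y => by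
      rw [hT.parallelTransport_eq, hg0, hg1]
    obtain ⟨A, hAs, hAi, hAd⟩ := hT.exists_hasFDerivAt
    have hTs : Function.Surjective T := by
      obtain ⟨hg, w, -, rfl⟩ := hT.exists_eq
      intro y
      obtain ⟨x, hx⟩ := surjective_adMulL _ hg (y + w)
      exact ⟨x, by dsimp only; rw [hx, add_sub_cancel_right]⟩
    have hmf : ∀ v : PathAlg B,
        (mfderiv 𝓘(ℝ, PathAlg B) 𝓘(ℝ, PathAlg B) T u v : PathAlg B) = A v := fun v => by
      rw [mfderiv_eq_fderiv, (hAd u).fderiv]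
      rfl
    refine ⟨T, ⟨_, fun t ht => conj_mem_of_normal hS (transport_mem_connectedComponent u ht) hs,
      ?_, hT⟩, hTu, ?_, hΦ, (hAd u).differentiableAt.mdifferentiableAt, fun v => ?_, fun v w => ?_⟩
    · dsimp only
      rw [hg0, hg1]
      exact ⟨hs, hb, hbp⟩
    · refine image_eq_of_mem_iff hTs fun y => and_congr Iff.rfl ?_
      change parallelTransport B (T y) ∈ orbitPreimage p N ↔ parallelTransport B y ∈ orbitPreimage p N
      rw [hΦ]
      exact mem_iff_of_image_eq (bijective_mul_left_right s b⁻¹).1 himg (parallelTransport B y)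
    · obtain ⟨w, hw⟩ := hAs v
      exact ⟨w, (hmf w).trans hw⟩
    · exact (congrArg₂ (fun x y : PathAlg B => inner ℝ x y) (hmf v) (hmf w)).trans (hAi v w)

theorem hasReflections_of_transportPreimage
    (hA : IsClosedSubmanifold L (orbitPreimage (m := m) p N))
    (h : HasReflections (PathAlg B) (hilbertMetric (PathAlg B)) (gaugeGroup B S (prodIsotropy S p))
      (transportPreimage B p N)) :
    HasReflections L (biinvariantMetric B) (twoSidedTranslations (prodIsotropy S p))
      (orbitPreimage p N) := by
  have : IsTopologicalGroup (RiemIsom m) := topologicalGroup_of_lieGroup 𝓘(ℝ, L) ∞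
  have hsub := isRiemannianSubmersionOn_parallelTransport (B := B)
  rw [transportPreimage_eq, ← univ_inter (parallelTransport B ⁻¹' orbitPreimage p N)] at h
  refine hsub.hasReflections_of_preimage hA (fun a ha => ?_) ?_ h
  · have h1 : a ∈ range (parallelTransport B) := by
      rw [range_parallelTransport]
      exact ha.1
    obtain ⟨u, hu⟩ := h1
    exact ⟨u, mem_univ u, hu⟩
  · rintro u ⟨-, hu⟩ T ⟨g, -, hgp, hT⟩ hTu -
    have hΦ := hT.parallelTransport_eq
    have hfix : g 0 * parallelTransport B u * (g 1)⁻¹ = parallelTransport B u := by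
      rw [← hΦ, hTu]
    obtain ⟨A, -, -, hAd⟩ := hT.exists_hasFDerivAt
    -- The translation fixes the point `Φ(u)` of `G₀`, so it preserves the component `G₀`.
    exact ⟨fun x => g 0 * x * (g 1)⁻¹,
      ⟨(g 0, g 1), hgp, rfl, image_connectedComponent_eq_of_fixed hu.1 hfix⟩, hΦ,
      mdifferentiableAt_mul_left_right _ _ _, (hAd u).differentiableAt.mdifferentiableAt⟩

end Transfer

end

/-! ### The main theorem. -/

theorem theorem1
    {E : Type*} [NormedAddCommGroup E] [NormedSpace ℝ E] [FiniteDimensional ℝ E]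
    {M : Type*} [TopologicalSpace M] [T2Space M] [ChartedSpace E M] [IsManifold 𝓘(ℝ, E) ∞ M]
    (m : Bundle.ContMDiffRiemannianMetric 𝓘(ℝ, E) ∞ E (fun x : M => TangentSpace 𝓘(ℝ, E) x))
    {L : Type*} [NormedAddCommGroup L] [NormedSpace ℝ L] [FiniteDimensional ℝ L]
    [ChartedSpace L (RiemIsom m)] [LieGroup 𝓘(ℝ, L) ∞ (RiemIsom m)]
    (hsmooth : ContMDiff (𝓘(ℝ, L).prod 𝓘(ℝ, E)) 𝓘(ℝ, E) ∞
      (fun q : RiemIsom m × M => q.1 q.2))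
    [CompactSpace (RiemIsom m)]
    (htrans : ∀ x y : M, ∃ a ∈ identityComponent m, a x = y)
    (p : M) (hirr : IsIsotropyIrreducible m p)
    (N : Set M) (hN : IsClosedSubmanifold E N)
    (S : Subgroup (RiemIsom m)) (hSclosed : IsClosed (S : Set (RiemIsom m)))
    (hSnormal : ∀ a ∈ identityComponent m, ∀ s ∈ S, a * s * a⁻¹ ∈ S) :
    (∃ B : AdInvariantInner L (RiemIsom m), IsNormalHomogeneous B p) ∧
    ∀ B : AdInvariantInner L (RiemIsom m), IsNormalHomogeneous B p →
      List.TFAE [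
        IsWeaklyReflective E (fun x v w => m.inner x v w) (isometriesOf S) N,
        IsWeaklyReflective L (biinvariantMetric B)
          (twoSidedTranslations (prodIsotropy S p)) (orbitPreimage p N),
        IsPFSubmanifold (transportPreimage B p N) ∧
          IsWeaklyReflective (PathAlg B) (hilbertMetric (PathAlg B))
            (gaugeGroup B S (prodIsotropy S p)) (transportPreimage B p N)] := by
  have : CompleteSpace E := FiniteDimensional.complete ℝ E
  refine ⟨exists_isNormalHomogeneous hsmooth htrans hirr, fun B hB => ?_⟩
  have hA := isClosedSubmanifold_orbitPreimage hsmooth hB hN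
  -- The submanifold and proper Fredholm clauses hold for all preimages of `N`, so only the
  -- reflections are transferred, with the statement on `G₀` as the middle term.
  tfae_have 1 → 2 := fun h => ⟨hA, hasReflections_orbitPreimage hsmooth hB hN hSnormal h.2⟩
  tfae_have 2 → 1 := fun h => ⟨hN, hasReflections_of_orbitPreimage hsmooth htrans hB hN h.2⟩
  tfae_have 2 → 3 := fun h => by
    have hPF : IsPFSubmanifold (transportPreimage B p N) := by
      rw [transportPreimage_eq]
      exact isPFSubmanifold_parallelTransport_preimage B hA
    exact ⟨hPF, hPF.submanifold, hasReflections_transportPreimage hSnormal hA h.2⟩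
  tfae_have 3 → 2 := fun h => ⟨hA, hasReflections_of_transportPreimage hA h.2.2⟩
  tfae_finish
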